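/- **MAG model.** Let $0<\mu<1$ and $0<\gamma<\beta<\alpha<1$, and let $\Theta$ be the symmetric matrix with $\Theta[0,0]=\alpha$, $\Theta[0,1]=\Theta[1,0]=\beta$, $\Theta[1,1]=\gamma$. For $n,l\in\mathbb N$ the random graph $M(n,l,\mu,\Theta)$ on $n$ nodes is generated as follows. Each node $u$ receives an attribute vector $a(u)\in\{0,1\}^l$; all entries of all vectors are independent, and each equals $0$ with probability $\mu$ and $1$ with probability $1-\mu$. Given the attributes, every unordered pair $\{u,v\}$ of nodes is joined by an edge, independently of the other pairs, with probability $$P[u,v]=\prod_{i=1}^{l}\Theta[a_i(u),a_i(v)].$$ Let $\rho>0$ be a constant, and let the number of attributes be $l=l(n)\in\mathbb N$ with $l(n)/\log_2 n\to\rho$ as $n\to\infty$ (for example $l=\rho\log_2 n$ rounded to an integer). "With high probability" means with probability tending to $1$ as $n\to\infty$. **Theorem (Connectedness).** If $(1-\mu)^\rho<\frac12$, then the equation $$\left[\left(\frac{\mu}{\nu}\right)^{\nu}\left(\frac{1-\mu}{1-\nu}\right)^{1-\nu}\right]^{\rho}=\frac12$$ has exactly one solution $\nu$ in $(0,\mu)$.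 Define the connectedness criterion $$F_c(M)=\begin{cases}\bigl(\mu\beta+(1-\mu)\gamma\bigr)^{\rho} & \text{if }(1-\mu)^{\rho}\ge\frac12,\\[4pt] \Bigl[\bigl(\mu\alpha+(1-\mu)\beta\bigr)^{\nu}\bigl(\mu\beta+(1-\mu)\gamma\bigr)^{1-\nu}\Bigr]^{\rho} & \text{otherwise, with this }\nu.\end{cases}$$ If $F_c(M)>\frac12$, then $M(n,l,\mu,\Theta)$ is connected with high probability as $n\to\infty$. If $F_c(M)<\frac12$, then $M(n,l,\mu,\Theta)$ is disconnected with high probability as $n\to\infty$. -/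

import Mathlib

open MeasureTheory ProbabilityTheory Filter Topology
open scoped unitInterval

noncomputable section

namespace MAG

/-- The symmetric `2 × 2` affinity matrix with `Θ[0,0] = α`, `Θ[0,1] = Θ[1,0] = β`,
`Θ[1,1] = γ`. -/
def affinity (α β γ : I) : Matrix (Fin 2) (Fin 2) I :=
  !![α, β; β, γ]

lemma affinity_comm (α β γ : I) (x y : Fin 2) :
    affinity α β γ x y = affinity α β γ y x := by
  fin_cases x <;> fin_cases y <;> rfl

/-- An assignment of `l` binary attributes to each of `n` nodes. -/
abbrev Attributes (n l : ℕ) : Type := Fin n → Fin l → Fin 2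

/-- The probability `P[u,v] = ∏ i, Θ[aᵢ(u), aᵢ(v)]` of an edge, as a function of the
unordered pair `{u, v}`. -/
def edgeProb {n l : ℕ} (α β γ : I) (a : Attributes n l) : Sym2 (Fin n) → I :=
  Sym2.lift ⟨fun u v => ∏ i, affinity α β γ (a u i) (a v i), fun u v =>
    Finset.prod_congr rfl fun i _ => affinity_comm α β γ (a u i) (a v i)⟩

/-- The law of the attributes: all entries are independent and take the value `0` with
probability `μ` and the value `1` with probability `1 - μ`. -/
def attrLaw (n l : ℕ) (μ : I) : Measure (Attributes n l) :=
  Measure.pi fun _ => Measure.pi fun _ => bernoulliMeasure 0 1 μ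

/-- The law of the edge indicators for given attributes: independent over the unordered
pairs of nodes, the indicator of `{u, v}` being `true` with probability `P[u,v]`. -/
def edgeLaw {n l : ℕ} (α β γ : I) (a : Attributes n l) : Measure (Sym2 (Fin n) → Bool) :=
  Measure.pi fun e => bernoulliMeasure true false (edgeProb α β γ a e)

/-- The simple graph whose edges are the pairs of distinct nodes with indicator `true`;
self-edges are dropped. -/
def toGraph {n : ℕ} (X : Sym2 (Fin n) → Bool) : SimpleGraph (Fin n) :=
  SimpleGraph.fromEdgeSet {e | X e = true}

/-- The law of the MAG graph `M(n, l, μ, Θ)`, `Θ = [α β; β γ]`: draw the attributes, then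
the edges given the attributes. -/
def graphLaw (n l : ℕ) (μ α β γ : I) : Measure (SimpleGraph (Fin n)) :=
  (attrLaw n l μ).bind fun a => (edgeLaw α β γ a).map toGraph

instance (n l : ℕ) (μ : I) : IsProbabilityMeasure (attrLaw n l μ) := by
  unfold attrLaw; infer_instance

instance {n l : ℕ} (α β γ : I) (a : Attributes n l) :
    IsProbabilityMeasure (edgeLaw α β γ a) := by
  unfold edgeLaw; infer_instance

instance (n l : ℕ) (μ α β γ : I) : IsProbabilityMeasure (graphLaw n l μ α β γ) := by
  unfold graphLaw
  refine isProbabilityMeasure_bind (Measurable.of_discrete).aemeasurable (.of_forall fun a => ?_)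
  exact Measure.isProbabilityMeasure_map (Measurable.of_discrete).aemeasurable

/-- Every property of graphs is measurable, and its probability is the average over the
attributes of its conditional probability. -/
lemma graphLaw_apply (n l : ℕ) (μ α β γ : I) (S : Set (SimpleGraph (Fin n))) :
    graphLaw n l μ α β γ S = ∫⁻ a, edgeLaw α β γ a (toGraph ⁻¹' S) ∂attrLaw n l μ := by
  have : MeasurableSingletonClass (SimpleGraph (Fin n)) :=
    ⟨fun G => ⟨{G.Adj}, measurableSet_singleton _, by ext H; simp [SimpleGraph.adj_inj]⟩⟩
  have hS : MeasurableSet S := S.toFinite.measurableSet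
  rw [graphLaw, Measure.bind_apply hS (Measurable.of_discrete).aemeasurable]
  refine lintegral_congr fun a => ?_
  rw [Measure.map_apply Measurable.of_discrete hS]

/-- `ν ∈ (0, μ)` solves `[(μ/ν)^ν ((1-μ)/(1-ν))^(1-ν)]^ρ = 1/2`. -/
def IsRatio (μ ρ ν : ℝ) : Prop :=
  ν ∈ Set.Ioo 0 μ ∧
    ((μ / ν) ^ ν * ((1 - μ) / (1 - ν)) ^ (1 - ν)) ^ ρ = 1 / 2

open scoped Classical in
/-- The connectedness criterion function `F_c(M)`; the argument `ν` matters only when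
`(1 - μ)^ρ < 1/2`. -/
def criterion (μ α β γ ρ ν : ℝ) : ℝ :=
  if (1 - μ) ^ ρ ≥ 1 / 2 then (μ * β + (1 - μ) * γ) ^ ρ
  else ((μ * α + (1 - μ) * β) ^ ν * (μ * β + (1 - μ) * γ) ^ (1 - ν)) ^ ρ

/-- The property `Q` of graphs holds with high probability for `M(n, l n, μ, Θ)`: its
probability tends to `1` as the number `n` of nodes tends to infinity. -/
def WHP (l : ℕ → ℕ) (μ α β γ : I) (Q : ∀ n, SimpleGraph (Fin n) → Prop) : Prop :=
  Tendsto (fun n => graphLaw n (l n) μ α β γ {G | Q n G}) atTop (𝓝 1)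

end MAG

end

open MeasureTheory ProbabilityTheory Filter Topology
open scoped unitInterval

set_option linter.unusedSectionVars false

/-! Put `lam = log 2 / ρ`, so that `n` is about `exp (lam * l)`. A node with a fraction `ν` of zeros
has expected degree about `n * exp (degRate ν * l)`, and for `ν < μ` a given node has at most that
fraction with probability about `exp (-klRate ν * l)`. The degree grows with `ν` and `klRate`
decreases on `[0, μ]`. Hence the nodes most likely to be isolated are those with the fewest zeros
that still occur among `n` nodes: `klRate ν = lam`, or `ν = 0` if `klRate 0 ≤ lam`. For this `ν` the
criterion is `exp (degRate ν * ρ)`. Comparing it with `1 / 2` means asking whether `lam + degRate ν`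
is positive or negative, that is, whether the lightest nodes have exponentially large or
exponentially small expected degree.

Below the threshold, a slightly larger `ν` gives nodes that exist and have no edge; a first-moment
bound on a well-chosen sample of nodes suffices (`prob_connected_le`,
`Valid.exists_disconnected_bound`).

Above the threshold, Chernoff's bound excludes nodes lighter than a slightly smaller `ν`, so every
node has neighbours of the typical kind (`Valid.exists_climb`). Across such an edge the number of
zeros moves by an affine contraction with factor `|gapEig| < 1` towards `statZero * l`; boundedly
many steps lead from any node into the core of nodes with about the stationary fraction of zeros
(`Valid.connected_of_climb`).

It remains to join any two nodes of the core, by a second-moment argument for paths of bounded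
length. The paths are weighted so that their mean is an iterated kernel of the random walk on types.
This walk is a product over the attributes of a two-state chain, diagonalised explicitly in
`iterKer`; after `s₀` steps its density lies within a factor of about `exp (η * l)` of one, with `η`
as small as desired. The recursion of `IsCore.pexp_momentSum_le` then shows that one group of layers
joins the two nodes with probability at least `exp (-3 * η * l) / 12`. Exponentially many disjoint
groups are independent, so the failure probability is doubly exponentially small
(`IsCore.prob_not_reachable_le`, `Valid.exists_core`) and survives a union bound over all pairs. -/

namespace MAG

/-! ### Expectations over finite product spaces. -/

section ProductExpectation

variable {ι α : Type*} [Fintype ι] [DecidableEq ι] [Fintype α]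

/-- Expectation of `f` when the coordinates are independent, the `i`-th with weights `p i`. -/
noncomputable def pexp (p : ι → α → ℝ) (f : (ι → α) → ℝ) : ℝ :=
  ∑ y, (∏ i, p i (y i)) * f y

/-- Each `p i` is a probability vector. -/
structure IsWeight (p : ι → α → ℝ) : Prop where
  nonneg : ∀ i x, 0 ≤ p i x
  sum_eq_one : ∀ i, ∑ x, p i x = 1

variable {p : ι → α → ℝ} {f g : (ι → α) → ℝ}

lemma pexp_prod (p : ι → α → ℝ) (f : ι → α → ℝ) :
    pexp p (fun y => ∏ i, f i (y i)) = ∏ i, ∑ x, p i x * f i x := by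
  simp only [pexp, ← Finset.prod_mul_distrib]
  rw [Finset.prod_univ_sum]
  simp

lemma pexp_const (hp : IsWeight p) (c : ℝ) : pexp p (fun _ => c) = c := by
  have h := pexp_prod p (fun _ _ => (1 : ℝ))
  simp only [mul_one, hp.sum_eq_one, Finset.prod_const_one, pexp] at h
  rw [pexp, ← Finset.sum_mul, h, one_mul]

lemma pexp_sum {κ : Type*} (s : Finset κ) (f : κ → (ι → α) → ℝ) :
    pexp p (fun y => ∑ k ∈ s, f k y) = ∑ k ∈ s, pexp p (f k) := by
  simp only [pexp, Finset.mul_sum]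
  exact Finset.sum_comm

lemma pexp_add : pexp p (fun y => f y + g y) = pexp p f + pexp p g := by
  simp only [pexp, mul_add, Finset.sum_add_distrib]

lemma pexp_mul_left (c : ℝ) : pexp p (fun y => c * f y) = c * pexp p f := by
  simp only [pexp, Finset.mul_sum]
  exact Finset.sum_congr rfl fun _ _ => by ring

lemma pexp_sub : pexp p (fun y => f y - g y) = pexp p f - pexp p g := by
  simp only [pexp, mul_sub, Finset.sum_sub_distrib]

lemma pexp_mono (hp : IsWeight p) (h : ∀ y, f y ≤ g y) : pexp p f ≤ pexp p g :=
  Finset.sum_le_sum fun y _ =>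
    mul_le_mul_of_nonneg_left (h y) (Finset.prod_nonneg fun i _ => hp.nonneg i _)

lemma pexp_nonneg (hp : IsWeight p) (h : ∀ y, 0 ≤ f y) : 0 ≤ pexp p f :=
  Finset.sum_nonneg fun y _ =>
    mul_nonneg (Finset.prod_nonneg fun i _ => hp.nonneg i _) (h y)

/-- Fubini for the splitting of the coordinates into `s` and its complement. The coordinates that a
factor ignores are frozen at a base point `y₀`. -/
lemma pexp_mul_of_dependsOn_compl (hp : IsWeight p) (s : Set ι) (hf : DependsOn f s)
    (hg : DependsOn g sᶜ) : pexp p (fun y => f y * g y) = pexp p f * pexp p g := by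
  classical
  rcases isEmpty_or_nonempty (ι → α) with hE | ⟨⟨y₀⟩⟩
  · simp [pexp]
  set e := Equiv.piEquivPiSubtypeProd (fun i => i ∈ s) (fun _ => α) with he
  have key : ∀ F : (ι → α) → ℝ, pexp p F = ∑ u : {i // i ∈ s} → α, ∑ v : {i // i ∉ s} → α,
      (∏ i : {i // i ∈ s}, p i (u i)) * (∏ i : {i // i ∉ s}, p i (v i)) * F (e.symm (u, v)) := by
    intro F
    rw [pexp, ← e.symm.sum_comp, Fintype.sum_prod_type]
    refine Finset.sum_congr rfl fun u _ => Finset.sum_congr rfl fun v _ => ?_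
    congr 1
    rw [← Fintype.prod_subtype_mul_prod_subtype (fun i => i ∈ s)]
    congr 1
    · exact Finset.prod_congr rfl fun i _ => by
        simp [he, Equiv.piEquivPiSubtypeProd, i.2]
    · exact Finset.prod_congr rfl fun i _ => by
        simp [he, Equiv.piEquivPiSubtypeProd, i.2]
  have tot : ∀ (q : ι → Prop) [DecidablePred q],
      ∑ v : {i // q i} → α, ∏ i : {i // q i}, p i (v i) = 1 := by
    intro q _
    have := pexp_prod (fun (i : {i // q i}) => p i) (fun _ _ => (1 : ℝ))
    simpa [pexp, hp.sum_eq_one] using this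
  set u₀ : {i // i ∈ s} → α := fun i => y₀ i
  set v₀ : {i // i ∉ s} → α := fun i => y₀ i
  have hf' : ∀ u v, f (e.symm (u, v)) = f (e.symm (u, v₀)) := fun u v => hf fun i hi => by
    simp [he, Equiv.piEquivPiSubtypeProd, hi]
  have hg' : ∀ u v, g (e.symm (u, v)) = g (e.symm (u₀, v)) := fun u v => hg fun i hi => by
    have : i ∉ s := hi
    simp [he, Equiv.piEquivPiSubtypeProd, this]
  have e1 : pexp p f = ∑ u : {i // i ∈ s} → α,
      (∏ i : {i // i ∈ s}, p i (u i)) * f (e.symm (u, v₀)) := by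
    rw [key]
    refine Finset.sum_congr rfl fun u _ => ?_
    simp only [hf' u, ← Finset.sum_mul, ← Finset.mul_sum]
    rw [tot (fun i => i ∉ s), mul_one]
  have e2 : pexp p g = ∑ v : {i // i ∉ s} → α,
      (∏ i : {i // i ∉ s}, p i (v i)) * g (e.symm (u₀, v)) := by
    rw [key, Finset.sum_comm]
    refine Finset.sum_congr rfl fun v _ => ?_
    simp only [hg' _ v, ← Finset.sum_mul]
    rw [tot (fun i => i ∈ s), one_mul]
  rw [e1, e2, key, Finset.sum_mul_sum]
  refine Finset.sum_congr rfl fun u _ => Finset.sum_congr rfl fun v _ => ?_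
  rw [hf' u v, hg' u v]
  ring

lemma pexp_mul (hp : IsWeight p) {s t : Set ι} (hf : DependsOn f s) (hg : DependsOn g t)
    (hst : Disjoint s t) : pexp p (fun y => f y * g y) = pexp p f * pexp p g :=
  pexp_mul_of_dependsOn_compl hp s hf fun _ _ h =>
    hg fun i hi => h i (Set.disjoint_right.mp hst hi)

lemma pexp_finset_prod (hp : IsWeight p) {κ : Type*} (K : Finset κ) (F : κ → (ι → α) → ℝ)
    (s : κ → Set ι) (hF : ∀ k ∈ K, DependsOn (F k) (s k))
    (hs : ∀ k ∈ K, ∀ k' ∈ K, k ≠ k' → Disjoint (s k) (s k')) :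
    pexp p (fun y => ∏ k ∈ K, F k y) = ∏ k ∈ K, pexp p (F k) := by
  classical
  induction K using Finset.induction_on with
  | empty => simpa using pexp_const hp 1
  | insert k K hk ih =>
    simp only [Finset.prod_insert hk]
    rw [← ih (fun j hj => hF j (Finset.mem_insert_of_mem hj))
      (fun j hj j' hj' => hs j (Finset.mem_insert_of_mem hj) j' (Finset.mem_insert_of_mem hj'))]
    refine pexp_mul hp (s := s k) (t := ⋃ j ∈ K, s j) (hF k (Finset.mem_insert_self _ _)) ?_ ?_
    · intro y y' h
      refine Finset.prod_congr rfl fun j hj => hF j (Finset.mem_insert_of_mem hj) fun i hi => ?_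
      exact h i (Set.mem_biUnion hj hi)
    · rw [Set.disjoint_iUnion₂_right]
      intro j hj
      exact hs k (Finset.mem_insert_self _ _) j (Finset.mem_insert_of_mem hj)
        (fun h => hk (h ▸ hj))

variable [DecidableEq α]

lemma pexp_indicator (hp : IsWeight p) (i : ι) (x : α) :
    pexp p (fun y => if y i = x then 1 else 0) = p i x := by
  have h := pexp_prod p (fun j z => if j = i then (if z = x then 1 else 0) else (1 : ℝ))
  have e : (fun y : ι → α => ∏ j, if j = i then (if y j = x then 1 else 0) else (1 : ℝ)) =
      fun y => if y i = x then 1 else 0 := by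
    ext y
    rw [Finset.prod_ite_eq' Finset.univ i (fun j => if y j = x then (1 : ℝ) else 0)]
    simp
  rw [e] at h
  rw [h, Finset.prod_eq_single i]
  · simp
  · intro j _ hj
    simp [hj, hp.sum_eq_one]
  · simp

/-- Resampling one coordinate does not change the expectation. -/
lemma pexp_update (hp : IsWeight p) (i : ι) (f : (ι → α) → ℝ) :
    pexp p f = ∑ x, p i x * pexp p (fun y => f (Function.update y i x)) := by
  have h : f = fun y => ∑ x, (if y i = x then 1 else 0) * f (Function.update y i x) := by
    ext y; simp
  conv_lhs => rw [h]
  rw [pexp_sum]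
  refine Finset.sum_congr rfl fun x _ => ?_
  rw [pexp_mul_of_dependsOn_compl (f := fun y => if y i = x then 1 else 0) hp {i},
    pexp_indicator hp]
  · intro y y' h; simp [h i rfl]
  · intro y y' h
    refine congrArg f ?_
    ext j
    by_cases hj : j = i
    · subst hj; simp
    · simp [hj, h j hj]

/-- Averaging a function of one coordinate and of the others. -/
lemma pexp_coord (hp : IsWeight p) (i : ι) (F : α → (ι → α) → ℝ) {s : Set ι}
    (hF : ∀ x, DependsOn (F x) s) (hi : i ∉ s) :
    pexp p (fun y => F (y i) y) = ∑ x, p i x * pexp p (F x) := by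
  rw [pexp_update hp i]
  refine Finset.sum_congr rfl fun x _ => ?_
  congr 2
  ext y
  simp only [Function.update_self]
  exact hF x fun j hj => by
    have : j ≠ i := fun h => hi (h ▸ hj)
    simp [this]

lemma pexp_coord₂ (hp : IsWeight p) {i j : ι} (hij : i ≠ j) (F : α → α → (ι → α) → ℝ)
    {s : Set ι} (hF : ∀ x x', DependsOn (F x x') s) (hi : i ∉ s) (hj : j ∉ s) :
    pexp p (fun y => F (y i) (y j) y) =
      ∑ x, ∑ x', p i x * p j x' * pexp p (F x x') := by
  rw [pexp_coord hp i (fun x y => F x (y j) y) (s := insert j s)]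
  · refine Finset.sum_congr rfl fun x _ => ?_
    rw [pexp_coord hp j (F x) (hF x) hj, Finset.mul_sum]
    exact Finset.sum_congr rfl fun x' _ => by ring
  · intro x y y' h
    simp only [h j (Set.mem_insert _ _)]
    exact hF _ _ fun k hk => h k (Set.mem_insert_of_mem _ hk)
  · simp [hij, hi]

end ProductExpectation

/-! ### Conditional moments of weighted path counts. -/

section RandomGraph

/-- The weights of a Bernoulli variable. -/
def bern (q : ℝ) (b : Bool) : ℝ := if b = true then q else 1 - q

/-- The indicator of a Boolean. -/
def ind (b : Bool) : ℝ := if b = true then 1 else 0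

@[simp] lemma ind_mul_self (b : Bool) : ind b * ind b = ind b := by cases b <;> simp [ind]

variable {V X : Type*} [Fintype V] [DecidableEq V] [Fintype X] [DecidableEq X]

/-- Expectation over the edges, the types `a` of the nodes being given. -/
noncomputable def edgeExp (P : Sym2 X → ℝ) (a : V → X) (F : (Sym2 V → Bool) → ℝ) : ℝ :=
  pexp (fun e => bern (P (e.map a))) F

lemma isWeight_bern {P : Sym2 X → ℝ} (hP : ∀ e, P e ∈ Set.Icc 0 1) (a : V → X) :
    IsWeight (fun e : Sym2 V => bern (P (e.map a))) where
  nonneg e b := by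
    have := hP (e.map a)
    cases b <;> simp [bern, this.1, this.2]
  sum_eq_one e := by simp [bern]

lemma edgeExp_ind {P : Sym2 X → ℝ} (hP : ∀ e, P e ∈ Set.Icc 0 1) (a : V → X) (e : Sym2 V) :
    edgeExp P a (fun ξ => ind (ξ e)) = P (e.map a) := by
  have := pexp_indicator (isWeight_bern hP a) e true
  simpa [edgeExp, ind, bern] using this

lemma edgeExp_ind_mul {P : Sym2 X → ℝ} (hP : ∀ e, P e ∈ Set.Icc 0 1) (a : V → X)
    {e e' : Sym2 V} (h : e ≠ e') :
    edgeExp P a (fun ξ => ind (ξ e) * ind (ξ e')) = P (e.map a) * P (e'.map a) := by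
  rw [← edgeExp_ind hP a e, ← edgeExp_ind hP a e']
  refine pexp_mul (isWeight_bern hP a) (s := {e}) (t := {e'}) ?_ ?_ (by simpa using h)
  · intro y y' h; simp [h e rfl]
  · intro y y' h
    exact congrArg ind (h _ (Set.mem_singleton _))

/-- Weighted number of paths from `v` to `t` through one node of each of the layers
`L (j - 1), …, L 0`. -/
noncomputable def pathSum (c : X → X → ℝ) (c₀ : X → ℝ) (L : ℕ → Finset V) (t : V) :
    ℕ → V → (V → X) → (Sym2 V → Bool) → ℝ
  | 0, v, a, ξ => c₀ (a v) * ind (ξ s(v, t))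
  | j + 1, v, a, ξ => ∑ w ∈ L j, c (a v) (a w) * ind (ξ s(v, w)) * pathSum c c₀ L t j w a ξ

/-- Conditional first moment of `pathSum` for a node of type `y`. -/
noncomputable def meanSum (P : Sym2 X → ℝ) (c : X → X → ℝ) (c₀ : X → ℝ) (L : ℕ → Finset V)
    (z : X) : ℕ → X → (V → X) → ℝ
  | 0, y, _ => c₀ y * P s(y, z)
  | j + 1, y, a => ∑ w ∈ L j, c y (a w) * P s(y, a w) * meanSum P c c₀ L z j (a w) a

/-- Conditional mixed second moment of `pathSum` for two distinct nodes of types `y`, `y'`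
(first component) and conditional second moment for one node of type `y` (second component). -/
noncomputable def momentSum (P : Sym2 X → ℝ) (c : X → X → ℝ) (c₀ : X → ℝ) (L : ℕ → Finset V)
    (z : X) : ℕ → (X → X → (V → X) → ℝ) × (X → (V → X) → ℝ)
  | 0 => (fun y y' _ => (c₀ y * P s(y, z)) * (c₀ y' * P s(y', z)),
      fun y _ => c₀ y ^ 2 * P s(y, z))
  | j + 1 => (fun y y' a => ∑ w ∈ L j, ∑ w' ∈ L j,
        if w = w' then (c y (a w) * P s(y, a w)) * (c y' (a w) * P s(y', a w)) *
          (momentSum P c c₀ L z j).2 (a w) a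
        else (c y (a w) * P s(y, a w)) * (c y' (a w') * P s(y', a w')) *
          (momentSum P c c₀ L z j).1 (a w) (a w') a,
      fun y a => ∑ w ∈ L j, ∑ w' ∈ L j,
        if w = w' then (c y (a w) ^ 2 * P s(y, a w)) * (momentSum P c c₀ L z j).2 (a w) a
        else (c y (a w) * P s(y, a w)) * (c y (a w') * P s(y, a w')) *
          (momentSum P c c₀ L z j).1 (a w) (a w') a)

variable {P : Sym2 X → ℝ} {c : X → X → ℝ} {c₀ : X → ℝ} {L : ℕ → Finset V} {t : V} {z : X}

/-- The edges inside `T ∪ {t, v}` with at least one end in `T`. -/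
def edgesOf (T : Set V) (t v : V) : Set (Sym2 V) :=
  {e | (∃ p ∈ e, p ∈ T) ∧ ∀ p ∈ e, p ∈ T ∨ p = t ∨ p = v}

/-- For `j = 0` the only edge is `{v, t}`, which counts as an edge of `T` only if `v ∈ T`; hence the
alternative in `hv`. For `j > 0` every edge of a path has an end in a layer. -/
lemma pathSum_dependsOn (T : Set V) (a : V → X) (j : ℕ) (hL : ∀ i < j, ↑(L i) ⊆ T) (v : V)
    (hv : 0 < j ∨ v ∈ T) : DependsOn (pathSum c c₀ L t j v a) (edgesOf T t v) := by
  induction j generalizing v with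
  | zero =>
    intro ξ ξ' h
    have hv : v ∈ T := by simpa using hv
    have : s(v, t) ∈ edgesOf T t v := ⟨⟨v, by simp, hv⟩, by simp [hv]⟩
    simp [pathSum, h _ this]
  | succ j ih =>
    intro ξ ξ' h
    simp only [pathSum]
    refine Finset.sum_congr rfl fun w hw => ?_
    have hwT : w ∈ T := hL j (Nat.lt_succ_self j) hw
    have h1 : s(v, w) ∈ edgesOf T t v := ⟨⟨w, by simp, hwT⟩, by simp [hwT]⟩
    rw [h _ h1, ih (fun i hi => hL i (hi.trans (Nat.lt_succ_self j))) w (Or.inr hwT)]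
    intro e he
    refine h e ⟨he.1, fun p hp => ?_⟩
    rcases he.2 p hp with h | h | h
    · exact Or.inl h
    · exact Or.inr (Or.inl h)
    · exact Or.inl (h ▸ hwT)

/-- The union of the first `j` layers. -/
def layers (L : ℕ → Finset V) (j : ℕ) : Set V := ⋃ i ∈ Set.Iio j, (L i : Set V)

lemma subset_layers {i j : ℕ} (h : i < j) : (L i : Set V) ⊆ layers L j :=
  Set.subset_biUnion_of_mem (u := fun i => (L i : Set V)) (Set.mem_Iio.mpr h)

lemma layers_mono {i j : ℕ} (h : i ≤ j) : layers L i ⊆ layers L j :=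
  Set.biUnion_subset_biUnion_left (Set.Iio_subset_Iio h)

/-- After the first step a path stays inside the lower layers and `t`, so it never again touches its
starting node. This makes the first edge independent of the rest of the path. -/
lemma disjoint_singleton_edgesOf {T : Set V} {w v p : V} (hv : v ∉ T) (hvt : v ≠ t) (hw : w ∈ T) :
    s(v, p) ∉ edgesOf T t w := by
  rintro ⟨-, h⟩
  rcases h v (by simp) with h | h | h
  · exact hv h
  · exact hvt h
  · exact hv (h ▸ hw)

lemma edgeExp_pathSum_step (hP : ∀ e, P e ∈ Set.Icc 0 1) (a : V → X) (j : ℕ) {v w : V}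
    (hv : v ∉ layers L (j + 1)) (hvt : v ≠ t) (hw : w ∈ L j) :
    edgeExp P a (fun ξ => ind (ξ s(v, w)) * pathSum c c₀ L t j w a ξ) =
      P s(a v, a w) * edgeExp P a (pathSum c c₀ L t j w a) := by
  have hwT : w ∈ layers L (j + 1) := subset_layers (Nat.lt_succ_self j) hw
  rw [← Sym2.map_mk, ← edgeExp_ind hP a s(v, w)]
  refine pexp_mul (isWeight_bern hP a) (s := {s(v, w)}) (t := edgesOf (layers L (j + 1)) t w)
    ?_ (pathSum_dependsOn _ a j (fun i hi => subset_layers (hi.trans (Nat.lt_succ_self j))) w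
      (Or.inr hwT)) ?_
  · intro y y' h; simp [h _ rfl]
  · exact Set.disjoint_singleton_left.mpr (disjoint_singleton_edgesOf hv hvt hwT)

/-- Neither `v ≠ v'` nor `w ≠ w'` is needed: the first edges contain `v` or `v'`, and no later edge
does. -/
lemma edgeExp_pathSum_step₂ (hP : ∀ e, P e ∈ Set.Icc 0 1) (a : V → X) (j : ℕ) {v v' w w' : V}
    (hv : v ∉ layers L (j + 1)) (hvt : v ≠ t) (hv' : v' ∉ layers L (j + 1)) (hvt' : v' ≠ t)
    (hw : w ∈ L j) (hw' : w' ∈ L j) :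
    edgeExp P a (fun ξ => (ind (ξ s(v, w)) * ind (ξ s(v', w'))) *
        (pathSum c c₀ L t j w a ξ * pathSum c c₀ L t j w' a ξ)) =
      edgeExp P a (fun ξ => ind (ξ s(v, w)) * ind (ξ s(v', w'))) *
      edgeExp P a (fun ξ => pathSum c c₀ L t j w a ξ * pathSum c c₀ L t j w' a ξ) := by
  have hwT : w ∈ layers L (j + 1) := subset_layers (Nat.lt_succ_self j) hw
  have hwT' : w' ∈ layers L (j + 1) := subset_layers (Nat.lt_succ_self j) hw'
  have hsub := fun i (hi : i < j) => subset_layers (L := L) (hi.trans (Nat.lt_succ_self j))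
  refine pexp_mul (isWeight_bern hP a) (s := {s(v, w), s(v', w')})
    (t := edgesOf (layers L (j + 1)) t w ∪ edgesOf (layers L (j + 1)) t w') ?_ ?_ ?_
  · intro y y' h; simp [h s(v, w) (by simp), h s(v', w') (by simp)]
  · intro y y' h
    simp only
    rw [pathSum_dependsOn _ a j hsub w (Or.inr hwT) fun e he => h e (Or.inl he),
      pathSum_dependsOn _ a j hsub w' (Or.inr hwT') fun e he => h e (Or.inr he)]
  · rw [Set.disjoint_left]
    rintro e (rfl | rfl) (h | h)
    · exact disjoint_singleton_edgesOf hv hvt hwT h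
    · exact disjoint_singleton_edgesOf hv hvt hwT' h
    · exact disjoint_singleton_edgesOf hv' hvt' hwT h
    · exact disjoint_singleton_edgesOf hv' hvt' hwT' h

lemma notMem_layers_of_mem (hL : ∀ i j, i ≠ j → Disjoint (L i) (L j)) {j : ℕ} {w : V}
    (hw : w ∈ L j) : w ∉ layers L j := by
  simp only [layers, Set.mem_iUnion, not_exists]
  intro i hi h
  exact Finset.disjoint_left.mp (hL i j (ne_of_lt hi)) h hw

lemma edgeExp_pathSum (hP : ∀ e, P e ∈ Set.Icc 0 1) (hL : ∀ i j, i ≠ j → Disjoint (L i) (L j))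
    (ht : ∀ i, t ∉ L i) (a : V → X) (haz : a t = z) (j : ℕ) (v : V) (hv : v ∉ layers L j)
    (hvt : v ≠ t) :
    edgeExp P a (pathSum c c₀ L t j v a) = meanSum P c c₀ L z j (a v) a := by
  induction j generalizing v with
  | zero =>
    simp only [meanSum, ← haz, ← Sym2.map_mk]
    rw [← edgeExp_ind hP a]
    exact pexp_mul_left _
  | succ j ih =>
    have : pathSum c c₀ L t (j + 1) v a = fun ξ => ∑ w ∈ L j, c (a v) (a w) *
      (ind (ξ s(v, w)) * pathSum c c₀ L t j w a ξ) := by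
      ext ξ; simp only [pathSum, mul_assoc]
    rw [this, edgeExp, pexp_sum, meanSum]
    refine Finset.sum_congr rfl fun w hw => ?_
    rw [pexp_mul_left, ← edgeExp, edgeExp_pathSum_step hP a j hv hvt hw,
      ih w (notMem_layers_of_mem hL hw) fun h => ht j (h ▸ hw), mul_assoc]

/-- The two statements need each other: paths from distinct nodes may meet, and paths from one node
may separate. From distinct nodes the two first edges always differ. From a single node they
coincide when `w = w'`; the squared indicator then counts once, which produces the factor `c ^ 2 *
P`. -/
lemma edgeExp_pathSum_mul (hP : ∀ e, P e ∈ Set.Icc 0 1)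
    (hL : ∀ i j, i ≠ j → Disjoint (L i) (L j)) (ht : ∀ i, t ∉ L i) (a : V → X) (haz : a t = z)
    (j : ℕ) :
    (∀ v v', v ∉ layers L j → v' ∉ layers L j → v ≠ t → v' ≠ t → v ≠ v' →
      edgeExp P a (fun ξ => pathSum c c₀ L t j v a ξ * pathSum c c₀ L t j v' a ξ) =
        (momentSum P c c₀ L z j).1 (a v) (a v') a) ∧
    (∀ v, v ∉ layers L j → v ≠ t →
      edgeExp P a (fun ξ => pathSum c c₀ L t j v a ξ * pathSum c c₀ L t j v a ξ) =
        (momentSum P c c₀ L z j).2 (a v) a) := by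
  induction j with
  | zero =>
    constructor
    · intro v v' _ _ hv hv' hvv
      have e : (fun ξ => pathSum c c₀ L t 0 v a ξ * pathSum c c₀ L t 0 v' a ξ) =
          fun ξ => (c₀ (a v) * c₀ (a v')) * (ind (ξ s(v, t)) * ind (ξ s(v', t))) := by
        ext ξ; simp only [pathSum]; ring
      have hne : s(v, t) ≠ s(v', t) := by simp [hvv, hv]
      rw [e, edgeExp, pexp_mul_left, ← edgeExp, edgeExp_ind_mul hP a hne]
      simp only [Sym2.map_mk, haz, momentSum]
      ring
    · intro v _ hv
      have e : (fun ξ => pathSum c c₀ L t 0 v a ξ * pathSum c c₀ L t 0 v a ξ) =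
          fun ξ => (c₀ (a v) ^ 2) * (ind (ξ s(v, t))) := by
        ext ξ; simp only [pathSum]; conv_rhs => rw [← ind_mul_self]
        ring
      rw [e, edgeExp, pexp_mul_left, ← edgeExp, edgeExp_ind hP a]
      simp only [Sym2.map_mk, haz, momentSum]
  | succ j ih =>
    have expand : ∀ v v', (fun ξ => pathSum c c₀ L t (j + 1) v a ξ *
        pathSum c c₀ L t (j + 1) v' a ξ) = fun ξ => ∑ w ∈ L j, ∑ w' ∈ L j,
          (c (a v) (a w) * c (a v') (a w')) * ((ind (ξ s(v, w)) * ind (ξ s(v', w'))) *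
            (pathSum c c₀ L t j w a ξ * pathSum c c₀ L t j w' a ξ)) := by
      intro v v'
      ext ξ
      simp only [pathSum]
      rw [Finset.sum_mul_sum]
      exact Finset.sum_congr rfl fun w _ => Finset.sum_congr rfl fun w' _ => by ring
    have hwt : ∀ w ∈ L j, w ≠ t := fun w hw h => ht j (h ▸ hw)
    have hwl : ∀ w ∈ L j, w ∉ layers L j := fun w hw => notMem_layers_of_mem hL hw
    constructor
    · intro v v' hv hv' hvt hvt' hvv
      rw [expand, edgeExp, pexp_sum]
      refine Finset.sum_congr rfl fun w hw => ?_
      rw [pexp_sum]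
      refine Finset.sum_congr rfl fun w' hw' => ?_
      have hwv : w ≠ v' := fun h => hv' (h ▸ subset_layers (Nat.lt_succ_self j) hw)
      have hne : s(v, w) ≠ s(v', w') := by simp [hvv, hwv]
      rw [pexp_mul_left, ← edgeExp, edgeExp_pathSum_step₂ hP a j hv hvt hv' hvt' hw hw',
        edgeExp_ind_mul hP a hne]
      simp only [Sym2.map_mk]
      split_ifs with h
      · subst h
        rw [ih.2 w (hwl w hw) (hwt w hw)]
        ring
      · rw [ih.1 w w' (hwl w hw) (hwl w' hw') (hwt w hw) (hwt w' hw') h]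
        ring
    · intro v hv hvt
      rw [expand, edgeExp, pexp_sum]
      refine Finset.sum_congr rfl fun w hw => ?_
      rw [pexp_sum]
      refine Finset.sum_congr rfl fun w' hw' => ?_
      rw [pexp_mul_left, ← edgeExp, edgeExp_pathSum_step₂ hP a j hv hvt hv hvt hw hw']
      split_ifs with h
      · subst h
        simp only [ind_mul_self]
        rw [ih.2 w (hwl w hw) (hwt w hw), edgeExp_ind hP]
        simp only [Sym2.map_mk]
        ring
      · have hwv : w ≠ v := fun h => hv (h ▸ subset_layers (Nat.lt_succ_self j) hw)
        have hne : s(v, w) ≠ s(v, w') := by simp [h, hwv]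
        rw [ih.1 w w' (hwl w hw) (hwl w' hw') (hwt w hw) (hwt w' hw') h,
          edgeExp_ind_mul hP a hne]
        simp only [Sym2.map_mk]
        ring

lemma meanSum_dependsOn (j : ℕ) (y : X) : DependsOn (meanSum P c c₀ L z j y) (layers L j) := by
  induction j generalizing y with
  | zero => intro a a' _; rfl
  | succ j ih =>
    intro a a' h
    simp only [meanSum]
    refine Finset.sum_congr rfl fun w hw => ?_
    rw [h w (subset_layers (Nat.lt_succ_self j) hw),
      ih _ fun i hi => h i (layers_mono (Nat.le_succ j) hi)]

lemma momentSum_dependsOn (j : ℕ) :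
    (∀ y y', DependsOn ((momentSum P c c₀ L z j).1 y y') (layers L j)) ∧
    (∀ y, DependsOn ((momentSum P c c₀ L z j).2 y) (layers L j)) := by
  induction j with
  | zero => exact ⟨fun _ _ a a' _ => rfl, fun _ a a' _ => rfl⟩
  | succ j ih =>
    have key : ∀ a a' : V → X, (∀ i ∈ layers L (j + 1), a i = a' i) →
        (∀ w ∈ L j, a w = a' w) ∧ (∀ i ∈ layers L j, a i = a' i) := fun a a' h =>
      ⟨fun w hw => h w (subset_layers (Nat.lt_succ_self j) hw),
        fun i hi => h i (layers_mono (Nat.le_succ j) hi)⟩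
    constructor
    · intro y y' a a' h
      obtain ⟨h1, h2⟩ := key a a' h
      simp only [momentSum]
      refine Finset.sum_congr rfl fun w hw => Finset.sum_congr rfl fun w' hw' => ?_
      rw [h1 w hw, h1 w' hw', ih.1 _ _ h2, ih.2 _ h2]
    · intro y a a' h
      obtain ⟨h1, h2⟩ := key a a' h
      simp only [momentSum]
      refine Finset.sum_congr rfl fun w hw => Finset.sum_congr rfl fun w' hw' => ?_
      rw [h1 w hw, h1 w' hw', ih.1 _ _ h2, ih.2 _ h2]

variable {m : X → ℝ}

/-- The node `w` lies outside the layers below it, so its type is independent of the remaining sum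
and can be averaged separately. -/
lemma pexp_meanSum_succ (hm : IsWeight fun _ : V => m)
    (hL : ∀ i j, i ≠ j → Disjoint (L i) (L j)) (j : ℕ) (y : X) :
    pexp (fun _ : V => m) (meanSum P c c₀ L z (j + 1) y) =
      ∑ x, (L j).card * m x * (c y x * P s(y, x)) *
        pexp (fun _ : V => m) (meanSum P c c₀ L z j x) := by
  have h1 : ∀ w ∈ L j, pexp (fun _ : V => m) (fun a => c y (a w) * P s(y, a w) *
      meanSum P c c₀ L z j (a w) a) = ∑ x, m x * (c y x * P s(y, x)) *
        pexp (fun _ : V => m) (meanSum P c c₀ L z j x) := by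
    intro w hw
    rw [pexp_coord hm w (fun x a => c y x * P s(y, x) * meanSum P c c₀ L z j x a)
      (s := layers L j)]
    · exact Finset.sum_congr rfl fun x _ => by rw [pexp_mul_left]; ring
    · intro x a a' h
      simp only
      rw [meanSum_dependsOn j x h]
    · exact notMem_layers_of_mem hL hw
  have : meanSum P c c₀ L z (j + 1) y = fun a => ∑ w ∈ L j, c y (a w) * P s(y, a w) *
      meanSum P c c₀ L z j (a w) a := rfl
  rw [this, pexp_sum, Finset.sum_congr rfl h1, Finset.sum_const, nsmul_eq_mul, Finset.mul_sum]
  exact Finset.sum_congr rfl fun x _ => by ring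

/-- Averaging one term of the second-moment recursion over the types. -/
lemma pexp_momentSum_term (hm : IsWeight fun _ : V => m)
    (hL : ∀ i j, i ≠ j → Disjoint (L i) (L j)) (j : ℕ) (f : X → X → ℝ) (g : X → ℝ) {w w' : V}
    (hw : w ∈ L j) (hw' : w' ∈ L j) :
    pexp (fun _ : V => m) (fun a => if w = w' then g (a w) * (momentSum P c c₀ L z j).2 (a w) a
      else f (a w) (a w') * (momentSum P c c₀ L z j).1 (a w) (a w') a) =
    if w = w' then ∑ x, m x * g x * pexp (fun _ : V => m) ((momentSum P c c₀ L z j).2 x)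
    else ∑ x, ∑ x', m x * m x' * f x x' *
      pexp (fun _ : V => m) ((momentSum P c c₀ L z j).1 x x') := by
  split_ifs with h
  · rw [pexp_coord hm w (fun x a => g x * (momentSum P c c₀ L z j).2 x a) (s := layers L j)]
    · exact Finset.sum_congr rfl fun x _ => by rw [pexp_mul_left]; ring
    · intro x a a' h
      simp only
      rw [(momentSum_dependsOn j).2 x h]
    · exact notMem_layers_of_mem hL hw
  · rw [pexp_coord₂ hm h (fun x x' a => f x x' * (momentSum P c c₀ L z j).1 x x' a)
      (s := layers L j)]
    · refine Finset.sum_congr rfl fun x _ => Finset.sum_congr rfl fun x' _ => ?_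
      rw [pexp_mul_left]; ring
    · intro x x' a a' h
      simp only
      rw [(momentSum_dependsOn j).1 x x' h]
    · exact notMem_layers_of_mem hL hw
    · exact notMem_layers_of_mem hL hw'

/-- The off-diagonal pairs are bounded in number by `N ^ 2` instead of `N ^ 2 - N`, which is allowed
because `α` is nonnegative. -/
lemma sum_ite_eq_le {N : ℕ} {S : Finset V} (hS : S.card = N) {α β : ℝ} (hα : 0 ≤ α) :
    ∑ w ∈ S, ∑ w' ∈ S, (if w = w' then β else α) ≤ (N : ℝ) ^ 2 * α + N * β := by
  have : ∀ w ∈ S, ∑ w' ∈ S, (if w = w' then β else α) ≤ N * α + β := by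
    intro w hw
    calc ∑ w' ∈ S, (if w = w' then β else α)
        ≤ ∑ w' ∈ S, (α + if w = w' then β else 0) := by
          refine Finset.sum_le_sum fun w' _ => ?_
          split_ifs <;> linarith
      _ = N * α + β := by
          rw [Finset.sum_add_distrib, Finset.sum_const, hS, nsmul_eq_mul,
            Finset.sum_ite_eq, if_pos hw]
  calc ∑ w ∈ S, ∑ w' ∈ S, (if w = w' then β else α) ≤ ∑ w ∈ S, (N * α + β) :=
        Finset.sum_le_sum this
    _ = (N : ℝ) ^ 2 * α + N * β := by rw [Finset.sum_const, hS, nsmul_eq_mul]; ring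

end RandomGraph

/-! ### The second moment of paths inside a core of types. -/

section SecondMoment

variable {V X : Type*} [Fintype V] [DecidableEq V] [Fintype X] [DecidableEq X]

/-- A set `C` of types on which the edge probabilities `P` dominate a multiple of the
kernel `k`, which is substochastic with respect to `w`. -/
structure IsCore (m : X → ℝ) (P : Sym2 X → ℝ) (C : Finset X) (w : X → ℝ) (k : X → X → ℝ)
    (Ω B : ℝ) : Prop where
  w_nonneg : ∀ x, 0 ≤ w x
  k_nonneg : ∀ x y, 0 ≤ k x y
  m_nonneg : ∀ x, 0 ≤ m x
  P_nonneg : ∀ e, 0 ≤ P e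
  Ω_nonneg : 0 ≤ Ω
  B_nonneg : 0 ≤ B
  P_le_one : ∀ e, P e ≤ 1
  w_le : ∀ x ∈ C, w x ≤ Ω * m x
  k_le : ∀ x ∈ C, ∀ y ∈ C, k x y ≤ B * P s(x, y)
  sum_le : ∀ x ∈ C, ∑ y ∈ C, w y * k x y ≤ 1

/-- The `j`-fold composition of `k` with itself, all intermediate types lying in `C`. -/
noncomputable def coreIter (C : Finset X) (w : X → ℝ) (k : X → X → ℝ) : ℕ → X → X → ℝ
  | 0, x, y => k x y
  | j + 1, x, y => ∑ a ∈ C, w a * k x a * coreIter C w k j a y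

/-- Weight of a step of a path. -/
noncomputable def stepWeight (m : X → ℝ) (P : Sym2 X → ℝ) (C : Finset X) (w : X → ℝ)
    (k : X → X → ℝ) (N : ℕ) (x y : X) : ℝ :=
  if y ∈ C then w y / m y / N * (k x y / P s(x, y)) else 0

/-- Weight of the last step of a path. -/
noncomputable def endWeight (P : Sym2 X → ℝ) (k : X → X → ℝ) (z x : X) : ℝ :=
  k x z / P s(x, z)

variable {m : X → ℝ} {P : Sym2 X → ℝ} {C : Finset X} {w : X → ℝ} {k : X → X → ℝ} {Ω B : ℝ}

section

variable (h : IsCore m P C w k Ω B)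
include h

lemma IsCore.coreIter_nonneg (j : ℕ) (x y : X) : 0 ≤ coreIter C w k j x y := by
  induction j generalizing x with
  | zero => exact h.k_nonneg x y
  | succ j ih =>
    exact Finset.sum_nonneg fun a _ =>
      mul_nonneg (mul_nonneg (h.w_nonneg a) (h.k_nonneg x a)) (ih a)

lemma IsCore.coreIter_le (j : ℕ) {x y : X} (hx : x ∈ C) (hy : y ∈ C) :
    coreIter C w k j x y ≤ B := by
  induction j generalizing x with
  | zero =>
    exact (h.k_le x hx y hy).trans (mul_le_of_le_one_right h.B_nonneg (h.P_le_one _))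
  | succ j ih =>
    calc coreIter C w k (j + 1) x y ≤ ∑ a ∈ C, w a * k x a * B :=
          Finset.sum_le_sum fun a ha =>
            mul_le_mul_of_nonneg_left (ih ha) (mul_nonneg (h.w_nonneg a) (h.k_nonneg x a))
      _ = (∑ a ∈ C, w a * k x a) * B := by rw [Finset.sum_mul]
      _ ≤ B := mul_le_of_le_one_left h.B_nonneg (h.sum_le x hx)

lemma IsCore.stepWeight_nonneg (N : ℕ) (x y : X) : 0 ≤ stepWeight m P C w k N x y := by
  unfold stepWeight
  split_ifs
  · exact mul_nonneg (div_nonneg (div_nonneg (h.w_nonneg _) (h.m_nonneg _)) (Nat.cast_nonneg _))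
      (div_nonneg (h.k_nonneg _ _) (h.P_nonneg _))
  · exact le_rfl

lemma IsCore.endWeight_nonneg (z x : X) : 0 ≤ endWeight P k z x :=
  div_nonneg (h.k_nonneg _ _) (h.P_nonneg _)

/-- Where `P` vanishes, `k_le` forces `k` to vanish too, so the value of a division by zero does no
harm. `IsCore.w_div_mul` rests on the same remark. -/
lemma IsCore.k_div_mul {x y : X} (hx : x ∈ C) (hy : y ∈ C) :
    k x y / P s(x, y) * P s(x, y) = k x y := by
  rcases eq_or_ne (P s(x, y)) 0 with h0 | h0
  · have := h.k_le x hx y hy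
    rw [h0, mul_zero] at this
    rw [h0, mul_zero]
    exact (le_antisymm this (h.k_nonneg x y)).symm
  · exact div_mul_cancel₀ _ h0

lemma IsCore.k_div_le {x y : X} (hx : x ∈ C) (hy : y ∈ C) : k x y / P s(x, y) ≤ B :=
  div_le_of_le_mul₀ (h.P_nonneg _) h.B_nonneg (h.k_le x hx y hy)

lemma IsCore.w_div_mul {x : X} (hx : x ∈ C) : w x / m x * m x = w x := by
  rcases eq_or_ne (m x) 0 with h0 | h0
  · have := h.w_le x hx
    rw [h0, mul_zero] at this
    rw [h0, mul_zero]
    exact (le_antisymm this (h.w_nonneg x)).symm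
  · exact div_mul_cancel₀ _ h0

lemma IsCore.w_div_le {x : X} (hx : x ∈ C) : w x / m x ≤ Ω :=
  div_le_of_le_mul₀ (h.m_nonneg _) h.Ω_nonneg (h.w_le x hx)

lemma IsCore.stepWeight_mul {N : ℕ} {x y : X} (hx : x ∈ C) (hy : y ∈ C) :
    stepWeight m P C w k N x y * P s(x, y) = w y / m y / N * k x y := by
  rw [stepWeight, if_pos hy, mul_assoc, h.k_div_mul hx hy]

/-- This identity is the purpose of the weights: averaged over the `N` nodes of a layer, a weighted
step to type `y` has mean `w y * k x y`. Counting paths thus becomes iterating the kernel, with no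
dependence on `N`. -/
lemma IsCore.card_mul_stepWeight {N : ℕ} (hN : 0 < N) {x y : X} (hx : x ∈ C) (hy : y ∈ C) :
    N * m y * (stepWeight m P C w k N x y * P s(x, y)) = w y * k x y := by
  have hN' : (N : ℝ) ≠ 0 := by positivity
  rw [h.stepWeight_mul hx hy]
  calc (N : ℝ) * m y * (w y / m y / N * k x y) = (w y / m y * m y) * k x y := by
        field_simp
    _ = w y * k x y := by rw [h.w_div_mul hy]

end

/-- `coreIter j` has `j` intermediate types and `j + 1` steps. The junction `a` is one further
intermediate type, hence the index `j + i + 1`. -/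
lemma coreIter_comp (j i : ℕ) (x y : X) :
    ∑ a ∈ C, w a * coreIter C w k j x a * coreIter C w k i a y =
      coreIter C w k (j + i + 1) x y := by
  induction j generalizing x with
  | zero => simp only [coreIter, Nat.zero_add]
  | succ j ih =>
    have e : j + 1 + i + 1 = (j + i + 1) + 1 := by omega
    have e' : coreIter C w k (j + i + 1 + 1) x y =
        ∑ a ∈ C, w a * k x a * coreIter C w k (j + i + 1) a y := rfl
    rw [e, e']
    simp_rw [← ih]
    simp only [coreIter, Finset.mul_sum, Finset.sum_mul]
    rw [Finset.sum_comm]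
    exact Finset.sum_congr rfl fun a _ => Finset.sum_congr rfl fun b _ => by ring

variable {L : ℕ → Finset V} {z : X} {N : ℕ}

lemma momentSum_nonneg {c : X → X → ℝ} {c₀ : X → ℝ} (hP : ∀ e, 0 ≤ P e)
    (hc : ∀ x y, 0 ≤ c x y) (hc₀ : ∀ x, 0 ≤ c₀ x) (j : ℕ) :
    (∀ y y' a, 0 ≤ (momentSum P c c₀ L z j).1 y y' a) ∧
    (∀ y a, 0 ≤ (momentSum P c c₀ L z j).2 y a) := by
  induction j with
  | zero =>
    exact ⟨fun y y' a => mul_nonneg (mul_nonneg (hc₀ _) (hP _)) (mul_nonneg (hc₀ _) (hP _)),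
      fun y a => mul_nonneg (sq_nonneg _) (hP _)⟩
  | succ j ih =>
    have hq : ∀ x y, 0 ≤ c x y * P s(x, y) := fun x y => mul_nonneg (hc _ _) (hP _)
    constructor
    · intro y y' a
      refine Finset.sum_nonneg fun u _ => Finset.sum_nonneg fun u' _ => ?_
      split_ifs
      · exact mul_nonneg (mul_nonneg (hq _ _) (hq _ _)) (ih.2 _ _)
      · exact mul_nonneg (mul_nonneg (hq _ _) (hq _ _)) (ih.1 _ _ _)
    · intro y a
      refine Finset.sum_nonneg fun u _ => Finset.sum_nonneg fun u' _ => ?_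
      split_ifs
      · exact mul_nonneg (mul_nonneg (sq_nonneg _) (hP _)) (ih.2 _ _)
      · exact mul_nonneg (mul_nonneg (hq _ _) (hq _ _)) (ih.1 _ _ _)

variable (V) in
lemma isWeight_const {m : X → ℝ} (h0 : ∀ x, 0 ≤ m x) (h1 : ∑ x, m x = 1) :
    IsWeight fun _ : V => m := ⟨fun _ => h0, fun _ => h1⟩

section

variable (h : IsCore m P C w k Ω B) (hm : ∑ x, m x = 1) (hN : 0 < N)
  (hL : ∀ i j, i ≠ j → Disjoint (L i) (L j))
include h hm hN hL

lemma IsCore.pexp_meanSum (hz : z ∈ C) (j : ℕ) (hLN : ∀ i < j, (L i).card = N) {y : X}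
    (hy : y ∈ C) :
    pexp (fun _ : V => m) (meanSum P (stepWeight m P C w k N) (endWeight P k z) L z j y) =
      coreIter C w k j y z := by
  have hW := isWeight_const V h.m_nonneg hm
  induction j generalizing y with
  | zero =>
    simp only [coreIter]
    rw [← h.k_div_mul hy hz]
    exact pexp_const hW _
  | succ j ih =>
    rw [pexp_meanSum_succ hW hL, hLN j (Nat.lt_succ_self j)]
    simp only [coreIter]
    rw [← Finset.sum_subset (Finset.subset_univ C)]
    · refine Finset.sum_congr rfl fun a ha => ?_
      rw [h.card_mul_stepWeight hN hy ha, ih (fun i hi => hLN i (hi.trans (Nat.lt_succ_self j))) ha]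
    · intro a _ ha
      simp [stepWeight, ha]

/-- Two paths from different nodes go on to different nodes of the layer, which gives the product
term, or to the same one. The coincidence costs `Ω / N`: the second path must hit one prescribed
node, and `w ≤ Ω * m`. -/
lemma IsCore.pexp_momentSum_succ_fst (j : ℕ) (hLN : (L j).card = N) {y y' : X} (hy : y ∈ C)
    (hy' : y' ∈ C) {F : X → X → ℝ} {G : X → ℝ}
    (hF : ∀ x ∈ C, ∀ x' ∈ C, pexp (fun _ : V => m)
      ((momentSum P (stepWeight m P C w k N) (endWeight P k z) L z j).1 x x') ≤ F x x')
    (hG : ∀ x ∈ C, pexp (fun _ : V => m)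
      ((momentSum P (stepWeight m P C w k N) (endWeight P k z) L z j).2 x) ≤ G x) :
    pexp (fun _ : V => m)
      ((momentSum P (stepWeight m P C w k N) (endWeight P k z) L z (j + 1)).1 y y') ≤
      ∑ a ∈ C, ∑ b ∈ C, (w a * k y a) * (w b * k y' b) * F a b +
        Ω / N * ∑ a ∈ C, w a * k y a * k y' a * G a := by
  have hW := isWeight_const V h.m_nonneg hm
  set c := stepWeight m P C w k N with hc
  set c₀ := endWeight P k z
  have hcn := h.stepWeight_nonneg N
  have hnn := momentSum_nonneg (L := L) (z := z) (c := c) (c₀ := c₀) h.P_nonneg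
    hcn (h.endWeight_nonneg z) j
  have e : (momentSum P c c₀ L z (j + 1)).1 y y' = fun a => ∑ u ∈ L j, ∑ u' ∈ L j,
      if u = u' then ((c y (a u) * P s(y, a u)) * (c y' (a u) * P s(y', a u))) *
          (momentSum P c c₀ L z j).2 (a u) a
        else ((c y (a u) * P s(y, a u)) * (c y' (a u') * P s(y', a u'))) *
          (momentSum P c c₀ L z j).1 (a u) (a u') a := rfl
  have hterm : ∀ u ∈ L j, ∀ u' ∈ L j, _ := fun u hu u' hu' =>
    pexp_momentSum_term (P := P) (c := c) (c₀ := c₀) (z := z) hW hL j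
      (fun x x' => (c y x * P s(y, x)) * (c y' x' * P s(y', x')))
      (fun x => (c y x * P s(y, x)) * (c y' x * P s(y', x))) hu hu'
  rw [e, pexp_sum, Finset.sum_congr rfl fun u hu => by
    rw [pexp_sum, Finset.sum_congr rfl fun u' hu' => hterm u hu u' hu']]
  have hN' : (0 : ℝ) < N := by positivity
  refine (sum_ite_eq_le hLN ?_).trans (add_le_add ?_ ?_)
  · refine Finset.sum_nonneg fun x _ => Finset.sum_nonneg fun x' _ => ?_
    exact mul_nonneg (mul_nonneg (mul_nonneg (h.m_nonneg _) (h.m_nonneg _))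
      (mul_nonneg (mul_nonneg (hcn _ _) (h.P_nonneg _)) (mul_nonneg (hcn _ _) (h.P_nonneg _))))
      (pexp_nonneg hW (hnn.1 x x'))
  · rw [← Finset.sum_subset (Finset.subset_univ C), Finset.mul_sum]
    · refine Finset.sum_le_sum fun a ha => ?_
      rw [← Finset.sum_subset (Finset.subset_univ C), Finset.mul_sum]
      · refine Finset.sum_le_sum fun b hb => ?_
        rw [← h.card_mul_stepWeight hN hy ha, ← h.card_mul_stepWeight hN hy' hb]
        calc _ = (N * m a * (c y a * P s(y, a))) * (N * m b * (c y' b * P s(y', b))) *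
              pexp (fun _ : V => m) ((momentSum P c c₀ L z j).1 a b) := by ring
          _ ≤ _ := by
            refine mul_le_mul_of_nonneg_left (hF a ha b hb) ?_
            rw [hc, h.card_mul_stepWeight hN hy ha, h.card_mul_stepWeight hN hy' hb]
            exact mul_nonneg (mul_nonneg (h.w_nonneg _) (h.k_nonneg _ _))
              (mul_nonneg (h.w_nonneg _) (h.k_nonneg _ _))
      · intro b _ hb
        simp [hc, stepWeight, hb]
    · intro a _ ha
      simp [hc, stepWeight, ha]
  · rw [← Finset.sum_subset (Finset.subset_univ C), Finset.mul_sum, Finset.mul_sum]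
    · refine Finset.sum_le_sum fun a ha => ?_
      have h1 : c y' a * P s(y', a) ≤ Ω / N * k y' a := by
        rw [hc, h.stepWeight_mul hy' ha]
        exact mul_le_mul_of_nonneg_right
          (div_le_div_of_nonneg_right (h.w_div_le ha) hN'.le) (h.k_nonneg _ _)
      have hp := pexp_nonneg hW (hnn.2 a)
      have hwk := mul_nonneg (h.w_nonneg a) (h.k_nonneg y a)
      calc _ = (N * m a * (c y a * P s(y, a))) * (c y' a * P s(y', a)) *
            pexp (fun _ : V => m) ((momentSum P c c₀ L z j).2 a) := by ring
        _ = (w a * k y a) * (c y' a * P s(y', a)) *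
            pexp (fun _ : V => m) ((momentSum P c c₀ L z j).2 a) := by
          rw [hc, h.card_mul_stepWeight hN hy ha]
        _ ≤ (w a * k y a) * (Ω / N * k y' a) * G a := by
          refine mul_le_mul (mul_le_mul_of_nonneg_left h1 hwk) (hG a ha) hp ?_
          exact mul_nonneg hwk (mul_nonneg (div_nonneg h.Ω_nonneg hN'.le) (h.k_nonneg _ _))
        _ = _ := by ring
    · intro a _ ha
      simp [hc, stepWeight, ha]

/-- If both paths leave along the same edge, that edge is paid for only once. One factor `k / P`
therefore remains, which is at most `B`; hence the constant `Ω / N * B`. -/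
lemma IsCore.pexp_momentSum_succ_snd (j : ℕ) (hLN : (L j).card = N) {y : X} (hy : y ∈ C)
    {F : X → X → ℝ} {G : X → ℝ}
    (hF : ∀ x ∈ C, ∀ x' ∈ C, pexp (fun _ : V => m)
      ((momentSum P (stepWeight m P C w k N) (endWeight P k z) L z j).1 x x') ≤ F x x')
    (hG : ∀ x ∈ C, pexp (fun _ : V => m)
      ((momentSum P (stepWeight m P C w k N) (endWeight P k z) L z j).2 x) ≤ G x) :
    pexp (fun _ : V => m)
      ((momentSum P (stepWeight m P C w k N) (endWeight P k z) L z (j + 1)).2 y) ≤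
      ∑ a ∈ C, ∑ b ∈ C, (w a * k y a) * (w b * k y b) * F a b +
        Ω / N * B * ∑ a ∈ C, w a * k y a * G a := by
  have hW := isWeight_const V h.m_nonneg hm
  set c := stepWeight m P C w k N with hc
  set c₀ := endWeight P k z
  have hcn := h.stepWeight_nonneg N
  have hnn := momentSum_nonneg (L := L) (z := z) (c := c) (c₀ := c₀) h.P_nonneg
    hcn (h.endWeight_nonneg z) j
  have e : (momentSum P c c₀ L z (j + 1)).2 y = fun a => ∑ u ∈ L j, ∑ u' ∈ L j,
      if u = u' then (c y (a u) ^ 2 * P s(y, a u)) *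
          (momentSum P c c₀ L z j).2 (a u) a
        else ((c y (a u) * P s(y, a u)) * (c y (a u') * P s(y, a u'))) *
          (momentSum P c c₀ L z j).1 (a u) (a u') a := rfl
  have hterm : ∀ u ∈ L j, ∀ u' ∈ L j, _ := fun u hu u' hu' =>
    pexp_momentSum_term (P := P) (c := c) (c₀ := c₀) (z := z) hW hL j
      (fun x x' => (c y x * P s(y, x)) * (c y x' * P s(y, x')))
      (fun x => c y x ^ 2 * P s(y, x)) hu hu'
  rw [e, pexp_sum, Finset.sum_congr rfl fun u hu => by
    rw [pexp_sum, Finset.sum_congr rfl fun u' hu' => hterm u hu u' hu']]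
  have hN' : (0 : ℝ) < N := by positivity
  refine (sum_ite_eq_le hLN ?_).trans (add_le_add ?_ ?_)
  · refine Finset.sum_nonneg fun x _ => Finset.sum_nonneg fun x' _ => ?_
    exact mul_nonneg (mul_nonneg (mul_nonneg (h.m_nonneg _) (h.m_nonneg _))
      (mul_nonneg (mul_nonneg (hcn _ _) (h.P_nonneg _)) (mul_nonneg (hcn _ _) (h.P_nonneg _))))
      (pexp_nonneg hW (hnn.1 x x'))
  · rw [← Finset.sum_subset (Finset.subset_univ C), Finset.mul_sum]
    · refine Finset.sum_le_sum fun a ha => ?_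
      rw [← Finset.sum_subset (Finset.subset_univ C), Finset.mul_sum]
      · refine Finset.sum_le_sum fun b hb => ?_
        rw [← h.card_mul_stepWeight hN hy ha, ← h.card_mul_stepWeight hN hy hb]
        calc _ = (N * m a * (c y a * P s(y, a))) * (N * m b * (c y b * P s(y, b))) *
              pexp (fun _ : V => m) ((momentSum P c c₀ L z j).1 a b) := by ring
          _ ≤ _ := by
            refine mul_le_mul_of_nonneg_left (hF a ha b hb) ?_
            rw [hc, h.card_mul_stepWeight hN hy ha, h.card_mul_stepWeight hN hy hb]
            exact mul_nonneg (mul_nonneg (h.w_nonneg _) (h.k_nonneg _ _))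
              (mul_nonneg (h.w_nonneg _) (h.k_nonneg _ _))
      · intro b _ hb
        simp [hc, stepWeight, hb]
    · intro a _ ha
      simp [hc, stepWeight, ha]
  · rw [← Finset.sum_subset (Finset.subset_univ C), Finset.mul_sum, Finset.mul_sum]
    · refine Finset.sum_le_sum fun a ha => ?_
      have h1 : c y a ≤ Ω / N * B := by
        rw [hc, stepWeight, if_pos ha]
        exact mul_le_mul (div_le_div_of_nonneg_right (h.w_div_le ha) hN'.le) (h.k_div_le hy ha)
          (div_nonneg (h.k_nonneg _ _) (h.P_nonneg _)) (div_nonneg h.Ω_nonneg hN'.le)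
      have hp := pexp_nonneg hW (hnn.2 a)
      have hwk := mul_nonneg (h.w_nonneg a) (h.k_nonneg y a)
      calc _ = (N * m a * (c y a * P s(y, a))) * c y a *
            pexp (fun _ : V => m) ((momentSum P c c₀ L z j).2 a) := by ring
        _ = (w a * k y a) * c y a *
            pexp (fun _ : V => m) ((momentSum P c c₀ L z j).2 a) := by
          rw [hc, h.card_mul_stepWeight hN hy ha]
        _ ≤ (w a * k y a) * (Ω / N * B) * G a := by
          refine mul_le_mul (mul_le_mul_of_nonneg_left h1 hwk) (hG a ha) hp ?_
          exact mul_nonneg hwk (mul_nonneg (div_nonneg h.Ω_nonneg hN'.le) h.B_nonneg)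
        _ = _ := by ring
    · intro a _ ha
      simp [hc, stepWeight, ha]

/-- Bound on the second moment of the weighted path count, in terms of bounds `b` on the
iterated kernel. -/
lemma IsCore.pexp_momentSum_le (hz : z ∈ C) (J : ℕ) (hLN : ∀ i < J, (L i).card = N)
    {b d : ℕ → ℝ} (hb : ∀ i, ∀ x ∈ C, ∀ y ∈ C, coreIter C w k i x y ≤ b i) (hB : B ≤ b 0)
    (hd₀ : b 0 ≤ d 0)
    (hd0 : ∀ j, 0 ≤ d j) (hd : ∀ j < J,
      b (j + 1) + Ω / N * ∑ i ∈ Finset.range (j + 1), d i * b (j - i) ≤ d (j + 1))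
    (j : ℕ) (hj : j ≤ J) :
    (∀ y ∈ C, ∀ y' ∈ C, pexp (fun _ : V => m)
      ((momentSum P (stepWeight m P C w k N) (endWeight P k z) L z j).1 y y') ≤
        coreIter C w k j y z * coreIter C w k j y' z + Ω / N * ∑ i ∈ Finset.range j,
          d i * ∑ a ∈ C, w a * coreIter C w k (j - i - 1) y a * coreIter C w k (j - i - 1) y' a *
            coreIter C w k i a z) ∧
    (∀ y ∈ C, pexp (fun _ : V => m)
      ((momentSum P (stepWeight m P C w k N) (endWeight P k z) L z j).2 y) ≤
        d j * coreIter C w k j y z) := by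
  have hW := isWeight_const V h.m_nonneg hm
  have hN' : (0 : ℝ) < N := by positivity
  have hη : 0 ≤ Ω / N := div_nonneg h.Ω_nonneg hN'.le
  have hκ := h.coreIter_nonneg
  -- The first bound sorts pairs of paths by the layer `i` where they first meet, at a node of type
  -- `a`. Until then they contribute two separate kernels with `j - i` steps each, the meeting costs
  -- `Ω / N`, and the common end is controlled by the second bound for `i`.
  induction j with
  | zero =>
    constructor
    · intro y hy y' hy'
      simp only [momentSum, endWeight, h.k_div_mul hy hz, h.k_div_mul hy' hz, pexp_const hW,
        Finset.range_zero, Finset.sum_empty, mul_zero, add_zero, coreIter, le_refl]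
    · intro y hy
      have e : endWeight P k z y ^ 2 * P s(y, z) = endWeight P k z y * k y z := by
        rw [pow_two, mul_assoc, endWeight, h.k_div_mul hy hz]
      simp only [momentSum, pexp_const hW, coreIter, e]
      exact mul_le_mul_of_nonneg_right (((h.k_div_le hy hz).trans hB).trans hd₀) (h.k_nonneg _ _)
  | succ j ih =>
    obtain ⟨ih1, ih2⟩ := ih (by omega)
    have hcard := hLN j (by omega)
    -- the two-point term, integrated against the first steps
    have two : ∀ y y' : X, ∑ a ∈ C, ∑ b ∈ C, (w a * k y a) * (w b * k y' b) *
        (coreIter C w k j a z * coreIter C w k j b z + Ω / N * ∑ i ∈ Finset.range j,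
          d i * ∑ e ∈ C, w e * coreIter C w k (j - i - 1) a e * coreIter C w k (j - i - 1) b e *
            coreIter C w k i e z) =
        coreIter C w k (j + 1) y z * coreIter C w k (j + 1) y' z +
          Ω / N * ∑ i ∈ Finset.range j, d i * ∑ e ∈ C, w e * coreIter C w k (j - i) y e *
            coreIter C w k (j - i) y' e * coreIter C w k i e z := by
      intro y y'
      simp only [mul_add, Finset.sum_add_distrib]
      congr 1
      · simp only [coreIter]
        rw [Finset.sum_mul_sum]
        exact Finset.sum_congr rfl fun a _ => Finset.sum_congr rfl fun b _ => by ring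
      · have e1 : ∀ i ∈ Finset.range j, d i * ∑ e ∈ C, w e * coreIter C w k (j - i) y e *
            coreIter C w k (j - i) y' e * coreIter C w k i e z =
            ∑ a ∈ C, ∑ b ∈ C, (w a * k y a) * (w b * k y' b) * (d i * ∑ e ∈ C, w e *
              coreIter C w k (j - i - 1) a e * coreIter C w k (j - i - 1) b e *
              coreIter C w k i e z) := by
          intro i hi
          have hi : i < j := by simpa using hi
          obtain ⟨r, hr⟩ : ∃ r, j - i = r + 1 := ⟨j - i - 1, by omega⟩
          rw [hr, Nat.add_sub_cancel]
          have e2 : ∀ e, w e * coreIter C w k (r + 1) y e * coreIter C w k (r + 1) y' e *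
              coreIter C w k i e z = ∑ a ∈ C, ∑ b ∈ C, (w a * k y a) * (w b * k y' b) *
                (w e * coreIter C w k r a e * coreIter C w k r b e * coreIter C w k i e z) := by
            intro e
            simp only [coreIter]
            rw [mul_assoc (w e), Finset.sum_mul_sum, Finset.mul_sum, Finset.sum_mul]
            refine Finset.sum_congr rfl fun a _ => ?_
            rw [Finset.mul_sum, Finset.sum_mul]
            exact Finset.sum_congr rfl fun b _ => by ring
          rw [Finset.sum_congr rfl fun e _ => e2 e, Finset.sum_comm, Finset.mul_sum]
          refine Finset.sum_congr rfl fun a _ => ?_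
          rw [Finset.sum_comm, Finset.mul_sum]
          refine Finset.sum_congr rfl fun b _ => ?_
          simp only [Finset.mul_sum]
          exact Finset.sum_congr rfl fun e _ => by ring
        rw [Finset.sum_congr rfl e1, Finset.mul_sum]
        rw [Finset.sum_congr rfl fun a _ => Finset.sum_congr rfl fun b _ => by
          rw [Finset.mul_sum, Finset.mul_sum]]
        rw [Finset.sum_congr rfl fun a _ => Finset.sum_comm, Finset.sum_comm]
        refine Finset.sum_congr rfl fun i _ => ?_
        simp only [Finset.mul_sum]
        refine Finset.sum_congr rfl fun a _ => Finset.sum_congr rfl fun b _ =>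
          Finset.sum_congr rfl fun e _ => by ring
    constructor
    · intro y hy y' hy'
      refine (h.pexp_momentSum_succ_fst hm hN hL j hcard hy hy' ih1 ih2).trans (le_of_eq ?_)
      rw [two, Finset.sum_range_succ, mul_add, ← add_assoc]
      congr 1
      · congr 2
        refine Finset.sum_congr rfl fun i hi => ?_
        have hi : i < j := by simpa using hi
        have : j + 1 - i - 1 = j - i := by omega
        rw [this]
      · have : j + 1 - j - 1 = 0 := by omega
        rw [this]
        simp only [coreIter, Finset.mul_sum]
        exact Finset.sum_congr rfl fun a _ => by ring
    · intro y hy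
      refine (h.pexp_momentSum_succ_snd hm hN hL j hcard hy ih1 ih2).trans ?_
      rw [two]
      refine le_trans ?_ (mul_le_mul_of_nonneg_right (hd j hj) (hκ (j + 1) y z))
      rw [Finset.sum_range_succ, add_mul, mul_add, add_mul, ← add_assoc]
      refine add_le_add (add_le_add ?_ ?_) ?_
      · exact mul_le_mul_of_nonneg_right (hb _ y hy z hz) (hκ _ _ _)
      · rw [mul_assoc]
        refine mul_le_mul_of_nonneg_left ?_ hη
        rw [Finset.sum_mul]
        refine Finset.sum_le_sum fun i hi => ?_
        have hi : i < j := by simpa using hi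
        rw [mul_assoc]
        refine mul_le_mul_of_nonneg_left ?_ (hd0 i)
        -- Both paths now start at `y`. One of the two kernels from `y` to `a` is bounded by `b (j -
        -- i)`; the other joins with the kernel from `a` to `z` by `coreIter_comp`.
        have e : coreIter C w k (j + 1) y z = ∑ a ∈ C, w a * coreIter C w k (j - i) y a *
            coreIter C w k i a z := by
          rw [coreIter_comp]; congr 1; omega
        rw [e, Finset.mul_sum]
        refine Finset.sum_le_sum fun a ha => ?_
        calc _ = (w a * coreIter C w k (j - i) y a * coreIter C w k i a z) *
              coreIter C w k (j - i) y a := by ring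
          _ ≤ (w a * coreIter C w k (j - i) y a * coreIter C w k i a z) * b (j - i) :=
            mul_le_mul_of_nonneg_left (hb _ y hy a ha)
              (mul_nonneg (mul_nonneg (h.w_nonneg _) (hκ _ _ _)) (hκ _ _ _))
          _ = _ := by ring
      · have e : ∑ a ∈ C, w a * k y a * (d j * coreIter C w k j a z) =
            d j * coreIter C w k (j + 1) y z := by
          simp only [coreIter, Finset.mul_sum]
          exact Finset.sum_congr rfl fun a _ => by ring
        rw [e, Nat.sub_self]
        calc _ = (Ω / N * (d j * coreIter C w k (j + 1) y z)) * B := by ring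
          _ ≤ (Ω / N * (d j * coreIter C w k (j + 1) y z)) * b 0 :=
            mul_le_mul_of_nonneg_left hB (mul_nonneg hη (mul_nonneg (hd0 j) (hκ _ _ _)))
          _ = _ := by ring

end

end SecondMoment

/-! ### Independent groups of layers between two nodes. -/

section Groups

variable {V X : Type*} [Fintype V] [DecidableEq V] [Fintype X] [DecidableEq X]

open scoped Classical in
/-- Probability of an event depending on the types of the nodes and on the edges. -/
noncomputable def prob (m : X → ℝ) (P : Sym2 X → ℝ) (S : (V → X) → (Sym2 V → Bool) → Prop) : ℝ :=
  pexp (fun _ : V => m) fun a => edgeExp P a fun ξ => if S a ξ then 1 else 0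

/-- The graph whose edges are the pairs with indicator `true`. -/
def indGraph (ξ : Sym2 V → Bool) : SimpleGraph V := SimpleGraph.fromEdgeSet {e | ξ e = true}

lemma indGraph_adj {ξ : Sym2 V → Bool} {u v : V} :
    (indGraph ξ).Adj u v ↔ ξ s(u, v) = true ∧ u ≠ v := by
  simp [indGraph]

variable {m : X → ℝ} {P : Sym2 X → ℝ} {C : Finset X} {w : X → ℝ} {k : X → X → ℝ} {Ω B : ℝ}
  {c : X → X → ℝ} {c₀ : X → ℝ}

lemma reachable_of_pathSum_ne_zero {L : ℕ → Finset V} {t : V} {a : V → X} {ξ : Sym2 V → Bool}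
    (j : ℕ) (v : V) (h : pathSum c c₀ L t j v a ξ ≠ 0) : (indGraph ξ).Reachable v t := by
  have step : ∀ v w : V, ind (ξ s(v, w)) ≠ 0 → (indGraph ξ).Reachable v w := by
    intro v w hvw
    have h1 : ξ s(v, w) = true := by
      by_contra h0
      simp [ind, h0] at hvw
    rcases eq_or_ne v w with rfl | hne
    · exact SimpleGraph.Reachable.refl _
    · exact (indGraph_adj.mpr ⟨h1, hne⟩).reachable
  induction j generalizing v with
  | zero => exact step v t (right_ne_zero_of_mul h)
  | succ j ih =>
    obtain ⟨w, _, hw⟩ := Finset.exists_ne_zero_of_sum_ne_zero h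
    exact (step v w (right_ne_zero_of_mul (left_ne_zero_of_mul hw))).trans
      (ih w (right_ne_zero_of_mul hw))

lemma prob_mono (hm : IsWeight fun _ : V => m) (hP : ∀ e, P e ∈ Set.Icc 0 1)
    {S S' : (V → X) → (Sym2 V → Bool) → Prop} (h : ∀ a ξ, S a ξ → S' a ξ) :
    prob m P S ≤ prob m P S' := by
  refine pexp_mono hm fun a => pexp_mono (isWeight_bern hP a) fun ξ => ?_
  by_cases hS : S a ξ
  · simp [hS, h a ξ hS]
  · simp only [hS, if_false]; split_ifs <;> norm_num

lemma prob_or_le (hm : IsWeight fun _ : V => m) (hP : ∀ e, P e ∈ Set.Icc 0 1)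
    (S S' : (V → X) → (Sym2 V → Bool) → Prop) :
    prob m P (fun a ξ => S a ξ ∨ S' a ξ) ≤ prob m P S + prob m P S' := by
  unfold prob
  rw [← pexp_add]
  refine pexp_mono hm fun a => ?_
  unfold edgeExp
  rw [← pexp_add]
  refine pexp_mono (isWeight_bern hP a) fun ξ => ?_
  by_cases h : S a ξ <;> by_cases h' : S' a ξ <;> simp [h, h']

lemma prob_exists_le (hm : IsWeight fun _ : V => m) (hP : ∀ e, P e ∈ Set.Icc 0 1)
    {κ : Type*} (s : Finset κ) (S : κ → (V → X) → (Sym2 V → Bool) → Prop) :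
    prob m P (fun a ξ => ∃ i ∈ s, S i a ξ) ≤ ∑ i ∈ s, prob m P (S i) := by
  classical
  unfold prob
  rw [← pexp_sum]
  refine pexp_mono hm fun a => ?_
  unfold edgeExp
  rw [← pexp_sum]
  refine pexp_mono (isWeight_bern hP a) fun ξ => ?_
  split_ifs with h
  · obtain ⟨i, hi, hS⟩ := h
    calc (1 : ℝ) = if S i a ξ then 1 else 0 := by simp [hS]
      _ ≤ _ := Finset.single_le_sum
        (f := fun i => if S i a ξ then (1 : ℝ) else 0)
        (fun j _ => by split_ifs <;> norm_num) hi
  · exact Finset.sum_nonneg fun j _ => by split_ifs <;> norm_num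

/-- All groups share the ends `t` and `u`, but every edge used by a group has an end inside that
group. -/
lemma edgesOf_disjoint {T T' : Set V} {t u : V} (h : Disjoint T T') (ht : t ∉ T) (hu : u ∉ T) :
    Disjoint (edgesOf T t u) (edgesOf T' t u) := by
  rw [Set.disjoint_left]
  rintro e ⟨⟨p, hp, hpT⟩, -⟩ ⟨-, h'⟩
  rcases h' p hp with h1 | h1 | h1
  · exact Set.disjoint_left.mp h hpT h1
  · exact ht (h1 ▸ hpT)
  · exact hu (h1 ▸ hpT)

/-- If each of several disjoint groups of layers joins two nodes with probability at least `p₀`,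
then none of them does with probability at most `(1 - p₀) ^ K`. -/
lemma IsCore.prob_not_reachable_le (h : IsCore m P C w k Ω B) (hm : ∑ x, m x = 1) {N J K : ℕ}
    (hN : 0 < N) (hJ : 0 < J) {u t : V} (hut : u ≠ t) (L : Fin K → ℕ → Finset V)
    (hcard : ∀ g, ∀ i < J, (L g i).card = N) (hL : ∀ g i j, i ≠ j → Disjoint (L g i) (L g j))
    (hLL : ∀ g g', g ≠ g' → Disjoint (layers (L g) J) (layers (L g') J))
    (hu : ∀ g i, u ∉ L g i) (ht : ∀ g i, t ∉ L g i)
    {b d : ℕ → ℝ} (hb : ∀ i, ∀ x ∈ C, ∀ y ∈ C, coreIter C w k i x y ≤ b i) (hB : B ≤ b 0)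
    (hd₀ : b 0 ≤ d 0)
    (hd0 : ∀ j, 0 ≤ d j) (hd : ∀ j < J,
      b (j + 1) + Ω / N * ∑ i ∈ Finset.range (j + 1), d i * b (j - i) ≤ d (j + 1))
    (hdJ : 0 < d J) {p₀ : ℝ} (hp₀ : ∀ x ∈ C, ∀ z ∈ C, p₀ ≤ coreIter C w k J x z / d J) :
    prob m P (fun a ξ => (a u ∈ C ∧ a t ∈ C) ∧ ¬ (indGraph ξ).Reachable u t) ≤
      max 0 (1 - p₀) ^ K := by
  classical
  have hW := isWeight_const V h.m_nonneg hm
  have hP : ∀ e, P e ∈ Set.Icc 0 1 := fun e => ⟨h.P_nonneg e, h.P_le_one e⟩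
  -- For a path count `Z`, the indicator of `Z = 0` is at most `(1 - s * Z) ^ 2`, and `ψ` is the
  -- conditional mean of this square. If `Z` has mean `M` and second moment at most `d J * M`, then
  -- `s = 1 / d J` gives `1 - 2 * M / d J + M / d J = 1 - M / d J`.
  set s := (d J)⁻¹ with hs
  set ψ : X → X → Fin K → (V → X) → ℝ := fun x z g a =>
    1 - 2 * s * meanSum P (stepWeight m P C w k N) (endWeight P k z) (L g) z J x a +
      s ^ 2 * (momentSum P (stepWeight m P C w k N) (endWeight P k z) (L g) z J).2 x a with hψ
  have hul : ∀ g j, u ∉ layers (L g) j := fun g j hj => by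
    simp only [layers, Set.mem_iUnion] at hj
    obtain ⟨i, _, hi⟩ := hj
    exact hu g i hi
  have htl : ∀ g j, t ∉ layers (L g) j := fun g j hj => by
    simp only [layers, Set.mem_iUnion] at hj
    obtain ⟨i, _, hi⟩ := hj
    exact ht g i hi
  -- for given types, the groups are independent
  have step1 : ∀ (x z : X) (a : V → X), x ∈ C → z ∈ C →
      edgeExp P (Function.update (Function.update a u x) t z) (fun ξ =>
        if ¬ (indGraph ξ).Reachable u t then 1 else 0) ≤ ∏ g, ψ x z g a := by
    intro x z a hx hz
    set a' := Function.update (Function.update a u x) t z with ha'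
    have hau : a' u = x := by simp [ha', hut]
    have hat : a' t = z := by simp [ha']
    have haa : ∀ g, ∀ i ∈ layers (L g) J, a' i = a i := by
      intro g i hi
      have h1 : i ≠ t := fun h => htl g J (h ▸ hi)
      have h2 : i ≠ u := fun h => hul g J (h ▸ hi)
      simp [ha', h1, h2]
    have hB := isWeight_bern (V := V) hP a'
    set Z : Fin K → (Sym2 V → Bool) → ℝ := fun g =>
      pathSum (stepWeight m P C w k N) (endWeight P k z) (L g) t J u a' with hZ
    calc edgeExp P a' (fun ξ => if ¬ (indGraph ξ).Reachable u t then 1 else 0)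
        ≤ edgeExp P a' (fun ξ => ∏ g, if Z g ξ = 0 then 1 else 0) := by
          refine pexp_mono hB fun ξ => ?_
          by_cases hr : (indGraph ξ).Reachable u t
          · rw [if_neg (not_not.mpr hr)]
            exact Finset.prod_nonneg fun g _ => by split_ifs <;> norm_num
          · rw [if_pos hr]
            refine le_of_eq (Finset.prod_eq_one fun g _ => ?_).symm
            rw [if_pos]
            by_contra h0
            exact hr (reachable_of_pathSum_ne_zero J u h0)
      _ = ∏ g, edgeExp P a' (fun ξ => if Z g ξ = 0 then 1 else 0) := by
          refine pexp_finset_prod hB Finset.univ _ (fun g => edgesOf (layers (L g) J) t u) ?_ ?_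
          · intro g _ ξ ξ' hξ
            exact congrArg (fun r : ℝ => if r = 0 then (1 : ℝ) else 0)
              (pathSum_dependsOn (layers (L g) J) a' J (fun i hi => subset_layers hi) u
                (Or.inl hJ) hξ)
          · intro g _ g' _ hgg
            exact edgesOf_disjoint (hLL g g' hgg) (htl g J) (hul g J)
      _ ≤ ∏ g, ψ x z g a := by
          refine Finset.prod_le_prod (fun g _ => pexp_nonneg hB fun ξ => by
            split_ifs <;> norm_num) fun g _ => ?_
          have e1 : edgeExp P a' (Z g) = meanSum P (stepWeight m P C w k N) (endWeight P k z)
              (L g) z J x a := by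
            rw [hZ, edgeExp_pathSum hP (hL g) (ht g) a' hat J u (hul g J) hut, hau]
            exact meanSum_dependsOn J x (haa g)
          have e2 : edgeExp P a' (fun ξ => Z g ξ * Z g ξ) =
              (momentSum P (stepWeight m P C w k N) (endWeight P k z) (L g) z J).2 x a := by
            rw [hZ]
            simp only
            rw [(edgeExp_pathSum_mul hP (hL g) (ht g) a' hat J).2 u (hul g J) hut, hau]
            exact (momentSum_dependsOn J).2 x (haa g)
          calc edgeExp P a' (fun ξ => if Z g ξ = 0 then 1 else 0)
              ≤ edgeExp P a' (fun ξ => (1 - (2 * s) * Z g ξ) + s ^ 2 * (Z g ξ * Z g ξ)) := by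
                refine pexp_mono hB fun ξ => ?_
                split_ifs with h0
                · simp [h0]
                · nlinarith [sq_nonneg (1 - s * Z g ξ)]
            _ = ψ x z g a := by
                unfold edgeExp at e1 e2 ⊢
                rw [pexp_add, pexp_sub, pexp_const hB, pexp_mul_left, pexp_mul_left, e1, e2]
  have step2 : ∀ (x z : X), x ∈ C → z ∈ C →
      pexp (fun _ : V => m) (fun a => ∏ g, ψ x z g a) ≤ max 0 (1 - p₀) ^ K := by
    intro x z hx hz
    rw [pexp_finset_prod hW Finset.univ (ψ x z) (fun g => layers (L g) J)]
    · have hg : ∀ g ∈ (Finset.univ : Finset (Fin K)), pexp (fun _ : V => m) (ψ x z g) ≤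
          max 0 (1 - p₀) := by
        intro g _
        have hM := h.pexp_meanSum hm hN (hL g) hz J (hcard g) hx
        have hD := (h.pexp_momentSum_le hm hN (hL g) hz J (hcard g)
          hb hB hd₀ hd0 hd J le_rfl).2 x hx
        have e : pexp (fun _ : V => m) (ψ x z g) = 1 - 2 * s * coreIter C w k J x z +
            s ^ 2 * pexp (fun _ : V => m)
              ((momentSum P (stepWeight m P C w k N) (endWeight P k z) (L g) z J).2 x) := by
          rw [hψ]
          simp only
          rw [pexp_add, pexp_sub, pexp_const hW, pexp_mul_left, pexp_mul_left, hM]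
        rw [e]
        refine le_max_of_le_right ?_
        have h1 := hp₀ x hx z hz
        have h2 : s ^ 2 * (d J * coreIter C w k J x z) = coreIter C w k J x z / d J := by
          rw [hs]; field_simp
        have h3 : s * coreIter C w k J x z = coreIter C w k J x z / d J := by
          rw [hs]; field_simp
        have h4 := mul_le_mul_of_nonneg_left hD (sq_nonneg s)
        rw [h2] at h4
        nlinarith
      calc ∏ g, pexp (fun _ : V => m) (ψ x z g) ≤ ∏ _g : Fin K, max 0 (1 - p₀) := by
            refine Finset.prod_le_prod (fun g hg' => ?_) hg
            refine pexp_nonneg hW fun a => ?_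
            -- nonnegativity: a conditional expectation of a square
            set a' := Function.update (Function.update a u x) t z with ha'
            have hau : a' u = x := by simp [ha', hut]
            have hat : a' t = z := by simp [ha']
            have haa : ∀ i ∈ layers (L g) J, a' i = a i := by
              intro i hi
              have h1 : i ≠ t := fun h => htl g J (h ▸ hi)
              have h2 : i ≠ u := fun h => hul g J (h ▸ hi)
              simp [ha', h1, h2]
            have hB := isWeight_bern (V := V) hP a'
            have e1 := edgeExp_pathSum (c := stepWeight m P C w k N) (c₀ := endWeight P k z)
              hP (hL g) (ht g) a' hat J u (hul g J) hut
            have e2 := (edgeExp_pathSum_mul (c := stepWeight m P C w k N)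
              (c₀ := endWeight P k z) hP (hL g) (ht g) a' hat J).2 u (hul g J) hut
            rw [hau, meanSum_dependsOn J x haa] at e1
            rw [hau, (momentSum_dependsOn J).2 x haa] at e2
            have := pexp_nonneg hB (f := fun ξ => (1 - (2 * s) * pathSum (stepWeight m P C w k N)
              (endWeight P k z) (L g) t J u a' ξ) + s ^ 2 * (pathSum (stepWeight m P C w k N)
              (endWeight P k z) (L g) t J u a' ξ * pathSum (stepWeight m P C w k N)
              (endWeight P k z) (L g) t J u a' ξ)) fun ξ => by
                nlinarith [sq_nonneg (1 - s * pathSum (stepWeight m P C w k N)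
                  (endWeight P k z) (L g) t J u a' ξ)]
            unfold edgeExp at e1 e2
            rw [pexp_add, pexp_sub, pexp_const hB, pexp_mul_left, pexp_mul_left] at this
            simp only [hψ]
            rw [← e1, ← e2]
            exact this
        _ = max 0 (1 - p₀) ^ K := by simp
    · intro g _ a a' haa
      simp only [hψ]
      rw [meanSum_dependsOn J x haa, (momentSum_dependsOn J).2 x haa]
    · intro g _ g' _ hgg
      exact hLL g g' hgg
  have hmax : 0 ≤ max 0 (1 - p₀) ^ K := pow_nonneg (le_max_left _ _) _
  unfold prob
  -- Resampling the types of `t` and `u` turns them into constants `z` and `x`; otherwise they would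
  -- correlate the groups.
  rw [pexp_update hW t]
  have havg : ∑ x, m x * max 0 (1 - p₀) ^ K = max 0 (1 - p₀) ^ K := by
    rw [← Finset.sum_mul, hm, one_mul]
  rw [← havg]
  refine Finset.sum_le_sum fun z _ => mul_le_mul_of_nonneg_left ?_ (h.m_nonneg z)
  rw [pexp_update hW u, ← havg]
  refine Finset.sum_le_sum fun x _ => mul_le_mul_of_nonneg_left ?_ (h.m_nonneg x)
  by_cases hxz : x ∈ C ∧ z ∈ C
  · refine le_trans (pexp_mono hW fun a => ?_) (step2 x z hxz.1 hxz.2)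
    refine le_trans (pexp_mono (isWeight_bern hP _) fun ξ => ?_) (step1 x z a hxz.1 hxz.2)
    by_cases hr : (indGraph ξ).Reachable u t <;> simp [hr, hut, hxz.1, hxz.2]
  · refine le_trans (le_of_eq ?_) hmax
    refine (congrArg _ ?_).trans (pexp_const hW 0)
    ext a
    refine (congrArg _ ?_).trans (pexp_const (isWeight_bern hP _) 0)
    ext ξ
    rw [if_neg]
    rintro ⟨h', -⟩
    simp [hut] at h'
    exact hxz h'

lemma exists_layers (K J N : ℕ) (u t : V) (hcard : K * (J * N) + 2 ≤ Fintype.card V) :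
    ∃ L : Fin K → ℕ → Finset V, (∀ g, ∀ i < J, (L g i).card = N) ∧
      (∀ g i j, i ≠ j → Disjoint (L g i) (L g j)) ∧
      (∀ g g', g ≠ g' → Disjoint (layers (L g) J) (layers (L g') J)) ∧
      (∀ g i, u ∉ L g i) ∧ (∀ g i, t ∉ L g i) := by
  have h1 : Fintype.card (Fin K × Fin J × Fin N) ≤
      Fintype.card {v : V // v ∉ ({u, t} : Finset V)} := by
    rw [Fintype.card_subtype_compl (fun v => v ∈ ({u, t} : Finset V))]
    have : Fintype.card {v : V // v ∈ ({u, t} : Finset V)} ≤ 2 := by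
      rw [Fintype.card_coe]; exact Finset.card_le_two
    simp only [Fintype.card_prod, Fintype.card_fin]
    omega
  obtain ⟨f⟩ := Function.Embedding.nonempty_of_card_le h1
  -- Layers with index at least `J` are empty, so the disjointness of layers holds for all indices.
  set L : Fin K → ℕ → Finset V := fun g i => if hi : i < J then
    Finset.univ.image (fun j : Fin N => (f (g, ⟨i, hi⟩, j) : V)) else ∅ with hLdef
  have hmem : ∀ g i v, v ∈ L g i ↔ ∃ (hi : i < J) (j : Fin N), (f (g, ⟨i, hi⟩, j) : V) = v := by
    intro g i v
    by_cases hi : i < J <;> simp [hLdef, hi]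
  have hinj : ∀ p q, (f p : V) = f q → p = q := fun p q h => f.injective (Subtype.ext h)
  refine ⟨L, ?_, ?_, ?_, ?_, ?_⟩
  · intro g i hi
    simp only [hLdef, hi, dif_pos]
    rw [Finset.card_image_of_injective, Finset.card_univ, Fintype.card_fin]
    intro j j' hj
    simpa using hinj _ _ hj
  · intro g i j hij
    rw [Finset.disjoint_left]
    intro v hv hv'
    obtain ⟨hi, a, rfl⟩ := (hmem _ _ _).mp hv
    obtain ⟨hj, b, hb⟩ := (hmem _ _ _).mp hv'
    have := hinj _ _ hb
    simp only [Prod.mk.injEq, Fin.mk.injEq] at this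
    exact hij this.2.1.symm
  · intro g g' hgg
    rw [Set.disjoint_left]
    intro v hv hv'
    simp only [layers, Set.mem_iUnion, Finset.mem_coe] at hv hv'
    obtain ⟨i, _, hv⟩ := hv
    obtain ⟨i', _, hv'⟩ := hv'
    obtain ⟨hi, a, rfl⟩ := (hmem _ _ _).mp hv
    obtain ⟨hj, b, hb⟩ := (hmem _ _ _).mp hv'
    have := hinj _ _ hb
    simp only [Prod.mk.injEq] at this
    exact hgg this.1.symm
  · intro g i hv
    obtain ⟨hi, a, ha⟩ := (hmem _ _ _).mp hv
    have := (f (g, ⟨i, hi⟩, a)).2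
    simp [ha] at this
  · intro g i hv
    obtain ⟨hi, a, ha⟩ := (hmem _ _ _).mp hv
    have := (f (g, ⟨i, hi⟩, a)).2
    simp [ha] at this

end Groups

/-! ### Typical neighbours and isolated nodes. -/

section Neighbours

variable {V X : Type*} [Fintype V] [DecidableEq V] [Fintype X] [DecidableEq X]
  {m : X → ℝ} {P : Sym2 X → ℝ}

lemma pexp_single {ι α : Type*} [Fintype ι] [DecidableEq ι] [Fintype α] [DecidableEq α]
    {p : ι → α → ℝ} (hp : IsWeight p) (i : ι) (f : α → ℝ) :
    pexp p (fun y => f (y i)) = ∑ x, p i x * f x := by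
  rw [pexp_update hp i]
  simp [pexp_const hp]

lemma prob_eq (S : (V → X) → (Sym2 V → Bool) → Prop) [∀ a ξ, Decidable (S a ξ)] :
    prob m P S = pexp (fun _ : V => m) fun a => edgeExp P a fun ξ => if S a ξ then 1 else 0 := by
  unfold prob
  congr!

open scoped Classical in
/-- A node whose type satisfies `G` has a neighbour whose type is related to its own by `W`, but
for a small probability. -/
lemma prob_no_neighbour_le (hm : IsWeight fun _ : V => m) (hP : ∀ e, P e ∈ Set.Icc 0 1)
    (hm1 : ∑ x, m x = 1) (G : X → Prop) (W : X → X → Prop) (u : V) {q : ℝ} (hq1 : q ≤ 1)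
    (hq : ∀ x, G x → q ≤ ∑ y, if W x y then m y * P s(x, y) else 0) :
    prob m P (fun a ξ => G (a u) ∧ ¬ ∃ v, v ≠ u ∧ W (a u) (a v) ∧ ξ s(u, v) = true) ≤
      (1 - q) ^ (Fintype.card V - 1) := by
  have hm0 : ∀ x, 0 ≤ m x := fun x => hm.nonneg u x
  rw [prob_eq, pexp_update hm u]
  have havg : ∑ x, m x * (1 - q) ^ (Fintype.card V - 1) = (1 - q) ^ (Fintype.card V - 1) := by
    rw [← Finset.sum_mul, hm1, one_mul]
  rw [← havg]
  refine Finset.sum_le_sum fun x _ => mul_le_mul_of_nonneg_left ?_ (hm0 x)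
  have hpow : 0 ≤ (1 - q) ^ (Fintype.card V - 1) := pow_nonneg (by linarith) _
  by_cases hx : G x
  swap
  · refine le_trans (le_of_eq ?_) hpow
    refine (congrArg _ ?_).trans (pexp_const hm 0)
    ext a
    refine (congrArg _ ?_).trans (pexp_const (isWeight_bern hP _) 0)
    ext ξ
    rw [if_neg]
    rintro ⟨h', -⟩
    simp at h'
    exact hx h'
  set χ : X → ℝ := fun y => if W x y then 1 else 0 with hχ
  have hχ01 : ∀ y, χ y = 0 ∨ χ y = 1 := fun y => by
    by_cases h : W x y <;> simp [hχ, h]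
  -- Given the type `x` of `u`, the edges at `u` are distinct pairs and the types of the other nodes
  -- are independent. So the average over edges, and later the one over types, factorise over `v`.
  have step : ∀ a : V → X, edgeExp P (Function.update a u x) (fun ξ =>
      if G (Function.update a u x u) ∧ ¬ ∃ v, v ≠ u ∧
        W (Function.update a u x u) (Function.update a u x v) ∧ ξ s(u, v) = true
        then 1 else 0) ≤ ∏ v ∈ Finset.univ.erase u, (1 - χ (a v) * P s(x, a v)) := by
    intro a
    set a' := Function.update a u x with ha'
    have hau : a' u = x := by simp [ha']
    have hB := isWeight_bern (V := V) hP a'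
    calc _ ≤ edgeExp P a' (fun ξ => ∏ v ∈ Finset.univ.erase u,
          (1 - χ (a v) * ind (ξ s(u, v)))) := by
          refine pexp_mono hB fun ξ => ?_
          have hnn : ∀ v, 0 ≤ 1 - χ (a v) * ind (ξ s(u, v)) := by
            intro v
            rcases hχ01 (a v) with h | h <;> rw [h] <;> unfold ind <;> split_ifs <;> norm_num
          split_ifs with h
          · refine le_of_eq (Finset.prod_eq_one fun v hv => ?_).symm
            have hv : v ≠ u := by simpa using hv
            have hav : a' v = a v := by simp [ha', hv]
            by_cases hW : W x (a v)
            · have : ξ s(u, v) ≠ true := fun hξ =>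
                h.2 ⟨v, hv, by rwa [hau, hav], hξ⟩
              simp [ind, this]
            · simp [hχ, hW]
          · exact Finset.prod_nonneg fun v _ => hnn v
      _ = ∏ v ∈ Finset.univ.erase u, edgeExp P a' (fun ξ => 1 - χ (a v) * ind (ξ s(u, v))) := by
          refine pexp_finset_prod hB _ (fun v (ξ : Sym2 V → Bool) =>
            1 - χ (a v) * ind (ξ s(u, v))) (fun v => {s(u, v)}) ?_ ?_
          · intro v _ ξ ξ' h
            simp [h _ rfl]
          · intro v hv v' _ hvv
            have hv : v ≠ u := by simpa using hv
            simp [hvv, hv]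
      _ = _ := by
          refine Finset.prod_congr rfl fun v hv => ?_
          have hv : v ≠ u := by simpa using hv
          have hav : a' v = a v := by simp [ha', hv]
          have := edgeExp_ind hP a' s(u, v)
          unfold edgeExp at this ⊢
          rw [pexp_sub, pexp_const hB, pexp_mul_left, this]
          simp [hau, hav]
  refine (pexp_mono hm step).trans ?_
  rw [pexp_finset_prod hm _ (fun v (a : V → X) => 1 - χ (a v) * P s(x, a v)) (fun v => {v})]
  · calc _ = ∏ v ∈ Finset.univ.erase u, (1 - ∑ y, if W x y then m y * P s(x, y) else 0) := by
          refine Finset.prod_congr rfl fun v _ => ?_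
          rw [pexp_single hm v (fun y => 1 - χ y * P s(x, y))]
          simp only [mul_sub, mul_one, Finset.sum_sub_distrib, hm1]
          congr 1
          refine Finset.sum_congr rfl fun y _ => ?_
          by_cases h : W x y <;> simp [hχ, h]
      _ ≤ ∏ v ∈ Finset.univ.erase u, (1 - q) := by
          refine Finset.prod_le_prod (fun v _ => ?_) fun v _ => by linarith [hq x hx]
          have : ∑ y, (if W x y then m y * P s(x, y) else 0) ≤ ∑ y, m y :=
            Finset.sum_le_sum fun y _ => by
              split_ifs
              · exact mul_le_of_le_one_right (hm0 y) (hP _).2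
              · exact hm0 y
          linarith
      _ = _ := by
          rw [Finset.prod_const, Finset.card_erase_of_mem (Finset.mem_univ u), Finset.card_univ]
  · intro v _ a a' h
    simp [h v rfl]
  · intro v _ v' _ hvv
    simp [hvv]

open scoped Classical in
lemma prob_edge (hm : IsWeight fun _ : V => m) (hP : ∀ e, P e ∈ Set.Icc 0 1) (A : X → Prop)
    {u v : V} (huv : u ≠ v) :
    prob m P (fun a ξ => A (a u) ∧ ξ s(u, v) = true) =
      ∑ x, if A x then m x * ∑ y, m y * P s(x, y) else 0 := by
  have h1 : ∀ a : V → X, edgeExp P a (fun ξ => if A (a u) ∧ ξ s(u, v) = true then 1 else 0) =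
      (if A (a u) then 1 else 0) * P s(a u, a v) := by
    intro a
    rw [← Sym2.map_mk, ← edgeExp_ind hP a s(u, v), edgeExp, edgeExp, ← pexp_mul_left]
    congr 1
    ext ξ
    by_cases h : A (a u) <;> simp [h, ind]
  rw [prob_eq]
  simp only [h1]
  rw [pexp_coord₂ hm huv (fun x y _ => (if A x then 1 else 0) * P s(x, y)) (s := ∅)
    (fun _ _ _ _ _ => rfl) (by simp) (by simp)]
  refine Finset.sum_congr rfl fun x _ => ?_
  by_cases h : A x
  · simp only [h, if_true, one_mul, pexp_const hm, Finset.mul_sum]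
    exact Finset.sum_congr rfl fun y _ => by ring
  · simp [h, pexp_const hm]

open scoped Classical in
lemma prob_forall_not (hm : IsWeight fun _ : V => m) (hP : ∀ e, P e ∈ Set.Icc 0 1)
    (hm1 : ∑ x, m x = 1) (A : X → Prop) (S : Finset V) :
    prob m P (fun a _ => ∀ u ∈ S, ¬ A (a u)) = (1 - ∑ x, if A x then m x else 0) ^ S.card := by
  have h1 : ∀ a : V → X, edgeExp P a (fun _ => if ∀ u ∈ S, ¬ A (a u) then 1 else 0) =
      ∏ u ∈ S, (1 - if A (a u) then 1 else 0) := by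
    intro a
    rw [edgeExp, pexp_const (isWeight_bern hP a)]
    by_cases h : ∀ u ∈ S, ¬ A (a u)
    · rw [if_pos h]
      exact (Finset.prod_eq_one fun u hu => by simp [h u hu]).symm
    · rw [if_neg h]
      push Not at h
      obtain ⟨u, hu, hA⟩ := h
      exact (Finset.prod_eq_zero hu (by simp [hA])).symm
  rw [prob_eq]
  simp only [h1]
  rw [pexp_finset_prod hm S (fun u (a : V → X) => 1 - if A (a u) then 1 else 0) (fun v => {v})]
  · rw [← Finset.prod_const]
    refine Finset.prod_congr rfl fun u _ => ?_
    rw [pexp_single hm u (fun x => 1 - if A x then 1 else 0)]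
    simp [mul_sub, Finset.sum_sub_distrib, hm1]
  · intro v _ a a' h
    simp [h v rfl]
  · intro v _ v' _ hvv
    simp [hvv]

open scoped Classical in
/-- Upper bound on the probability of connectedness by means of the nodes of `S` whose types
satisfy `A`. -/
lemma prob_connected_le (hm : IsWeight fun _ : V => m) (hP : ∀ e, P e ∈ Set.Icc 0 1)
    (hm1 : ∑ x, m x = 1) (A : X → Prop) (S : Finset V) (hV : 2 ≤ Fintype.card V) {D : ℝ}
    (hD0 : 0 ≤ D) (hD : ∀ x, A x → ∑ y, m y * P s(x, y) ≤ D) :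
    prob m P (fun _ (ξ : Sym2 V → Bool) => (indGraph ξ).Connected) ≤
      (1 - ∑ x, if A x then m x else 0) ^ S.card +
        S.card * (Fintype.card V * ((∑ x, if A x then m x else 0) * D)) := by
  have hm0 : ∀ x, 0 ≤ m x := by
    have : Nonempty V := Fintype.card_pos_iff.mp (by omega)
    exact fun x => hm.nonneg (Classical.arbitrary V) x
  have hpD : 0 ≤ (∑ x, if A x then m x else 0) * D :=
    mul_nonneg (Finset.sum_nonneg fun x _ => by split_ifs <;> simp [hm0]) hD0
  calc prob m P (fun _ ξ => (indGraph ξ).Connected)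
      -- In a connected graph with at least two nodes no node is isolated: if `S` contains a node of
      -- kind `A`, some such node has an edge. Only this first moment over `S` is needed, not the
      -- variance of the number of isolated nodes.
      ≤ prob m P (fun a ξ => (∀ u ∈ S, ¬ A (a u)) ∨
          ∃ u ∈ S, ∃ v ∈ Finset.univ.erase u, A (a u) ∧ ξ s(u, v) = true) := by
        refine prob_mono hm hP fun a ξ hc => ?_
        by_cases h : ∀ u ∈ S, ¬ A (a u)
        · exact Or.inl h
        · right
          push Not at h
          obtain ⟨u, hu, hA⟩ := h
          have : Nontrivial V := Fintype.one_lt_card_iff_nontrivial.mp hV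
          obtain ⟨v, hv⟩ := hc.preconnected.exists_adj_of_nontrivial u
          have := indGraph_adj.mp hv
          exact ⟨u, hu, v, by simpa using this.2.symm, hA, this.1⟩
    _ ≤ _ := by
        refine (prob_or_le hm hP _ _).trans (add_le_add (prob_forall_not hm hP hm1 A S).le ?_)
        refine (prob_exists_le hm hP S _).trans ?_
        refine (Finset.sum_le_card_nsmul S _ _ fun u _ => ?_).trans_eq (nsmul_eq_mul _ _)
        refine (prob_exists_le hm hP _ _).trans ?_
        refine (Finset.sum_le_card_nsmul (Finset.univ.erase u) _
          ((∑ x, if A x then m x else 0) * D) fun v hv => ?_).trans ?_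
        · have hv : v ≠ u := by simpa using hv
          rw [prob_edge hm hP A hv.symm, Finset.sum_mul]
          refine Finset.sum_le_sum fun x _ => ?_
          split_ifs with h
          · exact mul_le_mul_of_nonneg_left (hD x h) (hm0 x)
          · simp
        · rw [nsmul_eq_mul]
          refine mul_le_mul_of_nonneg_right ?_ hpD
          exact_mod_cast Finset.card_le_univ _

end Neighbours

/-! ### From the measures of the model to finite weighted sums. -/

section Law

/-- The probability vector `(p, 1 - p)`. -/
def coordWeight (p : ℝ) (b : Fin 2) : ℝ := if b = 0 then p else 1 - p

/-- The product weights on attribute vectors. -/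
noncomputable def attrWeight (l : ℕ) (p : ℝ) (x : Fin l → Fin 2) : ℝ := ∏ i, coordWeight p (x i)

/-- The entries of the affinity matrix as reals. -/
def aff (α β γ : ℝ) (x y : Fin 2) : ℝ :=
  if x = 0 then (if y = 0 then α else β) else (if y = 0 then β else γ)

lemma aff_comm (α β γ : ℝ) (x y : Fin 2) : aff α β γ x y = aff α β γ y x := by
  unfold aff; split_ifs <;> rfl

/-- Edge probability as a function of the unordered pair of attribute vectors. -/
noncomputable def pairProb (l : ℕ) (α β γ : ℝ) : Sym2 (Fin l → Fin 2) → ℝ :=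
  Sym2.lift ⟨fun x y => ∏ i, aff α β γ (x i) (y i), fun _ _ =>
    Finset.prod_congr rfl fun _ _ => aff_comm _ _ _ _ _⟩

lemma pairProb_mk (l : ℕ) (α β γ : ℝ) (x y : Fin l → Fin 2) :
    pairProb l α β γ s(x, y) = ∏ i, aff α β γ (x i) (y i) := rfl

lemma coe_affinity (α β γ : I) (x y : Fin 2) :
    (affinity α β γ x y : ℝ) = aff α β γ x y := by
  fin_cases x <;> fin_cases y <;> simp [affinity, aff]

lemma coe_edgeProb {n l : ℕ} (α β γ : I) (a : Attributes n l) (e : Sym2 (Fin n)) :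
    (edgeProb α β γ a e : ℝ) = pairProb l α β γ (e.map a) := by
  induction e using Sym2.ind with
  | _ u v =>
    rw [Sym2.map_mk, pairProb_mk]
    simp only [edgeProb, Sym2.lift_mk, ← coe_affinity]
    exact map_prod (⟨⟨fun t : I => (t : ℝ), rfl⟩, fun _ _ => rfl⟩ : I →* ℝ) _ _

lemma bernoulliMeasure_zero_one_singleton (p : I) (b : Fin 2) :
    bernoulliMeasure (0 : Fin 2) 1 p {b} = ENNReal.ofReal (coordWeight p b) := by
  classical
  rw [bernoulliMeasure_apply p (measurableSet_singleton b)]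
  fin_cases b
  · simp [coordWeight, ENNReal.ofReal, unitInterval.toNNReal]
    exact congrArg _ (NNReal.eq (by simp [p.2.1]; rfl))
  · simp [coordWeight, ENNReal.ofReal, unitInterval.toNNReal]
    exact congrArg _ (NNReal.eq (by simp [p.2.2]; rfl))

lemma bernoulliMeasure_bool_singleton (p : I) (b : Bool) :
    bernoulliMeasure true false p {b} = ENNReal.ofReal (bern p b) := by
  classical
  rw [bernoulliMeasure_apply p (measurableSet_singleton b)]
  cases b
  · simp [bern, ENNReal.ofReal, unitInterval.toNNReal]
    exact congrArg _ (NNReal.eq (by simp [p.2.2]; rfl))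
  · simp [bern, ENNReal.ofReal, unitInterval.toNNReal]
    exact congrArg _ (NNReal.eq (by simp [p.2.1]; rfl))

lemma coordWeight_nonneg {p : ℝ} (hp : p ∈ Set.Icc (0 : ℝ) 1) (b : Fin 2) :
    0 ≤ coordWeight p b := by
  have h1 := hp.1
  have h2 := hp.2
  unfold coordWeight
  split_ifs <;> linarith

lemma attrWeight_nonneg {l : ℕ} {p : ℝ} (hp : p ∈ Set.Icc (0 : ℝ) 1) (x : Fin l → Fin 2) :
    0 ≤ attrWeight l p x :=
  Finset.prod_nonneg fun i _ => coordWeight_nonneg hp (x i)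

/-- Sums over attribute vectors of products over the attributes factorize. -/
lemma sum_prod_coord {l : ℕ} (f : Fin l → Fin 2 → ℝ) :
    ∑ x : Fin l → Fin 2, ∏ i, f i (x i) = ∏ i, (f i 0 + f i 1) := by
  have := Finset.prod_univ_sum (fun _ : Fin l => (Finset.univ : Finset (Fin 2))) f
  simp only [Fin.sum_univ_two, Fintype.piFinset_univ] at this
  exact this.symm

lemma sum_attrWeight (l : ℕ) (p : ℝ) : ∑ x, attrWeight l p x = 1 := by
  unfold attrWeight
  rw [sum_prod_coord]
  simp [coordWeight]

lemma attrLaw_singleton {n l : ℕ} (μ : I) (a : Attributes n l) :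
    attrLaw n l μ {a} = ENNReal.ofReal (∏ u, attrWeight l μ (a u)) := by
  rw [attrLaw, Measure.pi_singleton,
    ENNReal.ofReal_prod_of_nonneg fun u _ => attrWeight_nonneg μ.2 (a u)]
  refine Finset.prod_congr rfl fun u _ => ?_
  rw [Measure.pi_singleton, attrWeight,
    ENNReal.ofReal_prod_of_nonneg fun i _ => coordWeight_nonneg μ.2 (a u i)]
  exact Finset.prod_congr rfl fun i _ => bernoulliMeasure_zero_one_singleton μ _

lemma pairProb_mem (l : ℕ) {α β γ : ℝ} (hα : α ∈ Set.Icc (0 : ℝ) 1) (hβ : β ∈ Set.Icc (0 : ℝ) 1)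
    (hγ : γ ∈ Set.Icc (0 : ℝ) 1) (e : Sym2 (Fin l → Fin 2)) :
    pairProb l α β γ e ∈ Set.Icc (0 : ℝ) 1 := by
  induction e using Sym2.ind with
  | _ x y =>
    rw [pairProb_mk]
    have h : ∀ i, aff α β γ (x i) (y i) ∈ Set.Icc (0 : ℝ) 1 := by
      intro i; unfold aff; split_ifs <;> assumption
    exact ⟨Finset.prod_nonneg fun i _ => (h i).1, Finset.prod_le_one (fun i _ => (h i).1)
      fun i _ => (h i).2⟩

lemma edgeLaw_apply {n l : ℕ} (α β γ : I) (a : Attributes n l) (S : Set (Sym2 (Fin n) → Bool))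
    [DecidablePred (· ∈ S)] :
    edgeLaw α β γ a S =
      ENNReal.ofReal (edgeExp (pairProb l α β γ) a fun ξ => if ξ ∈ S then 1 else 0) := by
  have hb : ∀ (e : Sym2 (Fin n)) (b : Bool), 0 ≤ bern (pairProb l α β γ (e.map a)) b :=
    fun e b => (isWeight_bern (pairProb_mem l α.2 β.2 γ.2) a).nonneg e b
  have hS : MeasurableSet S := S.toFinite.measurableSet
  rw [← lintegral_indicator_one hS, lintegral_fintype, edgeExp, pexp,
    ENNReal.ofReal_sum_of_nonneg]
  · refine Finset.sum_congr rfl fun ξ _ => ?_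
    rw [ENNReal.ofReal_mul (Finset.prod_nonneg fun e _ => hb e _), edgeLaw,
      Measure.pi_singleton, ENNReal.ofReal_prod_of_nonneg fun e _ => hb e _, mul_comm]
    congr 1
    · refine Finset.prod_congr rfl fun e _ => ?_
      rw [bernoulliMeasure_bool_singleton, coe_edgeProb]
    · by_cases h : ξ ∈ S <;> simp [h]
  · intro ξ _
    refine mul_nonneg (Finset.prod_nonneg fun e _ => hb e _) ?_
    split_ifs <;> norm_num

/-- The bridge between the measure-theoretic model and the elementary calculus of `prob`; after it
all estimates concern finite sums of reals. -/
lemma graphLaw_eq_prob (n l : ℕ) (μ α β γ : I) (Q : SimpleGraph (Fin n) → Prop) :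
    graphLaw n l μ α β γ {G | Q G} = ENNReal.ofReal
      (prob (attrWeight l μ) (pairProb l α β γ) fun _ (ξ : Sym2 (Fin n) → Bool) =>
        Q (indGraph ξ)) := by
  classical
  have hw : ∀ a : Attributes n l, 0 ≤ ∏ u, attrWeight l μ (a u) := fun a =>
    Finset.prod_nonneg fun u _ => attrWeight_nonneg μ.2 _
  rw [graphLaw_apply, lintegral_fintype, prob_eq, pexp, ENNReal.ofReal_sum_of_nonneg]
  · refine Finset.sum_congr rfl fun a _ => ?_
    rw [ENNReal.ofReal_mul (hw a), attrLaw_singleton, mul_comm, edgeLaw_apply]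
    rfl
  · intro a _
    refine mul_nonneg (hw a) (pexp_nonneg (isWeight_bern (pairProb_mem l α.2 β.2 γ.2) a)
      fun ξ => ?_)
    split_ifs <;> norm_num

/-- A property holds with high probability as soon as the probability of its failure is bounded
by a null sequence. -/
lemma whp_of_prob_le {l : ℕ → ℕ} {μ α β γ : I} {Q : ∀ n, SimpleGraph (Fin n) → Prop} {f : ℕ → ℝ}
    (hf : Tendsto f atTop (𝓝 0))
    (h : ∀ᶠ n in atTop, prob (attrWeight (l n) μ) (pairProb (l n) α β γ)
      (fun _ (ξ : Sym2 (Fin n) → Bool) => ¬ Q n (indGraph ξ)) ≤ f n) :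
    WHP l μ α β γ Q := by
  have h1 : Tendsto (fun n => 1 - ENNReal.ofReal (f n)) atTop (𝓝 1) := by
    have := ENNReal.Tendsto.sub (tendsto_const_nhds (x := (1 : ENNReal)))
      (ENNReal.tendsto_ofReal hf) (Or.inl ENNReal.one_ne_top)
    simpa using this
  refine tendsto_of_tendsto_of_tendsto_of_le_of_le' h1 tendsto_const_nhds ?_
    (Eventually.of_forall fun n => prob_le_one)
  filter_upwards [h] with n hn
  have hc : graphLaw n (l n) μ α β γ {G | Q n G}ᶜ ≤ ENNReal.ofReal (f n) := by
    have e : {G : SimpleGraph (Fin n) | Q n G}ᶜ = {G | ¬ Q n G} := rfl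
    rw [e, graphLaw_eq_prob]
    exact ENNReal.ofReal_le_ofReal hn
  have hu : (1 : ENNReal) ≤ graphLaw n (l n) μ α β γ {G | Q n G} +
      graphLaw n (l n) μ α β γ {G | Q n G}ᶜ := by
    rw [← measure_univ (μ := graphLaw n (l n) μ α β γ), ← Set.union_compl_self {G | Q n G}]
    exact measure_union_le _ _
  exact tsub_le_iff_right.mpr (hu.trans (add_le_add le_rfl hc))

end Law

/-! ### Exponential concentration of the number of zeros. -/

section Concentration

/-- The number of attributes equal to `0`. -/
noncomputable def zeros {l : ℕ} (x : Fin l → Fin 2) : ℝ := ∑ i, if x i = 0 then 1 else 0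

lemma zeros_nonneg {l : ℕ} (x : Fin l → Fin 2) : 0 ≤ zeros x :=
  Finset.sum_nonneg fun i _ => by split_ifs <;> norm_num

lemma zeros_le {l : ℕ} (x : Fin l → Fin 2) : zeros x ≤ l := by
  calc zeros x ≤ ∑ _i : Fin l, (1 : ℝ) := Finset.sum_le_sum fun i _ => by split_ifs <;> norm_num
    _ = l := by simp

lemma sum_ite_zero {l : ℕ} (x : Fin l → Fin 2) (s t : ℝ) :
    ∑ i, (if x i = 0 then s else t) = zeros x * s + (l - zeros x) * t := by
  have : ∀ i, (if x i = 0 then s else t) = (if x i = 0 then (1 : ℝ) else 0) * (s - t) + t := by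
    intro i; split_ifs <;> ring
  simp only [this, Finset.sum_add_distrib, ← Finset.sum_mul]
  simp [zeros]
  ring

lemma isWeight_coord {l : ℕ} {r : Fin l → ℝ} (hr : ∀ i, r i ∈ Set.Icc (0 : ℝ) 1) :
    IsWeight fun i => coordWeight (r i) where
  nonneg i x := coordWeight_nonneg (hr i) x
  sum_eq_one i := by simp [coordWeight]

/-- Use `exp t ≤ 1 + t + t ^ 2` for `|t| ≤ 1`. The variable is centred, so the linear terms cancel,
and its variance `r * (1 - r)` is at most one. -/
lemma mgf_coord_le {r s : ℝ} (hr : r ∈ Set.Icc (0 : ℝ) 1) (hs : |s| ≤ 1) :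
    r * Real.exp (s * (1 - r)) + (1 - r) * Real.exp (s * (0 - r)) ≤ Real.exp (s ^ 2) := by
  obtain ⟨h0, h1⟩ := hr
  have key : ∀ t : ℝ, |t| ≤ 1 → Real.exp t ≤ 1 + t + t ^ 2 := fun t ht => by
    have := (abs_le.mp (Real.abs_exp_sub_one_sub_id_le ht)).2
    linarith
  have hb : ∀ v : ℝ, |v| ≤ 1 → |s * v| ≤ 1 := fun v hv => by
    rw [abs_mul]; exact mul_le_one₀ hs (abs_nonneg _) hv
  have e1 := key (s * (1 - r)) (hb _ (by rw [abs_le]; constructor <;> linarith))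
  have e2 := key (s * (0 - r)) (hb _ (by rw [abs_le]; constructor <;> linarith))
  have e3 := Real.add_one_le_exp (s ^ 2)
  have h2 : r * (1 - r) ≤ 1 := by nlinarith
  calc _ ≤ r * (1 + s * (1 - r) + (s * (1 - r)) ^ 2) +
        (1 - r) * (1 + s * (0 - r) + (s * (0 - r)) ^ 2) :=
        add_le_add (mul_le_mul_of_nonneg_left e1 h0)
          (mul_le_mul_of_nonneg_left e2 (by linarith))
    _ = 1 + s ^ 2 * (r * (1 - r)) := by ring
    _ ≤ 1 + s ^ 2 * 1 := by gcongr
    _ ≤ Real.exp (s ^ 2) := by linarith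

lemma mgf_zeros_le {l : ℕ} {r : Fin l → ℝ} (hr : ∀ i, r i ∈ Set.Icc (0 : ℝ) 1) {s : ℝ}
    (hs : |s| ≤ 1) :
    pexp (fun i => coordWeight (r i)) (fun y => Real.exp (s * (zeros y - ∑ i, r i))) ≤
      Real.exp (s ^ 2 * l) := by
  have e : (fun y : Fin l → Fin 2 => Real.exp (s * (zeros y - ∑ i, r i))) =
      fun y => ∏ i, Real.exp (s * ((if y i = 0 then 1 else 0) - r i)) := by
    ext y
    rw [← Real.exp_sum, ← Finset.mul_sum, Finset.sum_sub_distrib, zeros]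
  rw [e, pexp_prod (fun i => coordWeight (r i))
    (fun i b => Real.exp (s * ((if b = 0 then 1 else 0) - r i)))]
  calc _ ≤ ∏ _i : Fin l, Real.exp (s ^ 2) := by
        refine Finset.prod_le_prod (fun i _ => Finset.sum_nonneg fun b _ =>
          mul_nonneg (coordWeight_nonneg (hr i) b) (Real.exp_pos _).le) fun i _ => ?_
        have := mgf_coord_le (hr i) hs
        simpa [coordWeight] using this
    _ = _ := by
        rw [Finset.prod_const, Finset.card_univ, Fintype.card_fin, ← Real.exp_nat_mul]
        ring_nf

/-- Exponential concentration of the number of zeros under a product law. -/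
lemma zeros_concentration {l : ℕ} {r : Fin l → ℝ} (hr : ∀ i, r i ∈ Set.Icc (0 : ℝ) 1) {ε : ℝ}
    (h0 : 0 ≤ ε) (h2 : ε ≤ 2) :
    pexp (fun i => coordWeight (r i)) (fun y => if ε * l ≤ |zeros y - ∑ i, r i| then 1 else 0) ≤
      2 * Real.exp (-(ε ^ 2 / 4 * l)) := by
  have hw := isWeight_coord hr
  -- `|s| = ε / 2` minimises the exponent `-|s| * ε + s ^ 2`, with value `-ε ^ 2 / 4`. The bound `ε
  -- ≤ 2` ensures `|s| ≤ 1`.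
  have tail : ∀ s : ℝ, |s| = ε / 2 → pexp (fun i => coordWeight (r i)) (fun y =>
      Real.exp (-(ε / 2 * (ε * l))) * Real.exp (s * (zeros y - ∑ i, r i))) ≤
        Real.exp (-(ε ^ 2 / 4 * l)) := by
    intro s hs
    rw [pexp_mul_left]
    calc _ ≤ Real.exp (-(ε / 2 * (ε * l))) * Real.exp (s ^ 2 * l) :=
          mul_le_mul_of_nonneg_left (mgf_zeros_le hr (by rw [hs]; linarith)) (Real.exp_pos _).le
      _ = _ := by
          rw [← Real.exp_add, ← sq_abs s, hs]
          ring_nf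
  calc _ ≤ pexp (fun i => coordWeight (r i)) (fun y =>
        Real.exp (-(ε / 2 * (ε * l))) * Real.exp (ε / 2 * (zeros y - ∑ i, r i)) +
        Real.exp (-(ε / 2 * (ε * l))) * Real.exp (-(ε / 2) * (zeros y - ∑ i, r i))) := by
        refine pexp_mono hw fun y => ?_
        have hp1 := Real.exp_pos (-(ε / 2 * (ε * l)))
        have hp2 := Real.exp_pos (ε / 2 * (zeros y - ∑ i, r i))
        have hp3 := Real.exp_pos (-(ε / 2) * (zeros y - ∑ i, r i))
        split_ifs with h
        · rw [← Real.exp_add, ← Real.exp_add]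
          rcases le_abs.mp h with h | h
          · have : (1 : ℝ) ≤ Real.exp (-(ε / 2 * (ε * l)) + ε / 2 * (zeros y - ∑ i, r i)) :=
              Real.one_le_exp (by nlinarith)
            have := Real.exp_pos (-(ε / 2 * (ε * l)) + -(ε / 2) * (zeros y - ∑ i, r i))
            linarith
          · have : (1 : ℝ) ≤ Real.exp (-(ε / 2 * (ε * l)) + -(ε / 2) * (zeros y - ∑ i, r i)) :=
              Real.one_le_exp (by nlinarith)
            have := Real.exp_pos (-(ε / 2 * (ε * l)) + ε / 2 * (zeros y - ∑ i, r i))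
            linarith
        · positivity
    _ ≤ _ := by
        rw [pexp_add, two_mul]
        exact add_le_add (tail _ (abs_of_nonneg (by linarith)))
          (tail _ (by rw [abs_neg]; exact abs_of_nonneg (by linarith)))

end Concentration

/-! ### The neighbour chain on attribute vectors and its diagonalisation. -/

section Kernel

/-- The standing assumptions on the parameters of the model. -/
structure Valid (μ α β γ : ℝ) : Prop where
  μ_pos : 0 < μ
  μ_lt_one : μ < 1
  γ_pos : 0 < γ
  γ_lt : γ < β
  β_lt : β < α
  α_lt_one : α < 1

/-- The factor which an attribute `0` of a node contributes to its expected degree. -/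
def degZero (μ α β : ℝ) : ℝ := μ * α + (1 - μ) * β

/-- The factor which an attribute `1` of a node contributes to its expected degree. -/
def degOne (μ β γ : ℝ) : ℝ := μ * β + (1 - μ) * γ

/-- The factor of one attribute in the expected edge density. -/
def density (μ α β γ : ℝ) : ℝ := μ * degZero μ α β + (1 - μ) * degOne μ β γ

/-- The probability of a `0` at the neighbour across an attribute `0`. -/
noncomputable def nbrZero (μ α β : ℝ) : ℝ := μ * α / degZero μ α β

/-- The probability of a `0` at the neighbour across an attribute `1`. -/
noncomputable def nbrOne (μ β γ : ℝ) : ℝ := μ * β / degOne μ β γ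

/-- The fraction of zeros at a node chosen in proportion to its degree. -/
noncomputable def statZero (μ α β γ : ℝ) : ℝ := μ * degZero μ α β / density μ α β γ

/-- The second eigenvalue of the one-attribute chain. -/
noncomputable def gapEig (μ α β γ : ℝ) : ℝ := nbrZero μ α β - nbrOne μ β γ

/-- Expected degree (divided by the number of nodes) of a node with given attributes. -/
noncomputable def degree (μ α β γ : ℝ) {l : ℕ} (x : Fin l → Fin 2) : ℝ :=
  ∏ i, if x i = 0 then degZero μ α β else degOne μ β γ

variable {μ α β γ : ℝ}

section

variable (h : Valid μ α β γ)
include h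

lemma Valid.degZero_pos : 0 < degZero μ α β := by
  have h1 := h.μ_pos; have h2 := h.μ_lt_one; have h3 := h.γ_pos
  have h4 := h.γ_lt; have h5 := h.β_lt
  have : 0 < 1 - μ := by linarith
  have : 0 < β := by linarith
  have : 0 < α := by linarith
  unfold degZero; positivity

lemma Valid.degOne_pos : 0 < degOne μ β γ := by
  have h1 := h.μ_pos; have h2 := h.μ_lt_one; have h3 := h.γ_pos
  have h4 := h.γ_lt
  have : 0 < 1 - μ := by linarith
  have : 0 < β := by linarith
  unfold degOne; positivity

lemma Valid.degOne_lt_degZero : degOne μ β γ < degZero μ α β := by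
  have h1 := h.μ_pos; have h2 := h.μ_lt_one
  have h4 := h.γ_lt; have h5 := h.β_lt
  unfold degOne degZero
  nlinarith

lemma Valid.density_pos : 0 < density μ α β γ := by
  have h1 := h.μ_pos; have h2 := h.μ_lt_one
  have : 0 < 1 - μ := by linarith
  have := h.degZero_pos; have := h.degOne_pos
  unfold density; positivity

lemma Valid.one_sub_nbrZero : 1 - nbrZero μ α β = (1 - μ) * β / degZero μ α β := by
  have := h.degZero_pos.ne'
  unfold nbrZero
  field_simp
  unfold degZero; ring

lemma Valid.one_sub_nbrOne : 1 - nbrOne μ β γ = (1 - μ) * γ / degOne μ β γ := by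
  have := h.degOne_pos.ne'
  unfold nbrOne
  field_simp
  unfold degOne; ring

lemma Valid.one_sub_statZero :
    1 - statZero μ α β γ = (1 - μ) * degOne μ β γ / density μ α β γ := by
  have := h.density_pos.ne'
  unfold statZero
  field_simp
  unfold density; ring

lemma Valid.nbrZero_mem : nbrZero μ α β ∈ Set.Ioo μ 1 := by
  have h1 := h.μ_pos; have h2 := h.μ_lt_one; have h3 := h.γ_pos
  have h4 := h.γ_lt; have h5 := h.β_lt
  have hA := h.degZero_pos
  constructor
  · rw [nbrZero, lt_div_iff₀ hA]
    unfold degZero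
    nlinarith [mul_pos h1 (mul_pos (sub_pos.mpr h2) (sub_pos.mpr h5))]
  · have : 0 < 1 - nbrZero μ α β := by
      rw [h.one_sub_nbrZero]
      exact div_pos (mul_pos (by linarith) (by linarith)) hA
    linarith

lemma Valid.nbrOne_mem : nbrOne μ β γ ∈ Set.Ioo μ 1 := by
  have h1 := h.μ_pos; have h2 := h.μ_lt_one; have h3 := h.γ_pos
  have h4 := h.γ_lt; have h5 := h.β_lt
  have hA := h.degOne_pos
  constructor
  · rw [nbrOne, lt_div_iff₀ hA]
    unfold degOne
    nlinarith [mul_pos h1 (mul_pos (sub_pos.mpr h2) (sub_pos.mpr h4))]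
  · have : 0 < 1 - nbrOne μ β γ := by
      rw [h.one_sub_nbrOne]
      exact div_pos (mul_pos (by linarith) (by linarith)) hA
    linarith

lemma Valid.abs_gapEig_lt : |gapEig μ α β γ| < 1 := by
  have h0 := h.nbrZero_mem; have h1 := h.nbrOne_mem; have h2 := h.μ_pos
  rw [abs_lt, gapEig]
  constructor <;> linarith [h0.1, h0.2, h1.1, h1.2]

lemma Valid.statZero_mem : statZero μ α β γ ∈ Set.Ioo μ 1 := by
  have h1 := h.μ_pos; have h2 := h.μ_lt_one
  have hZ := h.density_pos
  have hAB := h.degOne_lt_degZero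
  constructor
  · rw [statZero, lt_div_iff₀ hZ]
    unfold density
    nlinarith [mul_pos h1 (mul_pos (sub_pos.mpr h2) (sub_pos.mpr hAB))]
  · have : 0 < 1 - statZero μ α β γ := by
      rw [h.one_sub_statZero]
      exact div_pos (mul_pos (by linarith) h.degOne_pos) hZ
    linarith

lemma Valid.degree_pos {l : ℕ} (x : Fin l → Fin 2) : 0 < degree μ α β γ x :=
  Finset.prod_pos fun i _ => by
    split_ifs
    · exact h.degZero_pos
    · exact h.degOne_pos

lemma Valid.degree_eq_exp {l : ℕ} (x : Fin l → Fin 2) :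
    degree μ α β γ x = Real.exp (zeros x * Real.log (degZero μ α β) +
      (l - zeros x) * Real.log (degOne μ β γ)) := by
  rw [← sum_ite_zero, Real.exp_sum, degree]
  refine Finset.prod_congr rfl fun i _ => ?_
  split_ifs
  · rw [Real.exp_log h.degZero_pos]
  · rw [Real.exp_log h.degOne_pos]

/-- The law of the attributes of a neighbour. -/
lemma Valid.attrWeight_mul_pairProb {l : ℕ} (x y : Fin l → Fin 2) :
    attrWeight l μ y * pairProb l α β γ s(x, y) = degree μ α β γ x *
      ∏ i, coordWeight (if x i = 0 then nbrZero μ α β else nbrOne μ β γ) (y i) := by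
  rw [pairProb_mk, attrWeight, degree, ← Finset.prod_mul_distrib, ← Finset.prod_mul_distrib]
  refine Finset.prod_congr rfl fun i _ => ?_
  have hA := h.degZero_pos.ne'; have hB := h.degOne_pos.ne'
  unfold coordWeight aff
  split_ifs
  · unfold nbrZero; field_simp
  · unfold nbrOne; field_simp
  · rw [h.one_sub_nbrZero]; field_simp
  · rw [h.one_sub_nbrOne]; field_simp

lemma Valid.nbr_mem {l : ℕ} (x : Fin l → Fin 2) (i : Fin l) :
    (if x i = 0 then nbrZero μ α β else nbrOne μ β γ) ∈ Set.Icc (0 : ℝ) 1 := by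
  have h0 := h.nbrZero_mem; have h1 := h.nbrOne_mem; have h2 := h.μ_pos
  split_ifs
  · exact ⟨by linarith [h0.1], h0.2.le⟩
  · exact ⟨by linarith [h1.1], h1.2.le⟩

lemma Valid.sum_attrWeight_mul_pairProb {l : ℕ} (x : Fin l → Fin 2) :
    ∑ y, attrWeight l μ y * pairProb l α β γ s(x, y) = degree μ α β γ x := by
  simp only [h.attrWeight_mul_pairProb, ← Finset.mul_sum]
  have := pexp_const (isWeight_coord (h.nbr_mem x)) 1
  simp only [pexp, mul_one] at this
  rw [this, mul_one]

/-- Most of the expected degree of a node comes from neighbours with a typical number of zeros. -/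
lemma Valid.le_sum_typical {l : ℕ} (x : Fin l → Fin 2) {ε : ℝ} (h0 : 0 ≤ ε) (h2 : ε ≤ 2) :
    degree μ α β γ x * (1 - 2 * Real.exp (-(ε ^ 2 / 4 * l))) ≤
      ∑ y, if |zeros y - (zeros x * nbrZero μ α β + (l - zeros x) * nbrOne μ β γ)| < ε * l
        then attrWeight l μ y * pairProb l α β γ s(x, y) else 0 := by
  have hc := zeros_concentration (h.nbr_mem x) h0 h2
  have ht := pexp_const (isWeight_coord (h.nbr_mem x)) 1
  rw [sum_ite_zero] at hc
  calc _ ≤ degree μ α β γ x * (pexp (fun i => coordWeight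
        (if x i = 0 then nbrZero μ α β else nbrOne μ β γ)) (fun _ => 1) -
        pexp (fun i => coordWeight (if x i = 0 then nbrZero μ α β else nbrOne μ β γ))
        (fun y => if ε * l ≤ |zeros y - (zeros x * nbrZero μ α β + (l - zeros x) * nbrOne μ β γ)|
          then 1 else 0)) := by
        rw [ht]
        exact mul_le_mul_of_nonneg_left (by linarith) (h.degree_pos x).le
    _ = _ := by
        rw [← pexp_sub, pexp, Finset.mul_sum]
        refine Finset.sum_congr rfl fun y _ => ?_
        rw [h.attrWeight_mul_pairProb]
        by_cases hy : ε * l ≤ |zeros y - (zeros x * nbrZero μ α β + (l - zeros x) * nbrOne μ β γ)|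
        · rw [if_pos hy, if_neg (not_lt.mpr hy)]; simp
        · rw [if_neg hy, if_pos (not_le.mp hy)]; ring

end

/-- The reduced kernel on one attribute; the chain with eigenvalue `ϑ` has after `s` steps the
density `1 + ϑ ^ s * coordKer π x y` with respect to the stationary law `(π, 1 - π)`. -/
noncomputable def coordKer (π : ℝ) (x y : Fin 2) : ℝ :=
  if x = 0 then (if y = 0 then (1 - π) / π else -1) else (if y = 0 then -1 else π / (1 - π))

/-- The density after `s` steps of the chain on attribute vectors. -/
noncomputable def iterKer (μ α β γ : ℝ) (s : ℕ) {l : ℕ} (x y : Fin l → Fin 2) : ℝ :=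
  ∏ i, (1 + gapEig μ α β γ ^ s * coordKer (statZero μ α β γ) (x i) (y i))

lemma coordKer_comm (π : ℝ) (x y : Fin 2) : coordKer π x y = coordKer π y x := by
  unfold coordKer; split_ifs <;> rfl

lemma iterKer_comm (s : ℕ) {l : ℕ} (x y : Fin l → Fin 2) :
    iterKer μ α β γ s x y = iterKer μ α β γ s y x :=
  Finset.prod_congr rfl fun i _ => by rw [coordKer_comm]

/-- `coordKer π x y` is `φ x * φ y` for a function `φ` of mean zero and variance one under `(π, 1 -
π)`, the second eigenvector of the two-state chain. Hence the mixed terms vanish and the eigenvalues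
multiply. -/
lemma coordKer_comp {π : ℝ} (h0 : 0 < π) (h1 : π < 1) (s t : ℝ) (x y : Fin 2) :
    coordWeight π 0 * (1 + s * coordKer π x 0) * (1 + t * coordKer π 0 y) +
      coordWeight π 1 * (1 + s * coordKer π x 1) * (1 + t * coordKer π 1 y) =
      1 + s * t * coordKer π x y := by
  have h0' := h0.ne'
  have h1' : 1 - π ≠ 0 := by linarith
  unfold coordWeight coordKer
  fin_cases x <;> fin_cases y <;> simp <;> field_simp <;> ring

lemma coordWeight_mul_coordKer {π : ℝ} (h0 : 0 < π) (h1 : π < 1) (s : ℝ) (x y : Fin 2) :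
    coordWeight π y * (1 + s * coordKer π x y) =
      coordWeight (if x = 0 then π + s * (1 - π) else π - s * π) y := by
  have h0' := h0.ne'
  have h1' : 1 - π ≠ 0 := by linarith
  unfold coordWeight coordKer
  fin_cases x <;> fin_cases y <;> simp <;> field_simp <;> ring

section

variable (h : Valid μ α β γ)
include h

/-- Chapman–Kolmogorov. The index of `iterKer` is the number of steps, whereas `coreIter j` has `j +
1` of them. -/
lemma Valid.iterKer_comp (s t : ℕ) {l : ℕ} (x y : Fin l → Fin 2) :
    ∑ a, attrWeight l (statZero μ α β γ) a * iterKer μ α β γ s x a * iterKer μ α β γ t a y =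
      iterKer μ α β γ (s + t) x y := by
  have hp := h.statZero_mem
  unfold attrWeight iterKer
  simp only [← Finset.prod_mul_distrib]
  rw [sum_prod_coord fun i b => coordWeight (statZero μ α β γ) b *
    (1 + gapEig μ α β γ ^ s * coordKer (statZero μ α β γ) (x i) b) *
    (1 + gapEig μ α β γ ^ t * coordKer (statZero μ α β γ) b (y i))]
  refine Finset.prod_congr rfl fun i _ => ?_
  rw [coordKer_comp (h.μ_pos.trans hp.1) hp.2, pow_add]

/-- One step of the chain is a multiple of the edge probability. -/
lemma Valid.iterKer_one {l : ℕ} (x y : Fin l → Fin 2) :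
    iterKer μ α β γ 1 x y = density μ α β γ ^ l * pairProb l α β γ s(x, y) /
      (degree μ α β γ x * degree μ α β γ y) := by
  have hA := h.degZero_pos.ne'; have hB := h.degOne_pos.ne'; have hZ := h.density_pos.ne'
  have h1 : μ ≠ 0 := h.μ_pos.ne'
  have h2 : 1 - μ ≠ 0 := by linarith [h.μ_lt_one]
  have hZl : density μ α β γ ^ l = ∏ _i : Fin l, density μ α β γ := by simp
  have hg : gapEig μ α β γ = μ * (1 - μ) * (α * γ - β ^ 2) /
      (degZero μ α β * degOne μ β γ) := by
    unfold gapEig nbrZero nbrOne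
    rw [div_sub_div _ _ hA hB]
    congr 1
    unfold degZero degOne; ring
  rw [hZl, pairProb_mk, degree, degree, ← Finset.prod_mul_distrib, ← Finset.prod_mul_distrib,
    ← Finset.prod_div_distrib, iterKer]
  refine Finset.prod_congr rfl fun i _ => ?_
  rw [pow_one, hg]
  unfold coordKer aff
  rw [h.one_sub_statZero, statZero]
  split_ifs <;> field_simp <;> unfold density degZero degOne <;> ring

lemma Valid.iterKer_one_nonneg {l : ℕ} (x y : Fin l → Fin 2) : 0 ≤ iterKer μ α β γ 1 x y := by
  rw [h.iterKer_one]
  have h3 := h.γ_pos; have h4 := h.γ_lt; have h5 := h.β_lt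
  refine div_nonneg (mul_nonneg (pow_nonneg h.density_pos.le _) ?_)
    (mul_pos (h.degree_pos x) (h.degree_pos y)).le
  rw [pairProb_mk]
  exact Finset.prod_nonneg fun i _ => by unfold aff; split_ifs <;> linarith

lemma Valid.iterKer_nonneg (s : ℕ) {l : ℕ} (x y : Fin l → Fin 2) :
    0 ≤ iterKer μ α β γ (s + 1) x y := by
  have hp := h.statZero_mem
  induction s generalizing x with
  | zero => exact h.iterKer_one_nonneg x y
  | succ s ih =>
    rw [add_comm, ← h.iterKer_comp]
    refine Finset.sum_nonneg fun a _ => mul_nonneg (mul_nonneg (attrWeight_nonneg ⟨?_, hp.2.le⟩ a)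
      (h.iterKer_one_nonneg x a)) (ih a)
    exact (h.μ_pos.trans hp.1).le

/-- The law after `s` steps from `x` is again a product law, so `zeros_concentration` applies to it.
-/
lemma Valid.attrWeight_mul_iterKer (s : ℕ) {l : ℕ} (x y : Fin l → Fin 2) :
    attrWeight l (statZero μ α β γ) y * iterKer μ α β γ s x y =
      ∏ i, coordWeight (if x i = 0
        then statZero μ α β γ + gapEig μ α β γ ^ s * (1 - statZero μ α β γ)
        else statZero μ α β γ - gapEig μ α β γ ^ s * statZero μ α β γ) (y i) := by
  have hp := h.statZero_mem
  rw [attrWeight, iterKer, ← Finset.prod_mul_distrib]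
  exact Finset.prod_congr rfl fun i _ =>
    coordWeight_mul_coordKer (h.μ_pos.trans hp.1) hp.2 _ _ _

lemma Valid.stat_eq : nbrZero μ α β * statZero μ α β γ +
    nbrOne μ β γ * (1 - statZero μ α β γ) = statZero μ α β γ := by
  have hA := h.degZero_pos.ne'; have hB := h.degOne_pos.ne'; have hZ := h.density_pos.ne'
  rw [h.one_sub_statZero, statZero, nbrZero, nbrOne]
  field_simp
  unfold degZero; ring

lemma Valid.nbrZero_eq : nbrZero μ α β =
    statZero μ α β γ + gapEig μ α β γ * (1 - statZero μ α β γ) := by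
  have := h.stat_eq
  unfold gapEig
  linarith

lemma Valid.nbrOne_eq : nbrOne μ β γ =
    statZero μ α β γ - gapEig μ α β γ * statZero μ α β γ := by
  have := h.stat_eq
  unfold gapEig
  linarith

lemma Valid.gapEig_pow_le_one (s : ℕ) : gapEig μ α β γ ^ s ≤ 1 :=
  (le_abs_self _).trans (by rw [abs_pow]; exact pow_le_one₀ (abs_nonneg _) h.abs_gapEig_lt.le)

/-- A negative eigenvalue is possible. Its powers then never fall below the eigenvalue itself, so
the one-step chain is the extreme case. -/
lemma Valid.le_gapEig_pow (s : ℕ) :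
    0 ≤ gapEig μ α β γ ^ (s + 1) ∨ gapEig μ α β γ ≤ gapEig μ α β γ ^ (s + 1) := by
  rcases le_total 0 (gapEig μ α β γ) with h0 | h0
  · exact Or.inl (pow_nonneg h0 _)
  · right
    have := h.gapEig_pow_le_one s
    rw [pow_succ]
    nlinarith

/-- For a nonnegative power both parameters are averages with `0` or `1`; for a negative one they
are bounded by the one-step values `nbrZero` and `nbrOne`. -/
lemma Valid.chain_mem (s : ℕ) {l : ℕ} (x : Fin l → Fin 2) (i : Fin l) :
    (if x i = 0
        then statZero μ α β γ + gapEig μ α β γ ^ (s + 1) * (1 - statZero μ α β γ)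
        else statZero μ α β γ - gapEig μ α β γ ^ (s + 1) * statZero μ α β γ) ∈
        Set.Icc (0 : ℝ) 1 := by
  have h1 := h.gapEig_pow_le_one (s + 1)
  have hp := h.statZero_mem
  have hμ := h.μ_pos
  have e0 := h.nbrZero_eq; have e1 := h.nbrOne_eq
  have b0 := h.nbrZero_mem; have b1 := h.nbrOne_mem
  have hp0 : 0 < statZero μ α β γ := hμ.trans hp.1
  have hp1 := hp.2
  split_ifs
  · constructor
    · rcases h.le_gapEig_pow s with h2 | h2
      · nlinarith
      · nlinarith [b0.1]
    · nlinarith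
  · constructor
    · nlinarith
    · rcases h.le_gapEig_pow s with h2 | h2
      · nlinarith
      · nlinarith [b1.2]

lemma Valid.sum_attrWeight_mul_iterKer (s : ℕ) {l : ℕ} (x : Fin l → Fin 2) :
    ∑ a, attrWeight l (statZero μ α β γ) a * iterKer μ α β γ (s + 1) x a = 1 := by
  have := pexp_const (isWeight_coord (h.chain_mem s x)) 1
  simpa only [pexp, mul_one, ← h.attrWeight_mul_iterKer] using this

/-- The attribute vectors with about the stationary fraction of zeros. -/
noncomputable def core (l : ℕ) (π ε : ℝ) : Finset (Fin l → Fin 2) :=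
  Finset.univ.filter fun x => |zeros x - π * l| ≤ ε * l

omit h in
lemma mem_core {l : ℕ} {π ε : ℝ} {x : Fin l → Fin 2} :
    x ∈ core l π ε ↔ |zeros x - π * l| ≤ ε * l := by simp [core]

/-- The chain started in the core is unlikely to be outside the core. -/
lemma Valid.sum_notMem_core_le (s : ℕ) {l : ℕ} {ε : ℝ} (h0 : 0 ≤ ε) (h2 : ε ≤ 2)
    {x : Fin l → Fin 2} (hx : x ∈ core l (statZero μ α β γ) ε) :
    ∑ a ∈ (core l (statZero μ α β γ) ε)ᶜ,
      attrWeight l (statZero μ α β γ) a * iterKer μ α β γ (s + 1) x a ≤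
      2 * Real.exp (-(((1 - |gapEig μ α β γ|) * ε) ^ 2 / 4 * l)) := by
  have hg := h.abs_gapEig_lt
  have hg0 := abs_nonneg (gapEig μ α β γ)
  set ϑ := gapEig μ α β γ
  set π := statZero μ α β γ
  have hc := zeros_concentration (h.chain_mem s x) (ε := (1 - |ϑ|) * ε)
    (mul_nonneg (by linarith) h0) (by nlinarith)
  refine le_trans ?_ hc
  rw [sum_ite_zero, pexp, ← Finset.sum_filter_add_sum_filter_not Finset.univ
    (fun a => a ∈ (core l π ε)ᶜ)]
  simp only [Finset.filter_mem_eq_inter, Finset.univ_inter]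
  refine le_add_of_le_of_nonneg (Finset.sum_le_sum fun a ha => ?_)
    (Finset.sum_nonneg fun a _ => mul_nonneg (Finset.prod_nonneg fun i _ =>
      coordWeight_nonneg (h.chain_mem s x i) _) (by split_ifs <;> norm_num))
  rw [h.attrWeight_mul_iterKer, if_pos, mul_one]
  have ha : ε * l < |zeros a - π * l| := by simpa [mem_core] using ha
  have hx := mem_core.mp hx
  have hpow : |ϑ ^ (s + 1) * (zeros x - π * l)| ≤ |ϑ| * (ε * l) := by
    rw [abs_mul, abs_pow]
    refine mul_le_mul ?_ hx (abs_nonneg _) hg0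
    rw [pow_succ]
    exact mul_le_of_le_one_left hg0 (pow_le_one₀ hg0 hg.le)
  -- The chain shrinks the deviation of the mean from `π * l` by at least the factor `|ϑ|`. From
  -- inside the core, leaving it requires a fluctuation of at least `(1 - |ϑ|) * ε * l`.
  have e : zeros a - (zeros x * (π + ϑ ^ (s + 1) * (1 - π)) +
      (l - zeros x) * (π - ϑ ^ (s + 1) * π)) =
      (zeros a - π * l) - ϑ ^ (s + 1) * (zeros x - π * l) := by ring
  rw [e]
  have := abs_sub_abs_le_abs_sub (zeros a - π * l) (ϑ ^ (s + 1) * (zeros x - π * l))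
  linarith

/-- The largest entry of the one-attribute kernel. -/
noncomputable def kerBound (π : ℝ) : ℝ := max 1 (max ((1 - π) / π) (π / (1 - π)))

omit h in
lemma abs_coordKer_le {π : ℝ} (h0 : 0 < π) (h1 : π < 1) (x y : Fin 2) :
    |coordKer π x y| ≤ kerBound π := by
  have h1' : 0 < 1 - π := by linarith
  unfold coordKer kerBound
  split_ifs
  · rw [abs_of_pos (div_pos h1' h0)]; simp
  · simp
  · simp
  · rw [abs_of_pos (div_pos h0 h1')]; simp

omit h in
lemma one_le_kerBound (π : ℝ) : 1 ≤ kerBound π := le_max_left _ _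

lemma Valid.abs_entry_le (s : ℕ) (x y : Fin 2) :
    |gapEig μ α β γ ^ s * coordKer (statZero μ α β γ) x y| ≤
      kerBound (statZero μ α β γ) * |gapEig μ α β γ| ^ s := by
  have hp := h.statZero_mem
  rw [abs_mul, abs_pow, mul_comm]
  exact mul_le_mul_of_nonneg_right (abs_coordKer_le (h.μ_pos.trans hp.1) hp.2 x y)
    (pow_nonneg (abs_nonneg _) _)

lemma Valid.entry_nonneg (s : ℕ) (x y : Fin 2) :
    0 ≤ 1 + gapEig μ α β γ ^ (s + 1) * coordKer (statZero μ α β γ) x y := by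
  have := h.iterKer_nonneg s (fun _ : Fin 1 => x) (fun _ : Fin 1 => y)
  simpa [iterKer] using this

/-- Each attribute contributes a factor within `η` of one, so after many steps the density is flat
up to an arbitrarily small exponential rate. -/
lemma Valid.iterKer_le (s : ℕ) {η : ℝ}
    (hη : kerBound (statZero μ α β γ) * |gapEig μ α β γ| ^ (s + 1) ≤ η) {l : ℕ}
    (x y : Fin l → Fin 2) : iterKer μ α β γ (s + 1) x y ≤ Real.exp (η * l) := by
  calc iterKer μ α β γ (s + 1) x y ≤ ∏ _i : Fin l, Real.exp η := by
        refine Finset.prod_le_prod (fun i _ => h.entry_nonneg s _ _) fun i _ => ?_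
        have := (abs_le.mp (h.abs_entry_le (s + 1) (x i) (y i))).2
        linarith [Real.add_one_le_exp η]
    _ = Real.exp (η * l) := by
        rw [Finset.prod_const, Finset.card_univ, Fintype.card_fin, ← Real.exp_nat_mul, mul_comm]

lemma Valid.le_iterKer (s : ℕ) {η : ℝ} (hη1 : η ≤ 1 / 2)
    (hη : kerBound (statZero μ α β γ) * |gapEig μ α β γ| ^ (s + 1) ≤ η) {l : ℕ}
    (x y : Fin l → Fin 2) : Real.exp (-(2 * η * l)) ≤ iterKer μ α β γ (s + 1) x y := by
  have hη0 : 0 ≤ η := le_trans (mul_nonneg (zero_le_one.trans (one_le_kerBound _))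
    (pow_nonneg (abs_nonneg _) _)) hη
  calc Real.exp (-(2 * η * l)) = ∏ _i : Fin l, Real.exp (-(2 * η)) := by
        rw [Finset.prod_const, Finset.card_univ, Fintype.card_fin, ← Real.exp_nat_mul]
        ring_nf
    _ ≤ iterKer μ α β γ (s + 1) x y := by
        refine Finset.prod_le_prod (fun i _ => (Real.exp_pos _).le) fun i _ => ?_
        have h1 := (abs_le.mp (h.abs_entry_le (s + 1) (x i) (y i))).1
        have h2 : Real.exp (-(2 * η)) ≤ 1 - η := by
          rw [Real.exp_neg, inv_le_comm₀ (Real.exp_pos _) (by linarith)]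
          refine le_trans ?_ (Real.add_one_le_exp (2 * η))
          rw [inv_le_iff_one_le_mul₀ (by linarith)]
          nlinarith
        linarith

lemma Valid.coreIter_le_iterKer {l : ℕ} (C : Finset (Fin l → Fin 2)) (j : ℕ)
    (x y : Fin l → Fin 2) :
    coreIter C (attrWeight l (statZero μ α β γ)) (iterKer μ α β γ 1) j x y ≤
      iterKer μ α β γ (j + 1) x y := by
  have hp := h.statZero_mem
  have hw : ∀ a, 0 ≤ attrWeight l (statZero μ α β γ) a :=
    fun a => attrWeight_nonneg ⟨(h.μ_pos.trans hp.1).le, hp.2.le⟩ a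
  induction j generalizing x with
  | zero => exact le_rfl
  | succ j ih =>
    rw [add_comm (j + 1) 1, ← h.iterKer_comp]
    simp only [coreIter]
    refine (Finset.sum_le_sum fun a _ => mul_le_mul_of_nonneg_left (ih a)
      (mul_nonneg (hw a) (h.iterKer_one_nonneg x a))).trans ?_
    exact Finset.sum_le_sum_of_subset_of_nonneg (Finset.subset_univ C) fun a _ _ =>
      mul_nonneg (mul_nonneg (hw a) (h.iterKer_one_nonneg x a)) (h.iterKer_nonneg j a y)

/-- A union bound over the time `i + 1` at which a path of `j + 1` steps is outside `C`; at least
one step, namely `j - i`, then remains. -/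
lemma Valid.iterKer_sub_coreIter_le {l : ℕ} (C : Finset (Fin l → Fin 2)) (j : ℕ)
    (x y : Fin l → Fin 2) :
    iterKer μ α β γ (j + 1) x y -
      coreIter C (attrWeight l (statZero μ α β γ)) (iterKer μ α β γ 1) j x y ≤
      ∑ i ∈ Finset.range j, ∑ a ∈ Cᶜ, attrWeight l (statZero μ α β γ) a *
        iterKer μ α β γ (i + 1) x a * iterKer μ α β γ (j - i) a y := by
  have hp := h.statZero_mem
  have hw : ∀ a, 0 ≤ attrWeight l (statZero μ α β γ) a :=
    fun a => attrWeight_nonneg ⟨(h.μ_pos.trans hp.1).le, hp.2.le⟩ a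
  induction j generalizing x with
  | zero => simp [coreIter]
  | succ j ih =>
    have e1 : iterKer μ α β γ (j + 1 + 1) x y =
        ∑ a ∈ C, attrWeight l (statZero μ α β γ) a * iterKer μ α β γ 1 x a *
          iterKer μ α β γ (j + 1) a y +
        ∑ a ∈ Cᶜ, attrWeight l (statZero μ α β γ) a * iterKer μ α β γ 1 x a *
          iterKer μ α β γ (j + 1) a y := by
      rw [add_comm (j + 1) 1, ← h.iterKer_comp, Finset.sum_add_sum_compl]
    have e2 : ∑ a ∈ C, attrWeight l (statZero μ α β γ) a * iterKer μ α β γ 1 x a *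
          iterKer μ α β γ (j + 1) a y -
        coreIter C (attrWeight l (statZero μ α β γ)) (iterKer μ α β γ 1) (j + 1) x y ≤
        ∑ i ∈ Finset.range j, ∑ a ∈ Cᶜ, attrWeight l (statZero μ α β γ) a *
          iterKer μ α β γ (i + 1 + 1) x a * iterKer μ α β γ (j + 1 - (i + 1)) a y := by
      simp only [coreIter]
      rw [← Finset.sum_sub_distrib]
      calc _ ≤ ∑ a ∈ C, (attrWeight l (statZero μ α β γ) a * iterKer μ α β γ 1 x a) *
            ∑ i ∈ Finset.range j, ∑ b ∈ Cᶜ, attrWeight l (statZero μ α β γ) b *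
              iterKer μ α β γ (i + 1) a b * iterKer μ α β γ (j - i) b y := by
            refine Finset.sum_le_sum fun a _ => ?_
            rw [← mul_sub]
            exact mul_le_mul_of_nonneg_left (ih a)
              (mul_nonneg (hw a) (h.iterKer_one_nonneg x a))
        -- Extending the sum from `C` to all types adds only nonnegative terms and lets the first
        -- step merge with the next ones by `iterKer_comp`.
        _ ≤ ∑ a, (attrWeight l (statZero μ α β γ) a * iterKer μ α β γ 1 x a) *
            ∑ i ∈ Finset.range j, ∑ b ∈ Cᶜ, attrWeight l (statZero μ α β γ) b *
              iterKer μ α β γ (i + 1) a b * iterKer μ α β γ (j - i) b y := by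
            refine Finset.sum_le_sum_of_subset_of_nonneg (Finset.subset_univ C) fun a _ _ => ?_
            refine mul_nonneg (mul_nonneg (hw a) (h.iterKer_one_nonneg x a))
              (Finset.sum_nonneg fun i hi => Finset.sum_nonneg fun b _ => ?_)
            obtain ⟨r, hr⟩ : ∃ r, j - i = r + 1 :=
              ⟨j - i - 1, by have : i < j := by simpa using hi
                             omega⟩
            rw [hr]
            exact mul_nonneg (mul_nonneg (hw b) (h.iterKer_nonneg i a b)) (h.iterKer_nonneg r b y)
        _ = _ := by
            simp only [Finset.mul_sum]
            rw [Finset.sum_comm]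
            refine Finset.sum_congr rfl fun i _ => ?_
            rw [Finset.sum_comm]
            refine Finset.sum_congr rfl fun b _ => ?_
            rw [Nat.add_sub_add_right, add_comm (i + 1) 1, ← h.iterKer_comp, Finset.mul_sum,
              Finset.sum_mul]
            exact Finset.sum_congr rfl fun a _ => by ring
    rw [e1, Finset.sum_range_succ']
    simp only [Nat.sub_zero, zero_add]
    linarith

end

end Kernel

/-! ### Quantitative connection of two nodes of the core. -/

section CorePaths

/-- Explicit solution of the recursive inequality for the second moments. -/
lemma moment_recursion {B b η q : ℝ} {s J : ℕ} (hs : 0 < s) (hb : 0 ≤ b) (hbB : b ≤ B)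
    (hη : 0 ≤ η) (hq : q = η * B * (J + 1)) (hq6 : q ≤ 1 / 6) (j : ℕ) (hj : j < J) :
    (if j + 1 < s then B else b) + η * ∑ i ∈ Finset.range (j + 1),
      (4 * b + 2 * B * q ^ (i / s)) * (if j - i < s then B else b) ≤
        4 * b + 2 * B * q ^ ((j + 1) / s) := by
  have hB : 0 ≤ B := hb.trans hbB
  have hJ : (0 : ℝ) ≤ J := Nat.cast_nonneg J
  have hq0 : 0 ≤ q := by rw [hq]; positivity
  have hq1 : q ≤ 1 := by linarith
  have hjJ : ((j + 1 : ℕ) : ℝ) ≤ J + 1 := by exact_mod_cast (by omega)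
  have hd : ∀ i, 4 * b + 2 * B * q ^ (i / s) ≤ 6 * B := fun i => by
    have := pow_le_one₀ (n := i / s) hq0 hq1
    nlinarith
  have hd0 : ∀ i, 0 ≤ 4 * b + 2 * B * q ^ (i / s) := fun i => by positivity
  -- Kernels with index below `s` are only bounded by `B`, later ones by `b`. In the first block the
  -- crude bound `6 * B` on the moments suffices, since `q ≤ 1 / 6`.
  by_cases h : j + 1 < s
  · rw [if_pos h, Nat.div_eq_of_lt h, pow_zero]
    have : ∑ i ∈ Finset.range (j + 1), (4 * b + 2 * B * q ^ (i / s)) *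
        (if j - i < s then B else b) ≤ (J + 1) * (6 * B * B) := by
      refine (Finset.sum_le_card_nsmul _ _ (6 * B * B) fun i _ => ?_).trans ?_
      · refine mul_le_mul (hd i) ?_ ?_ (by positivity)
        · split_ifs <;> linarith
        · split_ifs <;> linarith
      · rw [nsmul_eq_mul, Finset.card_range]
        exact mul_le_mul_of_nonneg_right hjJ (by positivity)
    have h2 := mul_le_mul_of_nonneg_left this hη
    have e : η * ((J + 1) * (6 * B * B)) = 6 * q * B := by rw [hq]; ring
    rw [e] at h2
    nlinarith
  · rw [if_neg h]
    obtain ⟨r, hr⟩ : ∃ r, (j + 1) / s = r + 1 :=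
      ⟨(j + 1) / s - 1, by have := Nat.div_pos (not_lt.mp h) hs; omega⟩
    rw [hr]
    have hterm : ∀ i ∈ Finset.range (j + 1), (4 * b + 2 * B * q ^ (i / s)) *
        (if j - i < s then B else b) ≤ (4 * b + 2 * B * q ^ r) * B + 6 * B * b := by
      intro i hi
      have hi : i < j + 1 := by simpa using hi
      have hp : 0 ≤ (4 * b + 2 * B * q ^ r) * B := by positivity
      -- If `j - i < s`, then `i` lies at most one block before `j + 1`, so its moment carries at
      -- least `q ^ r`. Multiplying by `η * B * (J + 1) = q` yields `q ^ (r + 1)`.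
      split_ifs with hc
      · have hri : r ≤ i / s := by
          rw [Nat.le_div_iff_mul_le hs]
          have := Nat.div_mul_le_self (j + 1) s
          rw [hr, add_mul, one_mul] at this
          omega
        have h1 : q ^ (i / s) ≤ q ^ r := pow_le_pow_of_le_one hq0 hq1 hri
        have h2 : (4 * b + 2 * B * q ^ (i / s)) * B ≤ (4 * b + 2 * B * q ^ r) * B := by gcongr
        have : 0 ≤ 6 * B * b := by positivity
        linarith
      · have := mul_le_mul_of_nonneg_right (hd i) hb
        linarith
    have hsum : ∑ i ∈ Finset.range (j + 1), (4 * b + 2 * B * q ^ (i / s)) *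
        (if j - i < s then B else b) ≤
        (J + 1) * ((4 * b + 2 * B * q ^ r) * B + 6 * B * b) := by
      refine (Finset.sum_le_card_nsmul _ _ _ hterm).trans ?_
      rw [nsmul_eq_mul, Finset.card_range]
      exact mul_le_mul_of_nonneg_right hjJ (by positivity)
    have h2 := mul_le_mul_of_nonneg_left hsum hη
    have e : η * ((J + 1) * ((4 * b + 2 * B * q ^ r) * B + 6 * B * b)) =
        10 * q * b + 2 * B * q ^ (r + 1) := by rw [pow_succ, hq]; ring
    rw [e] at h2
    nlinarith

variable {μ α β γ : ℝ}

/-- Exponential rate of the degrees in the core. -/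
noncomputable def coreRate (μ α β γ : ℝ) : ℝ :=
  statZero μ α β γ * Real.log (degZero μ α β) +
    (1 - statZero μ α β γ) * Real.log (degOne μ β γ)

/-- The logarithm of the ratio of the two degree factors. -/
noncomputable def logRatio (μ α β γ : ℝ) : ℝ :=
  Real.log (degZero μ α β) - Real.log (degOne μ β γ)

section

variable (h : Valid μ α β γ)
include h

lemma Valid.logRatio_pos : 0 < logRatio μ α β γ :=
  sub_pos.mpr (Real.log_lt_log h.degOne_pos h.degOne_lt_degZero)

lemma Valid.degree_eq {l : ℕ} (x : Fin l → Fin 2) :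
    degree μ α β γ x = Real.exp (coreRate μ α β γ * l +
      (zeros x - statZero μ α β γ * l) * logRatio μ α β γ) := by
  rw [h.degree_eq_exp, coreRate, logRatio]
  ring_nf

lemma Valid.degree_bounds {l : ℕ} {ε : ℝ} {x : Fin l → Fin 2}
    (hx : x ∈ core l (statZero μ α β γ) ε) :
    Real.exp ((coreRate μ α β γ - logRatio μ α β γ * ε) * l) ≤ degree μ α β γ x ∧
      degree μ α β γ x ≤ Real.exp ((coreRate μ α β γ + logRatio μ α β γ * ε) * l) := by
  have hc := h.logRatio_pos
  have hx := abs_le.mp (mem_core.mp hx)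
  rw [h.degree_eq]
  constructor <;> apply Real.exp_le_exp.mpr <;> nlinarith [hx.1, hx.2]

/-- The stationary law is the attribute law biased by the degree. The ratio of the two is thus
controlled in the core, which yields the constant `Ω`. -/
lemma Valid.attrWeight_stat {l : ℕ} (x : Fin l → Fin 2) :
    attrWeight l (statZero μ α β γ) x =
      degree μ α β γ x / density μ α β γ ^ l * attrWeight l μ x := by
  have hZ := h.density_pos.ne'
  have hZl : density μ α β γ ^ l = ∏ _i : Fin l, density μ α β γ := by simp
  rw [hZl, attrWeight, attrWeight, degree, ← Finset.prod_div_distrib, ← Finset.prod_mul_distrib]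
  refine Finset.prod_congr rfl fun i _ => ?_
  unfold coordWeight
  split_ifs
  · rw [statZero]; field_simp
  · rw [h.one_sub_statZero]; field_simp

lemma Valid.mem_Icc : α ∈ Set.Icc (0 : ℝ) 1 ∧ β ∈ Set.Icc (0 : ℝ) 1 ∧ γ ∈ Set.Icc (0 : ℝ) 1 ∧
    μ ∈ Set.Icc (0 : ℝ) 1 := by
  have h1 := h.μ_pos; have h2 := h.μ_lt_one; have h3 := h.γ_pos
  have h4 := h.γ_lt; have h5 := h.β_lt; have h6 := h.α_lt_one
  refine ⟨⟨?_, ?_⟩, ⟨?_, ?_⟩, ⟨?_, ?_⟩, ⟨?_, ?_⟩⟩ <;> linarith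

/-- By `iterKer_one` the kernel is `density ^ l * P` divided by the two degrees. So `Ω` comes from
the largest degree in the core and `B` from the square of the smallest. -/
lemma Valid.isCore (l : ℕ) (ε : ℝ) :
    IsCore (attrWeight l μ) (pairProb l α β γ) (core l (statZero μ α β γ) ε)
      (attrWeight l (statZero μ α β γ)) (iterKer μ α β γ 1)
      (Real.exp ((coreRate μ α β γ + logRatio μ α β γ * ε) * l) / density μ α β γ ^ l)
      (density μ α β γ ^ l *
        Real.exp (-(2 * (coreRate μ α β γ - logRatio μ α β γ * ε) * l))) where
  w_nonneg := attrWeight_nonneg ⟨(h.μ_pos.trans h.statZero_mem.1).le, h.statZero_mem.2.le⟩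
  k_nonneg := h.iterKer_one_nonneg
  m_nonneg := attrWeight_nonneg h.mem_Icc.2.2.2
  P_nonneg e := (pairProb_mem l h.mem_Icc.1 h.mem_Icc.2.1 h.mem_Icc.2.2.1 e).1
  P_le_one e := (pairProb_mem l h.mem_Icc.1 h.mem_Icc.2.1 h.mem_Icc.2.2.1 e).2
  Ω_nonneg := div_nonneg (Real.exp_pos _).le (pow_nonneg h.density_pos.le _)
  B_nonneg := mul_nonneg (pow_nonneg h.density_pos.le _) (Real.exp_pos _).le
  w_le x hx := by
    rw [h.attrWeight_stat]
    exact mul_le_mul_of_nonneg_right (div_le_div_of_nonneg_right (h.degree_bounds hx).2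
      (pow_nonneg h.density_pos.le _)) (attrWeight_nonneg h.mem_Icc.2.2.2 x)
  k_le x hx y hy := by
    have hP := (pairProb_mem l h.mem_Icc.1 h.mem_Icc.2.1 h.mem_Icc.2.2.1 s(x, y)).1
    have hZ := pow_pos h.density_pos l
    have hE := Real.exp_pos ((coreRate μ α β γ - logRatio μ α β γ * ε) * l)
    rw [h.iterKer_one, div_le_iff₀ (mul_pos (h.degree_pos x) (h.degree_pos y))]
    have h1 := mul_le_mul (h.degree_bounds hx).1 (h.degree_bounds hy).1 hE.le (h.degree_pos x).le
    have e : Real.exp (-(2 * (coreRate μ α β γ - logRatio μ α β γ * ε) * l)) *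
        (Real.exp ((coreRate μ α β γ - logRatio μ α β γ * ε) * l) *
          Real.exp ((coreRate μ α β γ - logRatio μ α β γ * ε) * l)) = 1 := by
      rw [← Real.exp_add, ← Real.exp_add]
      ring_nf
      simp
    calc density μ α β γ ^ l * pairProb l α β γ s(x, y) = density μ α β γ ^ l *
          pairProb l α β γ s(x, y) *
          (Real.exp (-(2 * (coreRate μ α β γ - logRatio μ α β γ * ε) * l)) *
          (Real.exp ((coreRate μ α β γ - logRatio μ α β γ * ε) * l) *
          Real.exp ((coreRate μ α β γ - logRatio μ α β γ * ε) * l))) := by rw [e, mul_one]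
      _ ≤ density μ α β γ ^ l * pairProb l α β γ s(x, y) *
          (Real.exp (-(2 * (coreRate μ α β γ - logRatio μ α β γ * ε) * l)) *
          (degree μ α β γ x * degree μ α β γ y)) := by
          refine mul_le_mul_of_nonneg_left (mul_le_mul_of_nonneg_left h1 (Real.exp_pos _).le)
            (mul_nonneg hZ.le hP)
      _ = _ := by ring
  sum_le x _ := by
    rw [← h.sum_attrWeight_mul_iterKer 0 x]
    exact Finset.sum_le_sum_of_subset_of_nonneg (Finset.subset_univ _) fun a _ _ =>
      mul_nonneg (attrWeight_nonneg ⟨(h.μ_pos.trans h.statZero_mem.1).le,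
        h.statZero_mem.2.le⟩ a) (h.iterKer_one_nonneg x a)

lemma Valid.iterKer_le_of_le {s₀ s : ℕ} (hs : s₀ ≤ s + 1) {η : ℝ}
    (hη : kerBound (statZero μ α β γ) * |gapEig μ α β γ| ^ s₀ ≤ η) {l : ℕ}
    (x y : Fin l → Fin 2) : iterKer μ α β γ (s + 1) x y ≤ Real.exp (η * l) :=
  h.iterKer_le s (le_trans (mul_le_mul_of_nonneg_left
    (pow_le_pow_of_le_one (abs_nonneg _) h.abs_gapEig_lt.le hs)
    (zero_le_one.trans (one_le_kerBound _))) hη) x y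

/-- Lower bound for the kernel of long paths inside the core. -/
lemma Valid.le_coreIter {s₀ J l : ℕ} {η ε : ℝ} (hJ : 2 * s₀ ≤ J) (hη1 : η ≤ 1 / 2)
    (hη : kerBound (statZero μ α β γ) * |gapEig μ α β γ| ^ s₀ ≤ η) (h0 : 0 ≤ ε) (h2 : ε ≤ 2)
    (hsmall : J * (Real.exp (η * l) *
      (2 * Real.exp (-(((1 - |gapEig μ α β γ|) * ε) ^ 2 / 4 * l)))) ≤
        1 / 2 * Real.exp (-(2 * η * l)))
    {x z : Fin l → Fin 2} (hx : x ∈ core l (statZero μ α β γ) ε)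
    (hz : z ∈ core l (statZero μ α β γ) ε) :
    1 / 2 * Real.exp (-(2 * η * l)) ≤ coreIter (core l (statZero μ α β γ) ε)
      (attrWeight l (statZero μ α β γ)) (iterKer μ α β γ 1) J x z := by
  have hw : ∀ a, 0 ≤ attrWeight l (statZero μ α β γ) a := (h.isCore l ε).w_nonneg
  have h1 := h.iterKer_sub_coreIter_le (core l (statZero μ α β γ) ε) J x z
  have h3 : Real.exp (-(2 * η * l)) ≤ iterKer μ α β γ (J + 1) x z :=
    h.le_iterKer J hη1 (le_trans (mul_le_mul_of_nonneg_left
      (pow_le_pow_of_le_one (abs_nonneg _) h.abs_gapEig_lt.le (by omega))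
      (zero_le_one.trans (one_le_kerBound _))) hη) x z
  have h4 : ∑ i ∈ Finset.range J, ∑ a ∈ (core l (statZero μ α β γ) ε)ᶜ,
      attrWeight l (statZero μ α β γ) a * iterKer μ α β γ (i + 1) x a *
        iterKer μ α β γ (J - i) a z ≤ J * (Real.exp (η * l) *
      (2 * Real.exp (-(((1 - |gapEig μ α β γ|) * ε) ^ 2 / 4 * l)))) := by
    refine (Finset.sum_le_card_nsmul _ _ (Real.exp (η * l) *
      (2 * Real.exp (-(((1 - |gapEig μ α β γ|) * ε) ^ 2 / 4 * l)))) fun i hi => ?_).trans_eq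
      (by rw [nsmul_eq_mul, Finset.card_range])
    have hi : i < J := by simpa using hi
    obtain ⟨r, hr⟩ : ∃ r, J - i = r + 1 := ⟨J - i - 1, by omega⟩
    rw [hr]
    -- The legs from `x` to `a` and from `a` to `z` have `J + 1 > 2 * s₀` steps together, so one of
    -- them is long enough for its kernel to be at most `exp (η * l)`. The other leg leaves the core
    -- and is improbable; if it is the one to `z`, symmetry lets it start at `z`.
    by_cases hc : s₀ ≤ r + 1
    · calc _ ≤ ∑ a ∈ (core l (statZero μ α β γ) ε)ᶜ, Real.exp (η * l) *
            (attrWeight l (statZero μ α β γ) a * iterKer μ α β γ (i + 1) x a) := by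
            refine Finset.sum_le_sum fun a _ => ?_
            rw [mul_comm]
            exact mul_le_mul_of_nonneg_right (h.iterKer_le_of_le hc hη a z)
              (mul_nonneg (hw a) (h.iterKer_nonneg i x a))
        _ ≤ _ := by
            rw [← Finset.mul_sum]
            exact mul_le_mul_of_nonneg_left (h.sum_notMem_core_le i h0 h2 hx) (Real.exp_pos _).le
    · calc _ ≤ ∑ a ∈ (core l (statZero μ α β γ) ε)ᶜ, Real.exp (η * l) *
            (attrWeight l (statZero μ α β γ) a * iterKer μ α β γ (r + 1) z a) := by
            refine Finset.sum_le_sum fun a _ => ?_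
            rw [iterKer_comm (r + 1) a z, mul_right_comm, mul_comm]
            exact mul_le_mul_of_nonneg_right (h.iterKer_le_of_le (by omega) hη x a)
              (mul_nonneg (hw a) (h.iterKer_nonneg r z a))
        _ ≤ _ := by
            rw [← Finset.mul_sum]
            exact mul_le_mul_of_nonneg_left (h.sum_notMem_core_le r h0 h2 hz) (Real.exp_pos _).le
  linarith

/-- Two nodes of the core are connected, but for a small probability. -/
lemma Valid.prob_core_not_reachable_le {V : Type*} [Fintype V] [DecidableEq V]
    {s₀ r N K l : ℕ} {η ε q Ω B : ℝ} (hs : 0 < s₀) (hr : 2 ≤ r) (hN : 0 < N)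
    (hη1 : η ≤ 1 / 2) (hη : kerBound (statZero μ α β γ) * |gapEig μ α β γ| ^ s₀ ≤ η)
    (h0 : 0 ≤ ε) (h2 : ε ≤ 2)
    (hsmall : (r * s₀ : ℕ) * (Real.exp (η * l) *
      (2 * Real.exp (-(((1 - |gapEig μ α β γ|) * ε) ^ 2 / 4 * l)))) ≤
        1 / 2 * Real.exp (-(2 * η * l)))
    (hΩ : Ω = Real.exp ((coreRate μ α β γ + logRatio μ α β γ * ε) * l) / density μ α β γ ^ l)
    (hB : B = density μ α β γ ^ l *
        Real.exp (-(2 * (coreRate μ α β γ - logRatio μ α β γ * ε) * l)))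
    (hq : q = Ω / N * B * ((r * s₀ : ℕ) + 1)) (hq6 : q ≤ 1 / 6) (hBq : B * q ^ r ≤ 1)
    (hcard : K * (r * s₀ * N) + 2 ≤ Fintype.card V) {u t : V} (hut : u ≠ t) :
    prob (attrWeight l μ) (pairProb l α β γ) (fun a (ξ : Sym2 V → Bool) =>
      (a u ∈ core l (statZero μ α β γ) ε ∧ a t ∈ core l (statZero μ α β γ) ε) ∧
        ¬ (indGraph ξ).Reachable u t) ≤ Real.exp (-(Real.exp (-(3 * η * l)) / 12 * K)) := by
  set C := core l (statZero μ α β γ) ε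
  set J := r * s₀ with hJdef
  have hcore : IsCore (attrWeight l μ) (pairProb l α β γ) C
      (attrWeight l (statZero μ α β γ)) (iterKer μ α β γ 1) Ω B := by
    rw [hΩ, hB]; exact h.isCore l ε
  obtain ⟨L, hL1, hL2, hL3, hL4, hL5⟩ := exists_layers (V := V) K J N u t hcard
  have hJ0 : 0 < J := Nat.mul_pos (by omega) hs
  have hBpos : 0 < B := by
    rw [hB]; exact mul_pos (pow_pos h.density_pos _) (Real.exp_pos _)
  -- The minimum is taken because `moment_recursion` needs `b ≤ B`; both bounds hold for the late
  -- kernels.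
  set b := min B (Real.exp (η * l)) with hb
  have hb0 : 0 < b := lt_min hBpos (Real.exp_pos _)
  have hq0 : 0 ≤ q := by
    rw [hq]
    exact mul_nonneg (mul_nonneg (div_nonneg hcore.Ω_nonneg (Nat.cast_nonneg _)) hBpos.le)
      (by positivity)
  set d : ℕ → ℝ := fun j => 4 * b + 2 * B * q ^ (j / s₀) with hd
  -- As `J = r * s₀`, the transient part is `2 * B * q ^ r ≤ 2`. Together with the lower bound `exp
  -- (-2 * η * l) / 2` on the mean this gives `p₀ = exp (-3 * η * l) / 12`.
  have hdJ : d J ≤ 6 * Real.exp (η * l) := by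
    have e : J / s₀ = r := Nat.mul_div_cancel r hs
    have h1 : b ≤ Real.exp (η * l) := min_le_right _ _
    have h3 : (1 : ℝ) ≤ Real.exp (η * l) := by
      refine Real.one_le_exp (mul_nonneg ?_ (Nat.cast_nonneg _))
      exact le_trans (mul_nonneg (zero_le_one.trans (one_le_kerBound _))
        (pow_nonneg (abs_nonneg _) _)) hη
    simp only [hd, e]
    linarith
  have hd0 : ∀ j, 0 < d j := fun j => by
    have := pow_nonneg hq0 (j / s₀)
    simp only [hd]
    positivity
  set p₀ := Real.exp (-(3 * η * l)) / 12 with hp₀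
  have hp1 : ∀ x ∈ C, ∀ z ∈ C, p₀ ≤ coreIter C (attrWeight l (statZero μ α β γ))
      (iterKer μ α β γ 1) J x z / d J := by
    intro x hx z hz
    have hle := h.le_coreIter (J := J) (Nat.mul_le_mul_right s₀ hr) hη1 hη h0 h2 hsmall hx hz
    rw [le_div_iff₀ (hd0 J)]
    refine le_trans ?_ hle
    calc p₀ * d J ≤ p₀ * (6 * Real.exp (η * l)) :=
          mul_le_mul_of_nonneg_left hdJ (by positivity)
      _ = 1 / 2 * (Real.exp (-(3 * η * l)) * Real.exp (η * l)) := by rw [hp₀]; ring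
      _ = _ := by rw [← Real.exp_add]; ring_nf
  have main := hcore.prob_not_reachable_le (sum_attrWeight l μ) hN hJ0 hut L hL1 hL2 hL3 hL4 hL5
    (b := fun j => if j < s₀ then B else b) (d := d)
    (fun i x hx y hy => by
      split_ifs with hi
      · exact hcore.coreIter_le i hx hy
      · exact le_min (hcore.coreIter_le i hx hy) ((h.coreIter_le_iterKer C i x y).trans
          (h.iterKer_le_of_le (by omega) hη x y)))
    (by simp [hs]) (by simp [hs, hd]; linarith) (fun j => (hd0 j).le)
    (fun j hj => moment_recursion hs hb0.le (min_le_left _ _)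
      (div_nonneg hcore.Ω_nonneg (Nat.cast_nonneg _)) hq hq6 j hj) (hd0 J) hp1
  refine main.trans ?_
  have hmax : max 0 (1 - p₀) ≤ Real.exp (-p₀) :=
    max_le (Real.exp_pos _).le (by linarith [Real.add_one_le_exp (-p₀)])
  calc max 0 (1 - p₀) ^ K ≤ Real.exp (-p₀) ^ K := pow_le_pow_left₀ (le_max_left _ _) hmax K
    _ = _ := by rw [← Real.exp_nat_mul]; ring_nf

end

end CorePaths

/-! ### Choice of the constants for a large number of attributes. -/

section Asymptotics

lemma eventually_le_exp (M : ℝ) {c : ℝ} (hc : 0 < c) :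
    ∀ᶠ l : ℕ in atTop, M ≤ Real.exp (c * l) :=
  (Real.tendsto_exp_atTop.comp
    (tendsto_natCast_atTop_atTop.const_mul_atTop hc)).eventually_ge_atTop M

lemma tendsto_exp_neg {c : ℝ} (hc : 0 < c) :
    Tendsto (fun l : ℕ => Real.exp (-(c * l))) atTop (𝓝 0) :=
  Real.tendsto_exp_neg_atTop_nhds_zero.comp (tendsto_natCast_atTop_atTop.const_mul_atTop hc)

lemma tendsto_exp_sub_exp (a : ℝ) {b τ : ℝ} (hb : 0 < b) (hτ : 0 < τ) :
    Tendsto (fun l : ℕ => Real.exp (a * l) * Real.exp (-(b * Real.exp (τ * l)))) atTop (𝓝 0) := by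
  refine squeeze_zero' (Eventually.of_forall fun l => by positivity) ?_
    (tendsto_exp_neg (c := 1) one_pos)
  filter_upwards [eventually_ge_atTop ⌈2 * (a + 1) / (b * τ ^ 2)⌉₊] with l hl
  have hl : 2 * (a + 1) / (b * τ ^ 2) ≤ l := Nat.ceil_le.mp hl
  rw [div_le_iff₀ (by positivity)] at hl
  have hl0 : (0 : ℝ) ≤ l := Nat.cast_nonneg l
  have h1 := Real.quadratic_le_exp_of_nonneg (x := τ * l) (by positivity)
  rw [← Real.exp_add]
  refine Real.exp_le_exp.mpr ?_
  have h2 : b * ((τ * l) ^ 2 / 2) ≤ b * Real.exp (τ * l) :=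
    mul_le_mul_of_nonneg_left (by nlinarith [mul_nonneg hτ.le hl0]) hb.le
  nlinarith

variable {μ α β γ : ℝ}

section

variable (h : Valid μ α β γ)
include h

lemma Valid.log_degZero_neg : Real.log (degZero μ α β) < 0 := by
  refine Real.log_neg h.degZero_pos ?_
  have h1 := h.μ_pos; have h2 := h.μ_lt_one
  have h5 := h.β_lt; have h6 := h.α_lt_one
  unfold degZero
  nlinarith

lemma Valid.log_degOne_neg : Real.log (degOne μ β γ) < 0 :=
  (Real.log_lt_log h.degOne_pos h.degOne_lt_degZero).trans h.log_degZero_neg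

lemma Valid.coreRate_nonpos : coreRate μ α β γ ≤ 0 := by
  have hp := h.statZero_mem
  have h1 := h.μ_pos
  have := h.log_degZero_neg; have := h.log_degOne_neg
  unfold coreRate
  nlinarith [hp.1, hp.2]

set_option maxHeartbeats 800000 in
/-- Asymptotically, any two nodes of the core are connected. -/
lemma Valid.exists_core {lam : ℝ} (hlam : 0 < lam + coreRate μ α β γ) :
    ∃ ε sg τ : ℝ, 0 < ε ∧ ε ≤ 1 ∧ 0 < sg ∧ 0 < τ ∧ ∀ᶠ l : ℕ in atTop, ∀ n : ℕ,
      Real.exp ((lam - sg) * l) ≤ n → ∀ u t : Fin n, u ≠ t →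
      prob (attrWeight l μ) (pairProb l α β γ) (fun a (ξ : Sym2 (Fin n) → Bool) =>
        (a u ∈ core l (statZero μ α β γ) ε ∧ a t ∈ core l (statZero μ α β γ) ε) ∧
          ¬ (indGraph ξ).Reachable u t) ≤ Real.exp (-(1 * Real.exp (τ * l))) := by
  set δ := lam + coreRate μ α β γ with hδ
  have hc := h.logRatio_pos
  have hr0 := h.coreRate_nonpos
  have hZ := h.density_pos
  set c := logRatio μ α β γ
  -- Here `ρ` is the rate of the degrees in the core, not the ratio of `l` to `log₂ n`. With `n`
  -- about `exp (lam * l)`, the expected degrees in the core are about `exp (δ * l)`.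
  set ρ := coreRate μ α β γ
  set ϑ := |gapEig μ α β γ| with hϑ
  have hϑ1 : ϑ < 1 := h.abs_gapEig_lt
  have hϑ0 : 0 ≤ ϑ := abs_nonneg _
  set ε := min 1 (δ / (12 * c)) with hε
  have hε0 : 0 < ε := lt_min one_pos (by positivity)
  have hε1 : ε ≤ 1 := min_le_left _ _
  have hcε : 3 * c * ε ≤ δ / 4 := by
    have : ε ≤ δ / (12 * c) := min_le_right _ _
    rw [le_div_iff₀ (by positivity)] at this
    linarith
  set c₁ := ((1 - ϑ) * ε) ^ 2 / 4 with hc₁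
  have hc₁0 : 0 < c₁ := by
    have : 0 < 1 - ϑ := by linarith
    positivity
  -- `η ≤ c₁ / 6` makes `exp (3 * η * l)` negligible against the cost `exp (c₁ * l)` of leaving the
  -- core. `η ≤ δ / 48` makes the success probability of a group at least `exp (-(δ / 16) * l) /
  -- 12`.
  set η := min (1 / 2) (min (δ / 48) (c₁ / 6)) with hη
  have hη0 : 0 < η := lt_min (by norm_num) (lt_min (by positivity) (by positivity))
  have hη1 : η ≤ 1 / 2 := min_le_left _ _
  have hη2 : η ≤ δ / 48 := (min_le_right _ _).trans (min_le_left _ _)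
  have hη3 : η ≤ c₁ / 6 := (min_le_right _ _).trans (min_le_right _ _)
  obtain ⟨s₀, hs0, hs⟩ : ∃ s₀ : ℕ, 0 < s₀ ∧ kerBound (statZero μ α β γ) * ϑ ^ s₀ ≤ η := by
    have ht := (tendsto_pow_atTop_nhds_zero_of_lt_one hϑ0 hϑ1).const_mul
      (kerBound (statZero μ α β γ))
    rw [mul_zero] at ht
    obtain ⟨s₀, h1, h2⟩ := ((ht.eventually_le_const hη0).and (eventually_gt_atTop 0)).exists
    exact ⟨s₀, h2, h1⟩
  set b₁ := Real.log (density μ α β γ) - 2 * (ρ - c * ε) with hb₁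
  -- Since `B = exp (b₁ * l)` and `q ≤ exp (-(δ / 4) * l)`, this many blocks give `B * q ^ r ≤ 1`.
  set r := max 2 ⌈4 * b₁ / δ⌉₊ with hr
  have hr2 : 2 ≤ r := le_max_left _ _
  have hrb : b₁ ≤ r * (δ / 4) := by
    have h1 : 4 * b₁ / δ ≤ r := (Nat.le_ceil _).trans (by exact_mod_cast le_max_right _ _)
    rw [div_le_iff₀ hlam] at h1
    linarith
  set J := r * s₀ with hJ
  refine ⟨ε, δ / 16, δ / 32, hε0, hε1, by positivity, by positivity, ?_⟩
  have hlamδ : δ ≤ lam := by linarith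
  have hlam16 : 0 < lam - δ / 16 := by linarith
  filter_upwards [eventually_le_exp (J + 1 : ℝ) (c := δ / 4) (by positivity),
    eventually_le_exp 6 (c := δ / 4) (by positivity),
    eventually_le_exp (4 * J : ℝ) (c := c₁ / 2) (by positivity),
    eventually_le_exp (8 * J : ℝ) (c := δ / 16) (by positivity),
    eventually_le_exp 4 hlam16,
    eventually_le_exp 12 (c := δ / 32) (by positivity)] with l h1 h2 h3 h4 h5 h6 n hn u t hut
  have hl0 : (0 : ℝ) ≤ l := Nat.cast_nonneg l
  -- The layers are large enough for `Ω * B / N` to decay, and the `K * J * N` nodes still fit into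
  -- `exp ((lam - δ / 16) * l)`. The `exp (δ / 8 * l)` groups outweigh the small success probability
  -- of each.
  set N := ⌈Real.exp ((lam - δ / 4) * l)⌉₊ with hN
  set K := ⌈Real.exp (δ / 8 * l)⌉₊ with hK
  have hN1 : Real.exp ((lam - δ / 4) * l) ≤ N := Nat.le_ceil _
  have hN0 : 0 < N := Nat.ceil_pos.mpr (Real.exp_pos _)
  have hN2 : (N : ℝ) ≤ 2 * Real.exp ((lam - δ / 4) * l) := by
    have : 1 ≤ Real.exp ((lam - δ / 4) * l) :=
      Real.one_le_exp (mul_nonneg (by linarith) hl0)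
    linarith [Nat.ceil_lt_add_one (Real.exp_pos ((lam - δ / 4) * l)).le]
  have hK1 : Real.exp (δ / 8 * l) ≤ K := Nat.le_ceil _
  have hK2 : (K : ℝ) ≤ 2 * Real.exp (δ / 8 * l) := by
    have : 1 ≤ Real.exp (δ / 8 * l) := Real.one_le_exp (mul_nonneg (by linarith) hl0)
    linarith [Nat.ceil_lt_add_one (Real.exp_pos (δ / 8 * l)).le]
  have hZl : density μ α β γ ^ l = Real.exp (Real.log (density μ α β γ) * l) := by
    rw [mul_comm, Real.exp_nat_mul, Real.exp_log hZ]
  set Ω := Real.exp ((ρ + c * ε) * l) / density μ α β γ ^ l with hΩ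
  set B := density μ α β γ ^ l * Real.exp (-(2 * (ρ - c * ε) * l)) with hB
  set q := Ω / N * B * ((J : ℕ) + 1) with hq
  have hBe : B = Real.exp (b₁ * l) := by
    rw [hB, hZl, ← Real.exp_add, hb₁]; ring_nf
  have hΩB : Ω * B = Real.exp ((-ρ + 3 * c * ε) * l) := by
    rw [hΩ, hB]
    have := (pow_pos hZ l).ne'
    field_simp
    rw [← Real.exp_add]; ring_nf
  have hNpos : (0 : ℝ) < N := by exact_mod_cast hN0
  have hqle : q ≤ Real.exp (-(δ / 4 * l)) := by
    have e : q = Real.exp ((-ρ + 3 * c * ε) * l) * (J + 1) / N := by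
      rw [hq, ← hΩB]; ring
    rw [e, div_le_iff₀ hNpos]
    calc Real.exp ((-ρ + 3 * c * ε) * l) * (J + 1)
        ≤ Real.exp ((-ρ + δ / 4) * l) * Real.exp (δ / 4 * l) := by
          refine mul_le_mul (Real.exp_le_exp.mpr ?_) h1 (by positivity) (Real.exp_pos _).le
          exact mul_le_mul_of_nonneg_right (by linarith) hl0
      _ = Real.exp (-(δ / 4 * l)) * Real.exp ((lam - δ / 4) * l) := by
          rw [← Real.exp_add, ← Real.exp_add, hδ]; ring_nf
      _ ≤ _ := mul_le_mul_of_nonneg_left hN1 (Real.exp_pos _).le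
  have hq0 : 0 ≤ q := by
    rw [hq, hBe, hΩ]
    have := pow_pos hZ l
    positivity
  have hq6 : q ≤ 1 / 6 := by
    refine hqle.trans ?_
    rw [Real.exp_neg, one_div]
    exact inv_anti₀ (by norm_num) h2
  have hBq : B * q ^ r ≤ 1 := by
    calc B * q ^ r ≤ Real.exp (b₁ * l) * Real.exp (-(δ / 4 * l)) ^ r := by
          rw [hBe]
          exact mul_le_mul_of_nonneg_left (pow_le_pow_left₀ hq0 hqle r) (Real.exp_pos _).le
      _ = Real.exp ((b₁ - r * (δ / 4)) * l) := by
          rw [← Real.exp_nat_mul, ← Real.exp_add]; ring_nf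
      _ ≤ 1 := Real.exp_le_one_iff.mpr (mul_nonpos_of_nonpos_of_nonneg (by linarith) hl0)
  have hsmall : (J : ℕ) * (Real.exp (η * l) * (2 * Real.exp (-(c₁ * l)))) ≤
      1 / 2 * Real.exp (-(2 * η * l)) := by
    calc (J : ℝ) * (Real.exp (η * l) * (2 * Real.exp (-(c₁ * l))))
        = 1 / 2 * (4 * J * Real.exp ((η - c₁) * l)) := by
          rw [mul_left_comm (Real.exp (η * l)), ← Real.exp_add]; ring_nf
      _ ≤ 1 / 2 * (Real.exp (c₁ / 2 * l) * Real.exp ((η - c₁) * l)) := by gcongr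
      _ = 1 / 2 * Real.exp ((η - c₁ / 2) * l) := by rw [← Real.exp_add]; ring_nf
      _ ≤ _ := by
          refine mul_le_mul_of_nonneg_left (Real.exp_le_exp.mpr ?_) (by norm_num)
          nlinarith
  have hcard : K * (J * N) + 2 ≤ Fintype.card (Fin n) := by
    rw [Fintype.card_fin]
    have : ((K * (J * N) + 2 : ℕ) : ℝ) ≤ n := by
      refine le_trans ?_ hn
      push_cast
      have e1 : (K : ℝ) * (J * N) ≤ 1 / 2 * Real.exp ((lam - δ / 16) * l) := by
        calc (K : ℝ) * (J * N) ≤ (2 * Real.exp (δ / 8 * l)) *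
              (J * (2 * Real.exp ((lam - δ / 4) * l))) := by gcongr
          _ = 1 / 2 * (8 * J * (Real.exp (δ / 8 * l) * Real.exp ((lam - δ / 4) * l))) := by ring
          _ ≤ 1 / 2 * (Real.exp (δ / 16 * l) *
              (Real.exp (δ / 8 * l) * Real.exp ((lam - δ / 4) * l))) := by gcongr
          _ = 1 / 2 * Real.exp ((lam - δ / 16) * l) := by
              rw [← Real.exp_add, ← Real.exp_add]; ring_nf
      linarith
    exact_mod_cast this
  refine (h.prob_core_not_reachable_le hs0 hr2 hN0 hη1 hs hε0.le (by linarith) hsmall hΩ hB hq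
    hq6 hBq hcard hut).trans (Real.exp_le_exp.mpr (neg_le_neg ?_))
  rw [one_mul]
  calc Real.exp (δ / 32 * l) ≤ Real.exp (δ / 32 * l) * (Real.exp (δ / 32 * l) / 12) :=
        le_mul_of_one_le_right (Real.exp_pos _).le (by linarith)
    _ = Real.exp (-(δ / 16 * l)) / 12 * Real.exp (δ / 8 * l) := by
        have e : Real.exp (δ / 32 * l) * Real.exp (δ / 32 * l) =
            Real.exp (-(δ / 16 * l)) * Real.exp (δ / 8 * l) := by
          rw [← Real.exp_add, ← Real.exp_add]; congr 1; ring
        linear_combination (1 / 12) * e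
    _ ≤ Real.exp (-(3 * η * l)) / 12 * K := by
        refine mul_le_mul (div_le_div_of_nonneg_right (Real.exp_le_exp.mpr ?_) (by norm_num)) hK1
          (Real.exp_pos _).le (by positivity)
        nlinarith

/-- Exponential rate of the degree of a node with the fraction `ν` of zeros. -/
noncomputable def degRate (μ α β γ ν : ℝ) : ℝ :=
  ν * Real.log (degZero μ α β) + (1 - ν) * Real.log (degOne μ β γ)

omit h in
lemma degRate_add (ν ε : ℝ) : degRate μ α β γ (ν + ε) =
    degRate μ α β γ ν + ε * logRatio μ α β γ := by
  unfold degRate logRatio; ring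

lemma Valid.degRate_nonpos {ν : ℝ} (h0 : 0 ≤ ν) (h1 : ν ≤ 1) : degRate μ α β γ ν ≤ 0 := by
  have := h.log_degZero_neg; have := h.log_degOne_neg
  unfold degRate
  nlinarith

lemma Valid.le_degree {l : ℕ} {ν : ℝ} {x : Fin l → Fin 2} (hx : ν * l ≤ zeros x) :
    Real.exp (degRate μ α β γ ν * l) ≤ degree μ α β γ x := by
  rw [h.degree_eq_exp]
  refine Real.exp_le_exp.mpr ?_
  have := mul_le_mul_of_nonneg_right hx h.logRatio_pos.le
  unfold logRatio at this
  unfold degRate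
  nlinarith

lemma Valid.degree_le {l : ℕ} {ν : ℝ} {x : Fin l → Fin 2} (hx : zeros x ≤ ν * l) :
    degree μ α β γ x ≤ Real.exp (degRate μ α β γ ν * l) := by
  rw [h.degree_eq_exp]
  refine Real.exp_le_exp.mpr ?_
  have := mul_le_mul_of_nonneg_right hx h.logRatio_pos.le
  unfold logRatio at this
  unfold degRate
  nlinarith

/-- Asymptotically, every node with enough zeros has a neighbour with a typical number of
zeros. -/
lemma Valid.exists_climb {lam ν ε : ℝ} (hlam : 0 < lam) (hν : 0 < lam + degRate μ α β γ ν)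
    (hν0 : 0 ≤ ν) (hν1 : ν ≤ 1) (h0 : 0 < ε) (h2 : ε ≤ 2) :
    ∃ sg b τ : ℝ, 0 < sg ∧ 0 < b ∧ 0 < τ ∧ ∀ᶠ l : ℕ in atTop, ∀ n : ℕ,
      Real.exp ((lam - sg) * l) ≤ n → ∀ u : Fin n,
      prob (attrWeight l μ) (pairProb l α β γ) (fun a (ξ : Sym2 (Fin n) → Bool) =>
        ν * l ≤ zeros (a u) ∧ ¬ ∃ v, v ≠ u ∧
          |zeros (a v) - (zeros (a u) * nbrZero μ α β + (l - zeros (a u)) * nbrOne μ β γ)| < ε * l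
          ∧ ξ s(u, v) = true) ≤ Real.exp (-(b * Real.exp (τ * l))) := by
  have hr0 := h.degRate_nonpos hν0 hν1
  set δ := lam + degRate μ α β γ ν with hδ
  set sg := min (δ / 4) (lam / 2) with hsg
  have hsg0 : 0 < sg := lt_min (by positivity) (by positivity)
  refine ⟨sg, 1 / 4, δ / 2, hsg0, by norm_num, by positivity, ?_⟩
  filter_upwards [eventually_le_exp 4 (c := ε ^ 2 / 4) (by positivity),
    eventually_le_exp 2 (c := lam / 2) (by positivity)] with l h1 h3 n hn u
  have hl0 : (0 : ℝ) ≤ l := Nat.cast_nonneg l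
  have hm := isWeight_const (Fin n) (attrWeight_nonneg (l := l) h.mem_Icc.2.2.2)
    (sum_attrWeight l μ)
  have hP := pairProb_mem l h.mem_Icc.1 h.mem_Icc.2.1 h.mem_Icc.2.2.1
  -- For large `l` at least half of the expected degree comes from neighbours with a typical number
  -- of zeros.
  set q := 1 / 2 * Real.exp (degRate μ α β γ ν * l) with hq
  have hq1 : q ≤ 1 := by
    have := Real.exp_le_one_iff.mpr (mul_nonpos_of_nonpos_of_nonneg hr0 hl0)
    linarith
  have hhalf : 2 * Real.exp (-(ε ^ 2 / 4 * l)) ≤ 1 / 2 := by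
    rw [Real.exp_neg]
    have := inv_anti₀ (by norm_num) h1
    linarith
  have hdeg : ∀ x : Fin l → Fin 2, ν * l ≤ zeros x → 1 / 2 * Real.exp (degRate μ α β γ ν * l) ≤
      ∑ y, if |zeros y - (zeros x * nbrZero μ α β + (l - zeros x) * nbrOne μ β γ)| < ε * l
        then attrWeight l μ y * pairProb l α β γ s(x, y) else 0 := by
    intro x hx
    refine le_trans ?_ (h.le_sum_typical x h0.le h2)
    have := h.le_degree hx
    have hp := Real.exp_pos (degRate μ α β γ ν * l)
    nlinarith
  have main := prob_no_neighbour_le hm hP (sum_attrWeight l μ) (fun x => ν * l ≤ zeros x)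
    (fun x y => |zeros y - (zeros x * nbrZero μ α β + (l - zeros x) * nbrOne μ β γ)| < ε * l) u
    (q := q) hq1 (fun x hx => by
      refine (hdeg x hx).trans (le_of_eq ?_)
      refine Finset.sum_congr rfl fun y _ => ?_
      congr)
  refine main.trans ?_
  rw [Fintype.card_fin]
  have hn2 : (2 : ℝ) ≤ n := by
    refine (h3.trans (Real.exp_le_exp.mpr ?_)).trans hn
    have : sg ≤ lam / 2 := min_le_right _ _
    nlinarith
  have hn1 : (n : ℝ) / 2 ≤ ((n - 1 : ℕ) : ℝ) := by
    have : 1 ≤ n := by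
      have : (1 : ℝ) ≤ n := by linarith
      exact_mod_cast this
    rw [Nat.cast_sub this]
    push_cast
    linarith
  calc (1 - q) ^ (n - 1) ≤ Real.exp (-q) ^ (n - 1) :=
        pow_le_pow_left₀ (by linarith) (by linarith [Real.add_one_le_exp (-q)]) _
    _ = Real.exp (-(q * (n - 1 : ℕ))) := by rw [← Real.exp_nat_mul]; ring_nf
    _ ≤ _ := by
        refine Real.exp_le_exp.mpr (neg_le_neg ?_)
        calc 1 / 4 * Real.exp (δ / 2 * l)
            ≤ 1 / 4 * Real.exp (degRate μ α β γ ν * l + (lam - sg) * l) := by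
              have : sg ≤ δ / 4 := min_le_left _ _
              refine mul_le_mul_of_nonneg_left (Real.exp_le_exp.mpr ?_) (by norm_num)
              nlinarith
          _ = q * (Real.exp ((lam - sg) * l) / 2) := by rw [Real.exp_add, hq]; ring
          _ ≤ q * (n - 1 : ℕ) :=
              mul_le_mul_of_nonneg_left (by linarith) (by positivity)

end

end Asymptotics

/-! ### Large deviations of the number of zeros. -/

section Tilting

/-- The large deviation rate of the event that a fraction `ν` of the attributes is zero. -/
noncomputable def klRate (μ ν : ℝ) : ℝ :=
  -(ν * Real.log (μ / ν) + (1 - ν) * Real.log ((1 - μ) / (1 - ν)))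

/-- The derivative of the exponential tilting in the fraction of zeros. -/
noncomputable def tilt (μ ν : ℝ) : ℝ := Real.log (μ / ν) - Real.log ((1 - μ) / (1 - ν))

variable {μ ν : ℝ}

lemma tilt_nonneg (h0 : 0 < ν) (hν : ν ≤ μ) (h1 : μ < 1) : 0 ≤ tilt μ ν := by
  have e1 : 0 ≤ Real.log (μ / ν) := Real.log_nonneg ((one_le_div h0).mpr hν)
  have e2 : Real.log ((1 - μ) / (1 - ν)) ≤ 0 :=
    Real.log_nonpos (div_nonneg (by linarith) (by linarith))
      ((div_le_one (by linarith)).mpr (by linarith))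
  unfold tilt
  linarith

/-- Exact change of measure between two product laws. At exactly `ν * l` zeros the density is `exp
(-klRate * l)`, and `tilt` is its logarithmic slope, nonnegative for `ν ≤ μ`. -/
lemma attrWeight_tilt (hμ : μ ∈ Set.Ioo (0 : ℝ) 1) (hν : ν ∈ Set.Ioo (0 : ℝ) 1) {l : ℕ}
    (x : Fin l → Fin 2) : attrWeight l μ x =
      attrWeight l ν x * Real.exp (-(klRate μ ν * l) + (zeros x - ν * l) * tilt μ ν) := by
  have hμ1 : 0 < 1 - μ := by linarith [hμ.2]
  have hν1 : 0 < 1 - ν := by linarith [hν.2]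
  have hν0 := hν.1
  have e : Real.exp (-(klRate μ ν * l) + (zeros x - ν * l) * tilt μ ν) =
      ∏ i, if x i = 0 then μ / ν else (1 - μ) / (1 - ν) := by
    have e1 : -(klRate μ ν * l) + (zeros x - ν * l) * tilt μ ν =
        zeros x * Real.log (μ / ν) + (l - zeros x) * Real.log ((1 - μ) / (1 - ν)) := by
      unfold klRate tilt; ring
    rw [e1, ← sum_ite_zero, Real.exp_sum]
    refine Finset.prod_congr rfl fun i _ => ?_
    split_ifs
    · rw [Real.exp_log (div_pos hμ.1 hν0)]
    · rw [Real.exp_log (div_pos hμ1 hν1)]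
  rw [e, attrWeight, attrWeight, ← Finset.prod_mul_distrib]
  refine Finset.prod_congr rfl fun i _ => ?_
  unfold coordWeight
  split_ifs <;> field_simp

/-- Chernoff's bound for the number of zeros. -/
lemma sum_attrWeight_zeros_lt_le (hμ : μ < 1) (hν0 : 0 < ν) (hν : ν < μ) (l : ℕ) :
    ∑ x, (if zeros x < ν * l then attrWeight l μ x else 0) ≤ Real.exp (-(klRate μ ν * l)) := by
  have hνI : ν ∈ Set.Ioo (0 : ℝ) 1 := ⟨hν0, hν.trans hμ⟩
  have hνc : ν ∈ Set.Icc (0 : ℝ) 1 := ⟨hνI.1.le, hνI.2.le⟩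
  calc _ ≤ ∑ x, attrWeight l ν x * Real.exp (-(klRate μ ν * l)) := by
        refine Finset.sum_le_sum fun x _ => ?_
        have h0 := attrWeight_nonneg hνc x
        split_ifs with hx
        · rw [attrWeight_tilt ⟨hν0.trans hν, hμ⟩ hνI]
          refine mul_le_mul_of_nonneg_left (Real.exp_le_exp.mpr ?_) h0
          have := tilt_nonneg hν0 hν.le hμ
          nlinarith
        · positivity
    _ = _ := by rw [← Finset.sum_mul, sum_attrWeight, one_mul]

/-- The number of zeros is small with at least the probability given by the rate. -/
lemma le_sum_attrWeight_zeros_le (hμ : μ < 1) (hν0 : 0 < ν) (hν : ν < μ) {ε : ℝ} (h0 : 0 ≤ ε)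
    (h2 : ε ≤ 2) (l : ℕ) :
    Real.exp (-((klRate μ ν + ε * tilt μ ν) * l)) * (1 - 2 * Real.exp (-(ε ^ 2 / 4 * l))) ≤
      ∑ x, (if zeros x ≤ (ν + ε) * l then attrWeight l μ x else 0) := by
  have hνI : ν ∈ Set.Ioo (0 : ℝ) 1 := ⟨hν0, hν.trans hμ⟩
  have hνc : ν ∈ Set.Icc (0 : ℝ) 1 := ⟨hνI.1.le, hνI.2.le⟩
  have hμI : μ ∈ Set.Ioo (0 : ℝ) 1 := ⟨hν0.trans hν, hμ⟩
  have hc := zeros_concentration (l := l) (r := fun _ => ν) (fun _ => hνc) h0 h2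
  have hs : ∑ _i : Fin l, ν = ν * l := by simp [mul_comm]
  rw [hs] at hc
  set E := Real.exp (-((klRate μ ν + ε * tilt μ ν) * l))
  have ht : ∑ x : Fin l → Fin 2, attrWeight l ν x *
      (1 - if ε * l ≤ |zeros x - ν * l| then 1 else 0) =
      1 - pexp (fun _ : Fin l => coordWeight ν)
        (fun y => if ε * l ≤ |zeros y - ν * l| then 1 else 0) := by
    simp only [mul_sub, mul_one, Finset.sum_sub_distrib, sum_attrWeight]
    rfl
  calc _ ≤ E * ∑ x : Fin l → Fin 2, attrWeight l ν x *
        (1 - if ε * l ≤ |zeros x - ν * l| then 1 else 0) :=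
        mul_le_mul_of_nonneg_left (by rw [ht]; linarith) (Real.exp_pos _).le
    _ ≤ _ := by
        rw [Finset.mul_sum]
        refine Finset.sum_le_sum fun x _ => ?_
        have hx0 := attrWeight_nonneg hνc x
        have hx1 := attrWeight_nonneg (p := μ) ⟨hμI.1.le, hμI.2.le⟩ x
        -- Under the tilted law most vectors have within `ε * l` of `ν * l` zeros; on those the
        -- density loses at most a factor `exp (-ε * tilt * l)`.
        by_cases hx : ε * l ≤ |zeros x - ν * l|
        · rw [if_pos hx, sub_self, mul_zero, mul_zero]
          split_ifs <;> linarith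
        · rw [not_le, abs_lt] at hx
          have hx' : ¬ ε * l ≤ |zeros x - ν * l| := by rw [not_le, abs_lt]; exact hx
          rw [if_neg hx', if_pos (by linarith [hx.2]), sub_zero, mul_one, mul_comm,
            attrWeight_tilt hμI hνI]
          refine mul_le_mul_of_nonneg_left (Real.exp_le_exp.mpr ?_) hx0
          have := mul_le_mul_of_nonneg_right hx.1.le (tilt_nonneg hν0 hν.le hμ)
          nlinarith

end Tilting

/-! ### Connectedness above the threshold. -/

section Connectedness

variable {V : Type*} [Fintype V] [DecidableEq V]

open scoped Classical in
lemma prob_attr {X : Type*} [Fintype X] [DecidableEq X] {m : X → ℝ} {P : Sym2 X → ℝ}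
    (hm : IsWeight fun _ : V => m) (hP : ∀ e, P e ∈ Set.Icc 0 1) (A : X → Prop) (u : V) :
    prob m P (fun a _ => A (a u)) = ∑ x, if A x then m x else 0 := by
  have h1 : ∀ a : V → X, edgeExp P a (fun _ => if A (a u) then 1 else 0) =
      if A (a u) then 1 else 0 := fun a => pexp_const (isWeight_bern hP a) _
  rw [prob_eq]
  simp only [h1]
  rw [pexp_single hm u (fun x => if A x then 1 else 0)]
  exact Finset.sum_congr rfl fun x _ => by split_ifs <;> simp

variable {μ α β γ : ℝ}

section

variable (h : Valid μ α β γ)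
include h

lemma Valid.abs_zeros_sub_le {l : ℕ} (x : Fin l → Fin 2) :
    |zeros x - statZero μ α β γ * l| ≤ l := by
  have hp := h.statZero_mem
  have := h.μ_pos
  have h1 := zeros_nonneg x; have h2 := zeros_le x
  have hl : (0 : ℝ) ≤ l := Nat.cast_nonneg l
  rw [abs_le]
  constructor <;> nlinarith [hp.1, hp.2]

/-- If every node has a neighbour with a typical number of zeros, and the core is connected, then
the graph is connected. -/
lemma Valid.connected_of_climb [Nonempty V] {l : ℕ} {ε : ℝ} (h0 : 0 < ε)
    {a : V → Fin l → Fin 2} {ξ : Sym2 V → Bool}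
    (hclimb : ∀ u, ∃ v, v ≠ u ∧
      |zeros (a v) - (zeros (a u) * nbrZero μ α β + (l - zeros (a u)) * nbrOne μ β γ)| <
        ε * (1 - |gapEig μ α β γ|) / 2 * l ∧ ξ s(u, v) = true)
    (hcore : ∀ u t, u ≠ t → a u ∈ core l (statZero μ α β γ) ε →
      a t ∈ core l (statZero μ α β γ) ε → (indGraph ξ).Reachable u t) :
    (indGraph ξ).Connected := by
  have hg := h.abs_gapEig_lt
  have hg0 := abs_nonneg (gapEig μ α β γ)
  have hl : (0 : ℝ) ≤ l := Nat.cast_nonneg l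
  -- Each step multiplies the deviation from the stationary number of zeros by `|gapEig|` and adds
  -- at most `ε * (1 - |gapEig|) / 2 * l`. The error `ε / 2` is the fixed point of this recursion.
  have step : ∀ k : ℕ, ∀ u, ∃ v, (indGraph ξ).Reachable u v ∧
      |zeros (a v) - statZero μ α β γ * l| ≤ (|gapEig μ α β γ| ^ k + ε / 2) * l := by
    intro k
    induction k with
    | zero =>
      refine fun u => ⟨u, SimpleGraph.Reachable.refl u, (h.abs_zeros_sub_le _).trans ?_⟩
      rw [pow_zero]
      nlinarith
    | succ k ih =>
      intro u
      obtain ⟨v, huv, hv⟩ := ih u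
      obtain ⟨w, hwv, hw, hξ⟩ := hclimb v
      have hadj : (indGraph ξ).Adj v w := indGraph_adj.mpr ⟨hξ, hwv.symm⟩
      refine ⟨w, huv.trans hadj.reachable, ?_⟩
      have e : zeros (a w) - statZero μ α β γ * l =
          (zeros (a w) - (zeros (a v) * nbrZero μ α β + (l - zeros (a v)) * nbrOne μ β γ)) +
            gapEig μ α β γ * (zeros (a v) - statZero μ α β γ * l) := by
        rw [h.nbrZero_eq, h.nbrOne_eq]; ring
      rw [e]
      refine (abs_add_le _ _).trans ?_
      rw [abs_mul]
      have := mul_le_mul_of_nonneg_left hv hg0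
      calc _ ≤ ε * (1 - |gapEig μ α β γ|) / 2 * l +
            |gapEig μ α β γ| * ((|gapEig μ α β γ| ^ k + ε / 2) * l) := add_le_add hw.le this
        _ = _ := by ring
  obtain ⟨k, hk⟩ := exists_pow_lt_of_lt_one (half_pos h0) hg
  have reach : ∀ u, ∃ v, (indGraph ξ).Reachable u v ∧ a v ∈ core l (statZero μ α β γ) ε := by
    intro u
    obtain ⟨v, huv, hv⟩ := step k u
    exact ⟨v, huv, mem_core.mpr (hv.trans (mul_le_mul_of_nonneg_right (by linarith) hl))⟩
  refine ⟨fun u t => ?_⟩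
  obtain ⟨u', hu, hu'⟩ := reach u
  obtain ⟨t', ht, ht'⟩ := reach t
  by_cases e : u' = t'
  · exact hu.trans (e ▸ ht.symm)
  · exact hu.trans ((hcore u' t' e hu' ht').trans ht.symm)

/-- If isolated nodes are unlikely, then the graph is connected with high probability. -/
lemma Valid.exists_connected_bound {lam lam' ν : ℝ} (hlam : 0 < lam) (hν0 : 0 ≤ ν) (hν : ν < μ)
    (hrate : 0 < lam + degRate μ α β γ ν) (hlam' : lam < lam')
    (hlight : ∀ l : ℕ, ∑ x, (if zeros x < ν * l then attrWeight l μ x else 0) ≤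
      Real.exp (-(lam' * l))) :
    ∃ s : ℝ, ∃ f : ℕ → ℝ, 0 < s ∧ Tendsto f atTop (𝓝 0) ∧ ∀ᶠ l : ℕ in atTop, ∀ n : ℕ,
      Real.exp ((lam - s) * l) ≤ n → (n : ℝ) ≤ Real.exp ((lam + s) * l) →
      prob (attrWeight l μ) (pairProb l α β γ)
        (fun _ (ξ : Sym2 (Fin n) → Bool) => ¬ (indGraph ξ).Connected) ≤ f l := by
  have hg := h.abs_gapEig_lt
  have hg0 := abs_nonneg (gapEig μ α β γ)
  -- The stationary fraction exceeds `μ`, hence `ν`, and degrees increase with the fraction of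
  -- zeros.
  have hcr : 0 < lam + coreRate μ α β γ := by
    have hp := h.statZero_mem
    have e : coreRate μ α β γ = degRate μ α β γ (ν + (statZero μ α β γ - ν)) := by
      rw [add_sub_cancel]; rfl
    rw [e, degRate_add]
    have : 0 ≤ (statZero μ α β γ - ν) * logRatio μ α β γ :=
      mul_nonneg (by linarith [hp.1]) h.logRatio_pos.le
    linarith
  obtain ⟨ε, s₁, τ₁, hε0, hε1, hs₁, hτ₁, H₁⟩ := h.exists_core hcr
  obtain ⟨s₂, b, τ₂, hs₂, hb, hτ₂, H₂⟩ := h.exists_climb (ε := ε * (1 - |gapEig μ α β γ|) / 2)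
    hlam hrate hν0 (hν.trans h.μ_lt_one).le
    (by have : 0 < 1 - |gapEig μ α β γ| := by linarith
        positivity) (by nlinarith)
  set s := min (min s₁ s₂) ((lam' - lam) / 2) with hs
  have hss₁ : s ≤ s₁ := (min_le_left _ _).trans (min_le_left _ _)
  have hss₂ : s ≤ s₂ := (min_le_left _ _).trans (min_le_right _ _)
  have hss₃ : s ≤ (lam' - lam) / 2 := min_le_right _ _
  have hs0 : 0 < s := lt_min (lt_min hs₁ hs₂) (by linarith)
  -- The three terms account for a node with too few zeros, a node without a typical neighbour, and
  -- a pair of core nodes that is not joined; the factors are `n`, `n` and `n ^ 2`.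
  refine ⟨s, fun l => Real.exp (-((lam' - lam - s) * l)) +
    (Real.exp ((lam + s) * l) * Real.exp (-(b * Real.exp (τ₂ * l))) +
      Real.exp (2 * (lam + s) * l) * Real.exp (-(1 * Real.exp (τ₁ * l)))), hs0, ?_, ?_⟩
  · have := (tendsto_exp_neg (c := lam' - lam - s) (by linarith)).add
      ((tendsto_exp_sub_exp (lam + s) hb hτ₂).add
        (tendsto_exp_sub_exp (2 * (lam + s)) one_pos hτ₁))
    simpa only [add_zero] using this
  · filter_upwards [H₁, H₂] with l H₁ H₂ n hn hn'
    have hl0 : (0 : ℝ) ≤ l := Nat.cast_nonneg l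
    have hn₁ : Real.exp ((lam - s₁) * l) ≤ n :=
      (Real.exp_le_exp.mpr (mul_le_mul_of_nonneg_right (by linarith) hl0)).trans hn
    have hn₂ : Real.exp ((lam - s₂) * l) ≤ n :=
      (Real.exp_le_exp.mpr (mul_le_mul_of_nonneg_right (by linarith) hl0)).trans hn
    have hm := isWeight_const (Fin n) (attrWeight_nonneg (l := l) h.mem_Icc.2.2.2)
      (sum_attrWeight l μ)
    have hP := pairProb_mem l h.mem_Icc.1 h.mem_Icc.2.1 h.mem_Icc.2.2.1
    have hne : Nonempty (Fin n) := by
      have : (0 : ℝ) < n := (Real.exp_pos _).trans_le hn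
      exact ⟨⟨0, by exact_mod_cast this⟩⟩
    refine (prob_mono (S' := fun a (ξ : Sym2 (Fin n) → Bool) =>
      (∃ u ∈ Finset.univ, zeros (a u) < ν * l) ∨
      (∃ u ∈ Finset.univ, ν * l ≤ zeros (a u) ∧ ¬ ∃ v, v ≠ u ∧
        |zeros (a v) - (zeros (a u) * nbrZero μ α β + (l - zeros (a u)) * nbrOne μ β γ)| <
          ε * (1 - |gapEig μ α β γ|) / 2 * l ∧ ξ s(u, v) = true) ∨
      (∃ p ∈ (Finset.univ : Finset (Fin n)).offDiag, (a p.1 ∈ core l (statZero μ α β γ) ε ∧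
        a p.2 ∈ core l (statZero μ α β γ) ε) ∧ ¬ (indGraph ξ).Reachable p.1 p.2)) hm hP ?_).trans ?_
    · intro a ξ hc
      by_contra! hcon
      obtain ⟨c1, c2, c3⟩ := hcon
      refine hc (h.connected_of_climb hε0 (fun u => c2 u (Finset.mem_univ _)
        (c1 u (Finset.mem_univ _))) fun u t hut hu ht => c3 (u, t) ?_ ⟨hu, ht⟩)
      simpa using hut
    · refine (prob_or_le hm hP _ _).trans (add_le_add ?_ ((prob_or_le hm hP _ _).trans
        (add_le_add ?_ ?_)))
      · refine (prob_exists_le hm hP _ fun u a _ => zeros (a u) < ν * l).trans ?_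
        calc _ ≤ ∑ _u : Fin n, Real.exp (-(lam' * l)) := by
              refine Finset.sum_le_sum fun u _ => ?_
              rw [prob_attr hm hP (fun x => zeros x < ν * l)]
              refine le_trans (le_of_eq (Finset.sum_congr rfl fun x _ => ?_)) (hlight l)
              congr
          _ = n * Real.exp (-(lam' * l)) := by simp
          _ ≤ Real.exp ((lam + s) * l) * Real.exp (-(lam' * l)) :=
              mul_le_mul_of_nonneg_right hn' (Real.exp_pos _).le
          _ = _ := by rw [← Real.exp_add]; congr 1; ring
      · refine (prob_exists_le hm hP _ _).trans ((Finset.sum_le_sum fun u _ => H₂ n hn₂ u).trans ?_)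
        rw [Finset.sum_const, Finset.card_univ, Fintype.card_fin, nsmul_eq_mul]
        exact mul_le_mul_of_nonneg_right hn' (Real.exp_pos _).le
      · refine (prob_exists_le hm hP _ _).trans ((Finset.sum_le_sum fun p hp =>
          H₁ n hn₁ p.1 p.2 (Finset.mem_offDiag.mp hp).2.2).trans ?_)
        rw [Finset.sum_const, nsmul_eq_mul]
        refine mul_le_mul_of_nonneg_right ?_ (Real.exp_pos _).le
        have hcard : ((Finset.univ : Finset (Fin n)).offDiag.card : ℝ) ≤ (n : ℝ) * n := by
          have : (Finset.univ : Finset (Fin n)).offDiag.card ≤ n * n := by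
            rw [Finset.offDiag_card, Finset.card_univ, Fintype.card_fin]
            exact Nat.sub_le _ _
          exact_mod_cast this
        refine hcard.trans ((mul_le_mul hn' hn' (Nat.cast_nonneg n) (Real.exp_pos _).le).trans ?_)
        rw [← Real.exp_add]
        exact le_of_eq (by congr 1; ring)

end

end Connectedness

/-! ### Disconnectedness below the threshold. -/

section Disconnectedness

variable {μ α β γ : ℝ}

open scoped Classical in
/-- If there are nodes of vanishing expected degree, then the graph is disconnected with high
probability. -/
lemma Valid.exists_disconnected_bound (h : Valid μ α β γ) {lam ν : ℝ} (hlam : 0 < lam)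
    (hν0 : 0 < ν) (hν : ν < μ) (hkl : klRate μ ν < lam) (hdeg : degRate μ α β γ ν < -lam) :
    ∃ s : ℝ, ∃ f : ℕ → ℝ, 0 < s ∧ Tendsto f atTop (𝓝 0) ∧ ∀ᶠ l : ℕ in atTop, ∀ n : ℕ,
      Real.exp ((lam - s) * l) ≤ n → (n : ℝ) ≤ Real.exp ((lam + s) * l) →
      prob (attrWeight l μ) (pairProb l α β γ)
        (fun _ (ξ : Sym2 (Fin n) → Bool) => (indGraph ξ).Connected) ≤ f l := by
  set δ₁ := lam - klRate μ ν with hδ₁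
  set δ₂ := -lam - degRate μ α β γ ν with hδ₂
  have hδ₁0 : 0 < δ₁ := sub_pos.mpr hkl
  have hδ₂0 : 0 < δ₂ := sub_pos.mpr hdeg
  have ht := tilt_nonneg hν0 hν.le h.μ_lt_one
  have hc := h.logRatio_pos
  -- Passing from `ν` to `ν + ε` must preserve both strict inequalities. In the witness `tilt + 1`
  -- replaces `tilt`, which is only known to be nonnegative.
  obtain ⟨ε, hε0, hε2, hεt, hεc⟩ : ∃ ε : ℝ, 0 < ε ∧ ε ≤ 2 ∧ ε * tilt μ ν ≤ δ₁ / 4 ∧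
      ε * logRatio μ α β γ ≤ δ₂ / 2 := by
    refine ⟨min 2 (min (δ₁ / (4 * (tilt μ ν + 1))) (δ₂ / (2 * logRatio μ α β γ))),
      by positivity, min_le_left _ _, ?_, ?_⟩
    · have : min 2 (min (δ₁ / (4 * (tilt μ ν + 1))) (δ₂ / (2 * logRatio μ α β γ))) ≤
          δ₁ / (4 * (tilt μ ν + 1)) := (min_le_right _ _).trans (min_le_left _ _)
      calc _ ≤ δ₁ / (4 * (tilt μ ν + 1)) * (tilt μ ν + 1) :=
            mul_le_mul this (by linarith) ht (by positivity)
        _ = δ₁ / 4 := by field_simp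
    · have : min 2 (min (δ₁ / (4 * (tilt μ ν + 1))) (δ₂ / (2 * logRatio μ α β γ))) ≤
          δ₂ / (2 * logRatio μ α β γ) := (min_le_right _ _).trans (min_le_right _ _)
      calc _ ≤ δ₂ / (2 * logRatio μ α β γ) * logRatio μ α β γ :=
            mul_le_mul_of_nonneg_right this hc.le
        _ = δ₂ / 2 := by field_simp
  set κ := min (lam / 2) (min (δ₁ / 16) (δ₂ / 8)) with hκ
  have hκ0 : 0 < κ := by positivity
  have hκ1 : κ ≤ lam / 2 := min_le_left _ _
  have hκ2 : κ ≤ δ₁ / 16 := (min_le_right _ _).trans (min_le_left _ _)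
  have hκ3 : κ ≤ δ₂ / 8 := (min_le_right _ _).trans (min_le_right _ _)
  refine ⟨κ, fun l => Real.exp (0 * l) * Real.exp (-(1 * Real.exp (κ * l))) +
    2 * Real.exp (-(2 * κ * l)), hκ0, ?_, ?_⟩
  · have := (tendsto_exp_sub_exp 0 one_pos hκ0).add
      ((tendsto_exp_neg (c := 2 * κ) (by positivity)).const_mul 2)
    simpa only [mul_zero, add_zero] using this
  · filter_upwards [eventually_le_exp 4 (c := ε ^ 2 / 4) (by positivity),
      eventually_le_exp 2 (c := lam / 2) (by positivity),
      eventually_le_exp 4 (c := 2 * κ) (by positivity)] with l h1 h2 h3 n hn hn'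
    have hl0 : (0 : ℝ) ≤ l := Nat.cast_nonneg l
    have hm := isWeight_const (Fin n) (attrWeight_nonneg (l := l) h.mem_Icc.2.2.2)
      (sum_attrWeight l μ)
    have hP := pairProb_mem l h.mem_Icc.1 h.mem_Icc.2.1 h.mem_Icc.2.2.1
    set p := ∑ x : Fin l → Fin 2, if zeros x ≤ (ν + ε) * l then attrWeight l μ x else 0 with hp
    set D := Real.exp (degRate μ α β γ (ν + ε) * l) with hD
    have hpl : Real.exp (-((lam - 3 / 4 * δ₁) * l)) ≤ 2 * p := by
      have h4 : 1 / 2 ≤ 1 - 2 * Real.exp (-(ε ^ 2 / 4 * l)) := by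
        rw [Real.exp_neg]
        have := inv_anti₀ (by norm_num) h1
        linarith
      have h5 := le_sum_attrWeight_zeros_le h.μ_lt_one hν0 hν hε0.le hε2 l
      have h6 : Real.exp (-((lam - 3 / 4 * δ₁) * l)) ≤
          Real.exp (-((klRate μ ν + ε * tilt μ ν) * l)) :=
        Real.exp_le_exp.mpr (neg_le_neg (mul_le_mul_of_nonneg_right (by linarith) hl0))
      have h7 := mul_le_mul_of_nonneg_left h4
        (Real.exp_pos (-((klRate μ ν + ε * tilt μ ν) * l))).le
      have h8 : Real.exp (-((klRate μ ν + ε * tilt μ ν) * l)) * (1 / 2) ≤ p := by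
        refine (h7.trans h5).trans (le_of_eq (Finset.sum_congr rfl fun x _ => ?_))
        congr
      linarith
    have hp0 : 0 < p := by linarith [Real.exp_pos (-((lam - 3 / 4 * δ₁) * l))]
    have hp1 : p ≤ 1 := by
      rw [← sum_attrWeight l μ, hp]
      refine Finset.sum_le_sum fun x _ => ?_
      have := attrWeight_nonneg h.mem_Icc.2.2.2 x
      split_ifs <;> linarith
    have hE1 : 1 ≤ Real.exp (κ * l) := Real.one_le_exp (by positivity)
    -- The sample contains about `exp (κ * l)` light nodes on average: enough for one to exist, yet
    -- few enough for the expected number of their edges, at most `M * n * p * D`, to vanish. With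
    -- all `n` nodes the latter could be large.
    set M := ⌈Real.exp (κ * l) / p⌉₊ with hM
    have hM1 : Real.exp (κ * l) ≤ M * p := (div_le_iff₀ hp0).mp (Nat.le_ceil _)
    have hM2 : M * p ≤ 2 * Real.exp (κ * l) := by
      have := (Nat.ceil_lt_add_one (div_pos (Real.exp_pos (κ * l)) hp0).le).le
      have := mul_le_mul_of_nonneg_right this hp0.le
      rw [add_mul, div_mul_cancel₀ _ hp0.ne'] at this
      linarith
    have hMn : M ≤ n := by
      have : (M : ℝ) ≤ n := by
        refine le_trans ?_ hn
        have e2 : Real.exp (-((lam - 3 / 4 * δ₁) * l)) * M ≤ 4 * Real.exp (κ * l) := by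
          have := mul_le_mul_of_nonneg_right hpl (Nat.cast_nonneg (α := ℝ) M)
          linarith
        have e3 : 4 * Real.exp (κ * l) ≤
            Real.exp (-((lam - 3 / 4 * δ₁) * l)) * Real.exp ((lam - κ) * l) := by
          calc 4 * Real.exp (κ * l) ≤ Real.exp (2 * κ * l) * Real.exp (κ * l) :=
                mul_le_mul_of_nonneg_right h3 (Real.exp_pos _).le
            _ ≤ _ := by
                rw [← Real.exp_add, ← Real.exp_add]
                refine Real.exp_le_exp.mpr ?_
                nlinarith
        exact le_of_mul_le_mul_left (e2.trans e3) (Real.exp_pos _)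
      exact_mod_cast this
    obtain ⟨S, -, hS⟩ := Finset.exists_subset_card_eq
      (show M ≤ (Finset.univ : Finset (Fin n)).card by simpa using hMn)
    have hn2 : 2 ≤ n := by
      have : (2 : ℝ) ≤ n := (h2.trans (Real.exp_le_exp.mpr
        (mul_le_mul_of_nonneg_right (by linarith) hl0))).trans hn
      exact_mod_cast this
    refine (prob_connected_le hm hP (sum_attrWeight l μ) (fun x => zeros x ≤ (ν + ε) * l) S
      (by simpa using hn2) (D := D) (Real.exp_pos _).le (fun x hx => ?_)).trans ?_
    · rw [h.sum_attrWeight_mul_pairProb]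
      exact h.degree_le hx
    rw [hS, Fintype.card_fin]
    refine add_le_add ?_ ?_
    · rw [zero_mul, Real.exp_zero, one_mul, one_mul]
      calc (1 - p) ^ M ≤ Real.exp (-p) ^ M :=
            pow_le_pow_left₀ (by linarith) (by linarith [Real.add_one_le_exp (-p)]) _
        _ = Real.exp (-(M * p)) := by rw [← Real.exp_nat_mul]; ring_nf
        _ ≤ _ := Real.exp_le_exp.mpr (neg_le_neg hM1)
    · calc (M : ℝ) * (n * (p * D)) = M * p * (n * D) := by ring
        _ ≤ 2 * Real.exp (κ * l) * (Real.exp ((lam + κ) * l) * D) := by gcongr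
        _ = 2 * Real.exp ((2 * κ + lam + degRate μ α β γ (ν + ε)) * l) := by
            rw [hD, mul_assoc, ← Real.exp_add, ← Real.exp_add]; ring_nf
        _ ≤ _ := by
            refine mul_le_mul_of_nonneg_left (Real.exp_le_exp.mpr ?_) (by norm_num)
            rw [degRate_add]
            nlinarith

end Disconnectedness

/-! ### The rate function and the criterion as exponents. -/

section Threshold

variable {μ ν ρ : ℝ}

/-- Written as an affine function minus the binary entropy, the rate is visibly continuous at `ν =
0`, where the convention `0 * log 0 = 0` is at work. -/
lemma klRate_eq (hμ : μ ∈ Set.Ioo (0 : ℝ) 1) (hν : ν ∈ Set.Ico (0 : ℝ) 1) :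
    klRate μ ν = -(ν * Real.log μ + (1 - ν) * Real.log (1 - μ)) - Real.binEntropy ν := by
  have hμ1 : 1 - μ ≠ 0 := by linarith [hμ.2]
  have hν1 : 1 - ν ≠ 0 := by linarith [hν.2]
  rw [Real.binEntropy_eq_negMulLog_add_negMulLog_one_sub, Real.negMulLog, Real.negMulLog, klRate,
    Real.log_div hμ1 hν1]
  rcases hν.1.eq_or_lt with h0 | h0
  · simp [← h0]
  · rw [Real.log_div hμ.1.ne' h0.ne']
    ring

/-- The derivative is `log (ν / μ) - log ((1 - ν) / (1 - μ))`, in which both terms are negative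
contributions for `ν < μ`. -/
lemma klRate_strictAntiOn (hμ : μ ∈ Set.Ioo (0 : ℝ) 1) :
    StrictAntiOn (klRate μ) (Set.Icc 0 μ) ∧ ContinuousOn (klRate μ) (Set.Icc 0 μ) := by
  have e : Set.EqOn (fun ν => -(ν * Real.log μ + (1 - ν) * Real.log (1 - μ)) - Real.binEntropy ν)
      (klRate μ) (Set.Icc 0 μ) :=
    fun ν hν => (klRate_eq hμ ⟨hν.1, hν.2.trans_lt hμ.2⟩).symm
  have hc : Continuous fun ν =>
      -(ν * Real.log μ + (1 - ν) * Real.log (1 - μ)) - Real.binEntropy ν := by fun_prop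
  refine ⟨StrictAntiOn.congr (strictAntiOn_of_deriv_neg (convex_Icc 0 μ) hc.continuousOn ?_) e,
    hc.continuousOn.congr e.symm⟩
  intro ν hν
  rw [interior_Icc] at hν
  have hν1 : ν < 1 := hν.2.trans hμ.2
  have h1 := Real.hasDerivAt_binEntropy hν.1.ne' hν1.ne
  have h2 : HasDerivAt (fun ν => -(ν * Real.log μ + (1 - ν) * Real.log (1 - μ)))
      (-(1 * Real.log μ + -1 * Real.log (1 - μ))) ν :=
    (((hasDerivAt_id ν).mul_const _).add (((hasDerivAt_id ν).const_sub 1).mul_const _)).neg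
  rw [HasDerivAt.deriv (f := fun ν => -(ν * Real.log μ + (1 - ν) * Real.log (1 - μ)) -
    Real.binEntropy ν) (h2.sub h1)]
  have h3 := Real.log_lt_log hν.1 hν.2
  have h4 := Real.log_lt_log (by linarith [hμ.2] : 0 < 1 - μ) (by linarith [hν.2] : 1 - μ < 1 - ν)
  linarith

lemma klRate_zero : klRate μ 0 = -Real.log (1 - μ) := by simp [klRate]

lemma klRate_self (hμ : μ ∈ Set.Ioo (0 : ℝ) 1) : klRate μ μ = 0 := by
  have hμ1 : 1 - μ ≠ 0 := by linarith [hμ.2]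
  simp [klRate, div_self hμ1, div_self hμ.1.ne']

lemma half_lt_exp_iff (hρ : 0 < ρ) (x : ℝ) :
    1 / 2 < Real.exp (x * ρ) ↔ 0 < Real.log 2 / ρ + x := by
  have e : (1 / 2 : ℝ) = Real.exp (-Real.log 2) := by rw [Real.exp_neg, Real.exp_log two_pos]; simp
  rw [e, Real.exp_lt_exp, ← neg_lt_iff_pos_add', ← neg_div, div_lt_iff₀ hρ]

lemma exp_lt_half_iff (hρ : 0 < ρ) (x : ℝ) :
    Real.exp (x * ρ) < 1 / 2 ↔ x < -(Real.log 2 / ρ) := by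
  have e : (1 / 2 : ℝ) = Real.exp (-Real.log 2) := by rw [Real.exp_neg, Real.exp_log two_pos]; simp
  rw [e, Real.exp_lt_exp, ← neg_div, lt_div_iff₀ hρ]

lemma exp_eq_half_iff (hρ : 0 < ρ) (x : ℝ) :
    Real.exp (x * ρ) = 1 / 2 ↔ x = -(Real.log 2 / ρ) := by
  have e : (1 / 2 : ℝ) = Real.exp (-Real.log 2) := by rw [Real.exp_neg, Real.exp_log two_pos]; simp
  rw [e, Real.exp_eq_exp, ← neg_div, eq_div_iff hρ.ne']

lemma one_sub_rpow_eq (hμ : μ ∈ Set.Ioo (0 : ℝ) 1) : (1 - μ) ^ ρ = Real.exp (-klRate μ 0 * ρ) := by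
  rw [klRate_zero, neg_neg, Real.rpow_def_of_pos (by linarith [hμ.2])]

lemma isRatio_iff (hμ : μ ∈ Set.Ioo (0 : ℝ) 1) (hρ : 0 < ρ) :
    IsRatio μ ρ ν ↔ ν ∈ Set.Ioo 0 μ ∧ klRate μ ν = Real.log 2 / ρ := by
  refine and_congr_right fun hν => ?_
  have h1 : 0 < μ / ν := div_pos hμ.1 hν.1
  have h2 : 0 < (1 - μ) / (1 - ν) := div_pos (by linarith [hμ.2]) (by linarith [hν.2, hμ.2])
  have e : ((μ / ν) ^ ν * ((1 - μ) / (1 - ν)) ^ (1 - ν)) ^ ρ = Real.exp (-klRate μ ν * ρ) := by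
    rw [Real.rpow_def_of_pos h1, Real.rpow_def_of_pos h2, ← Real.exp_add, ← Real.exp_mul, klRate]
    ring_nf
  rw [e, exp_eq_half_iff hρ, neg_inj]

/-- The rate decreases continuously from `klRate μ 0 = -log (1 - μ)` to `klRate μ μ = 0`. The
hypothesis says that `log 2 / ρ` lies strictly between these values. -/
lemma existsUnique_isRatio (hμ : μ ∈ Set.Ioo (0 : ℝ) 1) (hρ : 0 < ρ)
    (h : (1 - μ) ^ ρ < 1 / 2) : ∃! ν : ℝ, IsRatio μ ρ ν := by
  rw [one_sub_rpow_eq hμ, exp_lt_half_iff hρ, neg_lt_neg_iff] at h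
  obtain ⟨hanti, hcont⟩ := klRate_strictAntiOn hμ
  have hlam : 0 < Real.log 2 / ρ := div_pos (Real.log_pos one_lt_two) hρ
  obtain ⟨ν, hν, he⟩ := intermediate_value_Ioo' hμ.1.le hcont
    (show Real.log 2 / ρ ∈ Set.Ioo (klRate μ μ) (klRate μ 0) from ⟨by rwa [klRate_self hμ], h⟩)
  refine ⟨ν, (isRatio_iff hμ hρ).mpr ⟨hν, he⟩, fun ν' hν' => ?_⟩
  obtain ⟨hν', he'⟩ := (isRatio_iff hμ hρ).mp hν'
  exact hanti.injOn (Set.Ioo_subset_Icc_self hν') (Set.Ioo_subset_Icc_self hν) (he'.trans he.symm)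

variable {α β γ : ℝ}

/-- Both cases are one formula: when even nodes without zeros are frequent enough, the extreme
fraction is `0`. -/
lemma Valid.criterion_eq (h : Valid μ α β γ) : criterion μ α β γ ρ ν =
    Real.exp (degRate μ α β γ (if (1 - μ) ^ ρ ≥ 1 / 2 then 0 else ν) * ρ) := by
  have e0 : μ * α + (1 - μ) * β = degZero μ α β := rfl
  have e1 : μ * β + (1 - μ) * γ = degOne μ β γ := rfl
  rw [criterion, e0, e1]
  split_ifs
  · rw [Real.rpow_def_of_pos h.degOne_pos]
    simp [degRate]
  · rw [Real.rpow_def_of_pos h.degZero_pos, Real.rpow_def_of_pos h.degOne_pos, ← Real.exp_add,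
      ← Real.exp_mul, degRate]
    ring_nf

lemma continuous_degRate : Continuous (degRate μ α β γ) := by
  unfold degRate; fun_prop

end Threshold

/-! ### The number of nodes in terms of the number of attributes. -/

section Sizes

/-- The assumption on `l` says that `log n` is asymptotic to `(log 2 / ρ) * l n`; a margin `s` in
the rate absorbs the error. -/
lemma eventually_exp_le {l : ℕ → ℕ} {ρ s : ℝ} (hρ : 0 < ρ) (hs : 0 < s)
    (hl : Tendsto (fun n : ℕ => (l n : ℝ) / Real.logb 2 n) atTop (𝓝 ρ)) :
    ∀ᶠ n : ℕ in atTop, Real.exp ((Real.log 2 / ρ - s) * l n) ≤ n ∧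
      (n : ℝ) ≤ Real.exp ((Real.log 2 / ρ + s) * l n) := by
  have h1 := (hl.const_mul (Real.log 2 / ρ - s)).eventually_lt_const (u := Real.log 2)
    (by rw [sub_mul, div_mul_cancel₀ _ hρ.ne']; linarith [mul_pos hs hρ])
  have h2 := (hl.const_mul (Real.log 2 / ρ + s)).eventually_const_lt (u := Real.log 2)
    (by rw [add_mul, div_mul_cancel₀ _ hρ.ne']; linarith [mul_pos hs hρ])
  filter_upwards [h1, h2, eventually_gt_atTop 1] with n h1 h2 hn
  have hn1 : (1 : ℝ) < n := by exact_mod_cast hn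
  have hlog : 0 < Real.logb 2 n := Real.logb_pos one_lt_two hn1
  have e : Real.log 2 * Real.logb 2 n = Real.log n := by
    rw [Real.logb, mul_div_cancel₀ _ (Real.log_pos one_lt_two).ne']
  rw [← mul_div_assoc, div_lt_iff₀ hlog, e] at h1
  rw [← mul_div_assoc, lt_div_iff₀ hlog, e] at h2
  exact ⟨(Real.le_log_iff_exp_le (by linarith)).mp h1.le,
    (Real.log_le_iff_le_exp (by linarith)).mp h2.le⟩

lemma tendsto_attributes {l : ℕ → ℕ} {ρ : ℝ} (hρ : 0 < ρ)
    (hl : Tendsto (fun n : ℕ => (l n : ℝ) / Real.logb 2 n) atTop (𝓝 ρ)) :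
    Tendsto l atTop atTop := by
  have hlog : Tendsto (fun n : ℕ => Real.logb 2 n) atTop atTop :=
    (Real.tendsto_logb_atTop one_lt_two).comp tendsto_natCast_atTop_atTop
  refine tendsto_natCast_atTop_iff.mp ((hl.pos_mul_atTop hρ hlog).congr' ?_)
  filter_upwards [hlog.eventually_gt_atTop 0] with n hn
  exact div_mul_cancel₀ _ (ne_of_gt hn)

/-- A bound in terms of the number of attributes gives convergence of the probability. -/
lemma whp_of_exp_bound {l : ℕ → ℕ} {ρ s : ℝ} (hρ : 0 < ρ) (hs : 0 < s)
    (hl : Tendsto (fun n : ℕ => (l n : ℝ) / Real.logb 2 n) atTop (𝓝 ρ)) {μ α β γ : I}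
    {Q : ∀ n, SimpleGraph (Fin n) → Prop} {f : ℕ → ℝ} (hf : Tendsto f atTop (𝓝 0))
    (h : ∀ᶠ k : ℕ in atTop, ∀ n : ℕ, Real.exp ((Real.log 2 / ρ - s) * k) ≤ n →
      (n : ℝ) ≤ Real.exp ((Real.log 2 / ρ + s) * k) →
      prob (attrWeight k μ) (pairProb k α β γ)
        (fun _ (ξ : Sym2 (Fin n) → Bool) => ¬ Q n (indGraph ξ)) ≤ f k) :
    WHP l μ α β γ Q := by
  have ht := tendsto_attributes hρ hl
  refine whp_of_prob_le (hf.comp ht) ?_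
  filter_upwards [ht.eventually h, eventually_exp_le hρ hs hl] with n h hn
  exact h n hn.1 hn.2

end Sizes

end MAG

/-! ### The connectedness theorem. -/

theorem theorem4p2 (μ α β γ : I) (hμ₀ : 0 < μ) (hμ₁ : μ < 1)
    (hγ : 0 < γ) (hγβ : γ < β) (hβα : β < α) (hα : α < 1)
    (ρ : ℝ) (hρ : 0 < ρ) (l : ℕ → ℕ)
    (hl : Tendsto (fun n : ℕ => (l n : ℝ) / Real.logb 2 n) atTop (𝓝 ρ)) :
    ((1 - (μ : ℝ)) ^ ρ < 1 / 2 → ∃! ν : ℝ, MAG.IsRatio μ ρ ν) ∧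
    ∀ ν : ℝ, ((1 - (μ : ℝ)) ^ ρ < 1 / 2 → MAG.IsRatio μ ρ ν) →
      (1 / 2 < MAG.criterion μ α β γ ρ ν →
        MAG.WHP l μ α β γ fun _ G => G.Connected) ∧
      (MAG.criterion μ α β γ ρ ν < 1 / 2 →
        MAG.WHP l μ α β γ fun _ G => ¬ G.Connected) := by
  have h : MAG.Valid (μ : ℝ) α β γ := ⟨hμ₀, hμ₁, hγ, hγβ, hβα, hα⟩
  have hμ : (μ : ℝ) ∈ Set.Ioo (0 : ℝ) 1 := ⟨h.μ_pos, h.μ_lt_one⟩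
  have hlam : 0 < Real.log 2 / ρ := div_pos (Real.log_pos one_lt_two) hρ
  obtain ⟨hanti, -⟩ := MAG.klRate_strictAntiOn hμ
  refine ⟨MAG.existsUnique_isRatio hμ hρ, fun ν hν => ?_⟩
  rw [h.criterion_eq, MAG.half_lt_exp_iff hρ, MAG.exp_lt_half_iff hρ]
  constructor
  · intro hc
    obtain ⟨lam', ν', hν'0, hν', hrate, hlam', hlight⟩ : ∃ lam' ν' : ℝ, 0 ≤ ν' ∧ ν' < μ ∧
        0 < Real.log 2 / ρ + MAG.degRate μ α β γ ν' ∧ Real.log 2 / ρ < lam' ∧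
        ∀ k : ℕ, ∑ x : Fin k → Fin 2, (if MAG.zeros x < ν' * k then MAG.attrWeight k μ x else 0) ≤
          Real.exp (-(lam' * k)) := by
      -- In the first case the threshold fraction is `0` and no node lies below it. The sum is then
      -- empty of mass, and any `lam'` above the threshold rate will do.
      split_ifs at hc with hcase
      · refine ⟨Real.log 2 / ρ + 1, 0, le_rfl, h.μ_pos, hc, by linarith, fun k => ?_⟩
        rw [Finset.sum_eq_zero fun x _ => if_neg (by simpa using MAG.zeros_nonneg x)]
        exact (Real.exp_pos _).le
      · obtain ⟨hν, he⟩ := (MAG.isRatio_iff hμ hρ).mp (hν (not_le.mp hcase))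
        -- A fraction slightly below `ν` keeps the degree condition by continuity, while its rate
        -- strictly exceeds `log 2 / ρ`; so no node is lighter.
        obtain ⟨ν', h1, h2⟩ := ((((continuous_const.add
          MAG.continuous_degRate).tendsto ν).eventually_const_lt hc).filter_mono
          nhdsWithin_le_nhds |>.and (Ioo_mem_nhdsLT hν.1)).exists
        have h3 : ν' < μ := h2.2.trans hν.2
        refine ⟨MAG.klRate μ ν', ν', h2.1.le, h3, h1, ?_,
          MAG.sum_attrWeight_zeros_lt_le h.μ_lt_one h2.1 h3⟩
        rw [← he]
        exact hanti ⟨h2.1.le, h3.le⟩ (Set.Ioo_subset_Icc_self hν) h2.2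
    obtain ⟨s, f, hs, hf, H⟩ := h.exists_connected_bound hlam hν'0 hν' hrate hlam' hlight
    exact MAG.whp_of_exp_bound hρ hs hl hf H
  · intro hc
    obtain ⟨ν₀, h0, h1, h2, h3⟩ : ∃ ν₀ : ℝ, 0 ≤ ν₀ ∧ ν₀ < μ ∧
        MAG.degRate μ α β γ ν₀ < -(Real.log 2 / ρ) ∧ MAG.klRate μ ν₀ ≤ Real.log 2 / ρ := by
      split_ifs at hc with hcase
      · refine ⟨0, le_rfl, h.μ_pos, hc, ?_⟩
        rw [ge_iff_le, ← not_lt, MAG.one_sub_rpow_eq hμ, MAG.exp_lt_half_iff hρ,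
          neg_lt_neg_iff, not_lt] at hcase
        exact hcase
      · obtain ⟨hν, he⟩ := (MAG.isRatio_iff hμ hρ).mp (hν (not_le.mp hcase))
        exact ⟨ν, hν.1.le, hν.2, hc, he.le⟩
    -- Conversely, a fraction slightly above `ν₀` keeps the degrees vanishing and has a rate
    -- strictly below `log 2 / ρ`, so such nodes exist. It is also positive, as the tilting
    -- requires.
    obtain ⟨ν', h4, h5⟩ := (((MAG.continuous_degRate.tendsto ν₀).eventually_lt_const
      h2).filter_mono nhdsWithin_le_nhds |>.and (Ioo_mem_nhdsGT h1)).exists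
    have hkl : MAG.klRate μ ν' < Real.log 2 / ρ :=
      (hanti ⟨h0, h1.le⟩ ⟨h0.trans h5.1.le, h5.2.le⟩ h5.1).trans_le h3
    obtain ⟨s, f, hs, hf, H⟩ :=
      h.exists_disconnected_bound hlam (h0.trans_lt h5.1) h5.2 hkl h4
    refine MAG.whp_of_exp_bound hρ hs hl hf ?_
    simpa only [not_not] using H
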